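/- Let $\mathbb D=\{z\in\mathbb C:|z|<1\}$, let $dA=\frac1\pi\,dx\,dy$, and for $1<p<\infty$ and $\mu\in\mathbb R$ let $A^p_\mu$ be the space of analytic $f:\mathbb D\to\mathbb C$ with $\|f\|_{p,\mu}=\left(\int_{\mathbb D}|f(z)|^p(1-|z|)^\mu\,dA(z)\right)^{1/p}<\infty$. For $\alpha>0$ let $A^p_{\alpha+}=\bigcap_{\mu>\alpha}A^p_\mu$, with the locally convex topology generated by the norms $\|\cdot\|_{p,\alpha+1/n}$, $n=1,2,\dots$, and let $A^p_{\alpha-}=\bigcup_{\mu<\alpha}A^p_\mu$, with the finest locally convex topology for which all inclusions $A^p_\mu\hookrightarrow A^p_{\alpha-}$, $\mu<\alpha$, are continuous. The Cesàro operator is $$\mathsf C f(z)=\frac1z\int_0^z\frac{f(\zeta)}{1-\zeta}\,d\zeta\quad(0<|z|<1),\qquad \mathsf C f(0)=f(0).$$ A linear operator $T:X\to X$ on a locally convex space is compact if it maps some neighbourhood of $0$ into a compact set; its spectrum $\sigma(T;X)$ is the set of $\lambda\in\mathbb C$ for which $\lambda I-T$ has no continuous linear inverse on $X$. **Proposition 2.6.**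 Let $1<p<\infty$ and $0<\alpha<\infty$. 1. $\mathsf C$ is a continuous linear operator on $A^p_{\alpha+}$ which is not compact, and its spectrum $\sigma(\mathsf C;A^p_{\alpha+})$ is not a compact subset of $\mathbb C$. 2. $\mathsf C$ is a continuous linear operator on $A^p_{\alpha-}$ which is not compact. The spectrum $\sigma(\mathsf C;A^p_{\alpha-})$ has a nonzero point that is not isolated in it; moreover, every nonzero point of $\sigma(\mathsf C;A^p_{\alpha-})$ that is not an eigenvalue of $\mathsf C$ is non-isolated in it. -/

import Mathlib

open MeasureTheory Metric Filter Topology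
open scoped ENNReal

noncomputable section

namespace Cesaro

/-- The analytic functions on the open unit disc, realised as functions on `ℂ` that are
holomorphic on the disc and extended by `0` outside of it. Extension by zero identifies this with
the space of holomorphic functions on the disc: two elements are equal exactly when they agree on
the disc. -/
def holo : Submodule ℂ (ℂ → ℂ) where
  carrier := {f | DifferentiableOn ℂ f (ball 0 1) ∧ ∀ z ∉ ball (0 : ℂ) 1, f z = 0}
  add_mem' := fun hf hg =>
    ⟨hf.1.add hg.1, fun z hz => by simp [hf.2 z hz, hg.2 z hz]⟩
  zero_mem' := ⟨differentiableOn_const 0, fun _ _ => rfl⟩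
  smul_mem' := fun c _ hf => ⟨hf.1.const_smul c, fun z hz => by simp [hf.2 z hz]⟩

/-- The measure `(1 - |z|)^μ dA(z)` on the open unit disc, where `dA = π⁻¹ dx dy`. -/
def diskMeasure (μ : ℝ) : Measure ℂ :=
  (volume.restrict (ball (0 : ℂ) 1)).withDensity
    fun z => ENNReal.ofReal ((1 - ‖z‖) ^ μ / Real.pi)

/-- The weighted Bergman space `A^p_μ` as a space of functions: the analytic functions on the disc
with `∫ |f|^p (1 - |z|)^μ dA < ∞`. -/
def bergman (p : ℝ≥0∞) (μ : ℝ) : Submodule ℂ (ℂ → ℂ) where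
  carrier := {f | f ∈ holo ∧ MemLp f p (diskMeasure μ)}
  add_mem' := fun hf hg => ⟨holo.add_mem hf.1 hg.1, hf.2.add hg.2⟩
  zero_mem' := ⟨holo.zero_mem, MemLp.zero⟩
  smul_mem' := fun c _ hf => ⟨holo.smul_mem c hf.1, hf.2.const_smul c⟩

theorem eq_zero_of_eLpNorm_eq_zero {p : ℝ≥0∞} (hp : p ≠ 0) {μ : ℝ} {f : ℂ → ℂ}
    (hf : f ∈ bergman p μ) (h : eLpNorm f p (diskMeasure μ) = 0) : f = 0 := by
  have h1 : f =ᵐ[diskMeasure μ] 0 := (eLpNorm_eq_zero_iff hf.2.1 hp).1 h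
  have hm : Measurable fun z : ℂ => ENNReal.ofReal ((1 - ‖z‖) ^ μ / Real.pi) := by fun_prop
  have hac : volume.restrict (ball (0 : ℂ) 1) ≪ diskMeasure μ := by
    refine withDensity_absolutelyContinuous' hm.aemeasurable ?_
    filter_upwards [ae_restrict_mem measurableSet_ball] with z hz
    have hz' : 0 < 1 - ‖z‖ := by simpa using hz
    simp only [ne_eq, ENNReal.ofReal_eq_zero, not_le]
    positivity
  have h2 : f =ᵐ[volume.restrict (ball (0 : ℂ) 1)] 0 := hac.ae_le h1
  have h3 := Measure.eqOn_open_of_ae_eq h2 isOpen_ball hf.1.1.continuousOn continuousOn_const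
  funext z
  by_cases hz : z ∈ ball (0 : ℂ) 1
  · exact h3 hz
  · exact hf.1.2 z hz

/-- The norm `‖f‖_{p,μ} = (∫ |f|^p (1 - |z|)^μ dA)^{1/p}` of `A^p_μ`, as a seminorm. -/
def bergmanNorm (p : ℝ≥0∞) [Fact (1 ≤ p)] (μ : ℝ) : Seminorm ℂ (bergman p μ) :=
  Seminorm.of (fun f => (eLpNorm (f : ℂ → ℂ) p (diskMeasure μ)).toReal)
    (fun f g => by
      rw [← ENNReal.toReal_add f.2.2.2.ne g.2.2.2.ne]
      exact ENNReal.toReal_mono (ENNReal.add_ne_top.2 ⟨f.2.2.2.ne, g.2.2.2.ne⟩)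
        (eLpNorm_add_le f.2.2.1 g.2.2.1 Fact.out))
    (fun c f => by
      rw [Submodule.coe_smul, eLpNorm_const_smul, ENNReal.toReal_mul]
      simp)

/-- The weighted Bergman space `A^p_μ`, to be equipped with its norm. -/
def Bergman (p : ℝ≥0∞) (μ : ℝ) : Type := bergman p μ

instance (p : ℝ≥0∞) (μ : ℝ) : AddCommGroup (Bergman p μ) :=
  inferInstanceAs (AddCommGroup (bergman p μ))

instance (p : ℝ≥0∞) (μ : ℝ) : Module ℂ (Bergman p μ) :=
  inferInstanceAs (Module ℂ (bergman p μ))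

instance (p : ℝ≥0∞) [Fact (1 ≤ p)] (μ : ℝ) : NormedAddCommGroup (Bergman p μ) :=
  AddGroupNorm.toNormedAddCommGroup
    { (bergmanNorm p μ).toAddGroupSeminorm with
      eq_zero_of_map_eq_zero' := fun f hf => by
        have h1 : (eLpNorm f.1 p (diskMeasure μ)).toReal = 0 := hf
        have hp : p ≠ 0 := (lt_of_lt_of_le one_pos (Fact.out : 1 ≤ p)).ne'
        refine Subtype.ext (eq_zero_of_eLpNorm_eq_zero hp f.2 ?_)
        exact ((ENNReal.toReal_eq_zero_iff _).1 h1).resolve_right f.2.2.2.ne }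

instance (p : ℝ≥0∞) [Fact (1 ≤ p)] (μ : ℝ) : NormedSpace ℂ (Bergman p μ) where
  norm_smul_le c f := (map_smul_eq_mul (bergmanNorm p μ) c f).le

/-- The functions in `⋂_{μ > α} A^p_μ`. -/
def bergmanPlus (p : ℝ≥0∞) (α : ℝ) : Submodule ℂ (ℂ → ℂ) where
  carrier := {f | ∀ μ : ℝ, α < μ → f ∈ bergman p μ}
  add_mem' := fun hf hg μ hμ => (bergman p μ).add_mem (hf μ hμ) (hg μ hμ)
  zero_mem' := fun μ _ => (bergman p μ).zero_mem
  smul_mem' := fun c _ hf μ hμ => (bergman p μ).smul_mem c (hf μ hμ)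

theorem bergman_mono {p : ℝ≥0∞} {μ γ : ℝ} (h : μ ≤ γ) : bergman p μ ≤ bergman p γ := by
  intro f hf
  refine ⟨hf.1, hf.2.mono_measure ?_⟩
  refine withDensity_mono ?_
  filter_upwards [ae_restrict_mem measurableSet_ball] with z hz
  have hz' : 0 < 1 - ‖z‖ := by simpa using hz
  have : (1 - ‖z‖) ^ γ ≤ (1 - ‖z‖) ^ μ :=
    Real.rpow_le_rpow_of_exponent_ge hz' (by linarith [norm_nonneg z]) h
  gcongr

/-- The functions in `⋃_{μ < α} A^p_μ`. -/
def bergmanMinus (p : ℝ≥0∞) (α : ℝ) : Submodule ℂ (ℂ → ℂ) where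
  carrier := {f | ∃ μ : ℝ, μ < α ∧ f ∈ bergman p μ}
  add_mem' := by
    rintro f g ⟨μ, hμ, hf⟩ ⟨γ, hγ, hg⟩
    exact ⟨max μ γ, max_lt hμ hγ, (bergman p _).add_mem (bergman_mono (le_max_left _ _) hf)
      (bergman_mono (le_max_right _ _) hg)⟩
  zero_mem' := ⟨α - 1, sub_one_lt α, (bergman p _).zero_mem⟩
  smul_mem' := fun c _ ⟨μ, hμ, hf⟩ => ⟨μ, hμ, (bergman p μ).smul_mem c hf⟩

/-- The space `A^p_{α+} = ⋂_{μ > α} A^p_μ`, to be equipped with its Fréchet topology. -/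
def BergmanPlus (p : ℝ≥0∞) (α : ℝ) : Type := bergmanPlus p α

/-- The space `A^p_{α-} = ⋃_{μ < α} A^p_μ`, to be equipped with its (LB)-topology. -/
def BergmanMinus (p : ℝ≥0∞) (α : ℝ) : Type := bergmanMinus p α

section Plus

variable (p : ℝ≥0∞) (α : ℝ)

instance : AddCommGroup (BergmanPlus p α) := inferInstanceAs (AddCommGroup (bergmanPlus p α))

instance : Module ℂ (BergmanPlus p α) := inferInstanceAs (Module ℂ (bergmanPlus p α))

instance : CoeFun (BergmanPlus p α) (fun _ => ℂ → ℂ) := ⟨fun f => f.1⟩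

/-- The inclusion of `A^p_{α+}` into `A^p_μ` for `μ > α`. -/
def plusToBergman {μ : ℝ} (h : α < μ) : BergmanPlus p α →ₗ[ℂ] bergman p μ :=
  Submodule.inclusion (fun _ hf => hf μ h)

/-- The norms `‖·‖_{p, α + 1/n}`, `n = 1, 2, …`, on `A^p_{α+}`. -/
def plusNorms [Fact (1 ≤ p)] : SeminormFamily ℂ (BergmanPlus p α) ℕ := fun n =>
  (bergmanNorm p (α + 1 / ((n : ℝ) + 1))).comp
    (plusToBergman p α (lt_add_of_pos_right α Nat.one_div_pos_of_nat))

/-- The locally convex topology on `A^p_{α+}` generated by the norms `‖·‖_{p, α + 1/n}`. -/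
instance [Fact (1 ≤ p)] : TopologicalSpace (BergmanPlus p α) :=
  (plusNorms p α).moduleFilterBasis.topology

theorem withSeminorms_plusNorms [Fact (1 ≤ p)] : WithSeminorms (plusNorms p α) := ⟨rfl⟩

instance [Fact (1 ≤ p)] : IsTopologicalAddGroup (BergmanPlus p α) :=
  (withSeminorms_plusNorms p α).topologicalAddGroup

instance [Fact (1 ≤ p)] : ContinuousSMul ℂ (BergmanPlus p α) :=
  (withSeminorms_plusNorms p α).continuousSMul

end Plus

section Minus

variable (p : ℝ≥0∞) (α : ℝ)

instance : AddCommGroup (BergmanMinus p α) := inferInstanceAs (AddCommGroup (bergmanMinus p α))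

instance : Module ℂ (BergmanMinus p α) := inferInstanceAs (Module ℂ (bergmanMinus p α))

instance : CoeFun (BergmanMinus p α) (fun _ => ℂ → ℂ) := ⟨fun f => f.1⟩

/-- The inclusion of `A^p_μ` into `A^p_{α-}` for `μ < α`. -/
def bergmanToMinus {μ : ℝ} (h : μ < α) : Bergman p μ →ₗ[ℂ] BergmanMinus p α :=
  Submodule.inclusion (fun _ hf => ⟨μ, h, hf⟩)

/-- The locally convex vector space topologies on `A^p_{α-}` for which all the inclusions
`A^p_μ → A^p_{α-}`, `μ < α`, are continuous. -/
def minusTopologies [Fact (1 ≤ p)] : Set (TopologicalSpace (BergmanMinus p α)) :=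
  {t | @IsTopologicalAddGroup _ t _ ∧ @ContinuousSMul ℂ _ _ _ t ∧
    @LocallyConvexSpace ℝ _ _ _ _ _ t ∧
    ∀ (μ : ℝ) (h : μ < α), Continuous[_, t] (bergmanToMinus p α h)}

/-- The inductive limit topology on `A^p_{α-}`: the finest locally convex vector space topology
for which all the inclusions `A^p_μ → A^p_{α-}`, `μ < α`, are continuous. -/
instance [Fact (1 ≤ p)] : TopologicalSpace (BergmanMinus p α) := sInf (minusTopologies p α)

instance [Fact (1 ≤ p)] : IsTopologicalAddGroup (BergmanMinus p α) :=
  topologicalAddGroup_sInf fun _ ht => ht.1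

instance [Fact (1 ≤ p)] : ContinuousSMul ℂ (BergmanMinus p α) :=
  continuousSMul_sInf fun _ ht => ht.2.1

end Minus

/-- The value at `z` of the Cesàro transform of `f`: it is `f 0` for `z = 0`, and
`(1 / z) ∫_0^z f(ζ) / (1 - ζ) dζ` for `z ≠ 0`, the integral being taken along the segment
`ζ = t z`, `0 ≤ t ≤ 1`. -/
def cesaro (f : ℂ → ℂ) (z : ℂ) : ℂ :=
  if z = 0 then f 0 else (1 / z) * ∫ t in (0 : ℝ)..1, f (t * z) / (1 - t * z) * z

end Cesaro

end

noncomputable section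

namespace Cesaro

/-! The relation `H = C f` is the differential equation `(1 - z) (z H)' = f`. Put `γ = 1 / λ`. For
`μ ≥ 0` and `λ` not of the form `1 / (m + 1)`, the line `Re γ = (μ + 2) / p` is critical for `λ - C`
on `A^p_μ`: to its left `λ - C` has a bounded inverse (`resolvent_bounded`), to its right high
powers of `z` are outside the range (`not_isCesaro_pow`).

The inverse on multiples of `z^N` comes from `flowInt`, an average over `s` of the weighted
compositions `k ∘ flow s / den s ^ (N + 1)`. For large `N` these have `L^p` norm at most a constant
times `s ^ ((μ + 2) / p - (N + 1))`, so the weight `s ^ (N - γ)` is harmless left of the critical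
line. The degrees below `N` are recovered one at a time with the backward shift; a degree `n` with
`λ = 1 / (n + 1)` yields an eigenfunction instead. To the right, the solution for `z^N` behaves like
a nonzero Beta value times `(1 - x) ^ (-γ)` as `x → 1`, which contradicts the growth estimate
`norm_le_growth_mul`.

On `A^p_{α+}` every `μ > α` counts, so nonreal `γ` on the line `Re γ = (α + 2) / p` give resolvent
points, while everything nonreal to the right is spectrum: the spectrum is not closed. On `A^p_{α-}`
the half-plane to the left contributes only eigenvalues, and any `γ` on or to the right of the line
is a limit of nonreal points strictly to the right, which are spectral.

Compactness fails because `C` gains no growth: `prePeak` is mapped to `peak`, which attains the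
maximal growth of `A^p_μ` at `1 - s`. A compact image of a neighbourhood of `0` would satisfy a
strictly better growth bound. -/

/-! ### The semigroup of self-maps of the disc. -/

/-- The denominator of the semigroup of self-maps `z ↦ s z / (1 - (1 - s) z)` of the disc. -/
def den (s : ℝ) (z : ℂ) : ℂ := 1 - (1 - s) * z

/-- The semigroup of self-maps of the disc that becomes dilation by `s` in the coordinate
`z / (1 - z)`. -/
def flow (s : ℝ) (z : ℂ) : ℂ := s * z / den s z

theorem le_norm_den {s : ℝ} (h1 : s ≤ 1) (z : ℂ) : 1 - (1 - s) * ‖z‖ ≤ ‖den s z‖ := by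
  have h := norm_sub_norm_le (1 : ℂ) ((1 - s) * z)
  have h2 : ‖(1 - (s : ℂ)) * z‖ = (1 - s) * ‖z‖ := by
    rw [norm_mul]
    congr 1
    rw [← Complex.ofReal_one, ← Complex.ofReal_sub, Complex.norm_real, Real.norm_of_nonneg]
    linarith
  rw [h2, norm_one] at h
  exact h

theorem self_le_norm_den {s : ℝ} (h1 : s ≤ 1) {z : ℂ} (hz : ‖z‖ ≤ 1) : s ≤ ‖den s z‖ := by
  have := le_norm_den h1 z
  nlinarith [norm_nonneg z]

theorem one_sub_le_norm_den {s : ℝ} (h0 : 0 ≤ s) (h1 : s ≤ 1) (z : ℂ) :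
    1 - ‖z‖ ≤ ‖den s z‖ := by
  have := le_norm_den h1 z
  nlinarith [norm_nonneg z]

theorem den_ne_zero {s : ℝ} (h0 : 0 ≤ s) (h1 : s ≤ 1) {z : ℂ} (hz : ‖z‖ < 1) : den s z ≠ 0 := by
  have := one_sub_le_norm_den h0 h1 z
  exact norm_pos_iff.1 (by linarith)

/-- Numerator of `1 - ‖flow s z‖ ^ 2`. Both terms on the right are nonnegative for `0 ≤ s ≤ 1` and
`‖z‖ < 1`; dropping the first gives `mul_one_sub_sq_le`. -/
theorem norm_den_sq_sub (s : ℝ) (z : ℂ) :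
    ‖den s z‖ ^ 2 - s ^ 2 * ‖z‖ ^ 2 = (1 - s) * ‖1 - z‖ ^ 2 + s * (1 - ‖z‖ ^ 2) := by
  simp only [← Complex.normSq_eq_norm_sq, Complex.normSq_apply, den]
  simp
  ring

theorem norm_flow (s : ℝ) (h0 : 0 ≤ s) (z : ℂ) : ‖flow s z‖ = s * ‖z‖ / ‖den s z‖ := by
  rw [flow, norm_div, norm_mul, Complex.norm_real, Real.norm_of_nonneg h0]

theorem mul_one_sub_sq_le {s : ℝ} (h0 : 0 ≤ s) (h1 : s ≤ 1) {z : ℂ} (hz : ‖z‖ < 1) :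
    s * (1 - ‖z‖ ^ 2) ≤ ‖den s z‖ ^ 2 * (1 - ‖flow s z‖ ^ 2) := by
  have hd : 0 < ‖den s z‖ := norm_pos_iff.2 (den_ne_zero h0 h1 hz)
  have h := norm_den_sq_sub s z
  have h2 : ‖den s z‖ ^ 2 * (1 - ‖flow s z‖ ^ 2) = ‖den s z‖ ^ 2 - s ^ 2 * ‖z‖ ^ 2 := by
    rw [norm_flow s h0]; field_simp
  rw [h2, h]
  nlinarith [mul_nonneg (sub_nonneg.2 h1) (sq_nonneg ‖1 - z‖)]

theorem norm_flow_lt_one {s : ℝ} (h0 : 0 ≤ s) (h1 : s ≤ 1) {z : ℂ} (hz : ‖z‖ < 1) :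
    ‖flow s z‖ < 1 := by
  have hd : 0 < ‖den s z‖ := norm_pos_iff.2 (den_ne_zero h0 h1 hz)
  rw [norm_flow s h0, div_lt_one hd]
  have := le_norm_den h1 z
  nlinarith [norm_nonneg z]

theorem one_sub_norm_le_flow {s : ℝ} (h0 : 0 < s) (h1 : s ≤ 1) {z : ℂ} (hz : ‖z‖ < 1) :
    1 - ‖z‖ ≤ 2 * s⁻¹ * ‖den s z‖ ^ 2 * (1 - ‖flow s z‖) := by
  have h := mul_one_sub_sq_le h0.le h1 hz
  have hf := norm_flow_lt_one h0.le h1 hz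
  have h3 : s * (1 - ‖z‖) ≤ ‖den s z‖ ^ 2 * (2 * (1 - ‖flow s z‖)) :=
    calc s * (1 - ‖z‖) ≤ s * (1 - ‖z‖ ^ 2) := by
          gcongr; nlinarith [norm_nonneg z]
      _ ≤ _ := h
      _ ≤ _ := by
          gcongr; nlinarith [norm_nonneg (flow s z), sq_nonneg (1 - ‖flow s z‖)]
  calc 1 - ‖z‖ = s⁻¹ * (s * (1 - ‖z‖)) := by field_simp
    _ ≤ s⁻¹ * (‖den s z‖ ^ 2 * (2 * (1 - ‖flow s z‖))) := by gcongr
    _ = _ := by ring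

theorem hasDerivAt_den (s : ℝ) (z : ℂ) : HasDerivAt (den s) (-(1 - s)) z := by
  exact (((hasDerivAt_id z).const_mul (1 - (s : ℂ))).const_sub 1).congr_deriv (by ring)

theorem hasDerivAt_flow {s : ℝ} {z : ℂ} (hd : den s z ≠ 0) :
    HasDerivAt (flow s) (s / den s z ^ 2) z := by
  have h := ((hasDerivAt_id z).const_mul (s : ℂ)).div (hasDerivAt_den s z) hd
  refine h.congr_deriv ?_
  simp only [id, den]
  congr 1
  ring

theorem hasDerivAt_den_param (s : ℝ) (z : ℂ) : HasDerivAt (fun t : ℝ => den t z) z s := by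
  have h : HasDerivAt (fun t : ℝ => (t : ℂ)) 1 s := Complex.ofRealCLM.hasDerivAt
  simpa [den] using ((h.const_sub 1).mul_const z).const_sub 1

/-- Together with `hasDerivAt_flow` this says `s ∂_s flow = z (1 - z) ∂_z flow`, which links the
parameter to the operator `z (1 - z) d/dz` of the Cesàro equation. -/
theorem hasDerivAt_flow_param {s : ℝ} {z : ℂ} (hd : den s z ≠ 0) :
    HasDerivAt (fun t : ℝ => flow t z) (z * (1 - z) / den s z ^ 2) s := by
  have h : HasDerivAt (fun t : ℝ => (t : ℂ)) 1 s := Complex.ofRealCLM.hasDerivAt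
  refine ((h.mul_const z).div (hasDerivAt_den_param s z) hd).congr_deriv ?_
  simp only [den]
  congr 1
  ring

theorem injOn_flow {s : ℝ} (h0 : 0 < s) (h1 : s ≤ 1) : Set.InjOn (flow s) (ball 0 1) := by
  intro z hz w hw h
  have hz' := den_ne_zero h0.le h1 (by simpa using hz)
  have hw' := den_ne_zero h0.le h1 (by simpa using hw)
  have hs : (s : ℂ) ≠ 0 := by exact_mod_cast h0.ne'
  rw [flow, flow, div_eq_div_iff hz' hw'] at h
  have h2 : (s : ℂ) * (z - w) = 0 := by
    simp only [den] at h
    linear_combination h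
  rcases mul_eq_zero.1 h2 with h3 | h3
  · exact absurd h3 hs
  · exact sub_eq_zero.1 h3

theorem continuous_den : Continuous fun x : ℝ × ℂ => den x.1 x.2 := by
  unfold den; fun_prop

theorem measurable_flow : Measurable fun x : ℝ × ℂ => flow x.1 x.2 := by
  unfold flow
  exact (by fun_prop : Continuous fun x : ℝ × ℂ => (x.1 : ℂ) * x.2).measurable.div
    continuous_den.measurable

/-- The real determinant of multiplication by `c` is the algebra norm of `c` over `ℝ`. -/
theorem det_restrictScalars_toSpanSingleton (c : ℂ) :
    ((ContinuousLinearMap.toSpanSingleton ℂ c).restrictScalars ℝ).det = ‖c‖ ^ 2 := by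
  rw [← Complex.normSq_eq_norm_sq, ← Algebra.norm_complex_apply, Algebra.norm_apply]
  unfold ContinuousLinearMap.det
  congr 1
  ext
  all_goals simp [mul_comm]

/-- Change of variables with Jacobian `|flow'| ^ 2`; the image is only part of the disc, hence an
inequality. -/
theorem lintegral_flow {s : ℝ} (h0 : 0 < s) (h1 : s ≤ 1) (g : ℂ → ℝ≥0∞) :
    ∫⁻ z in ball (0 : ℂ) 1, ENNReal.ofReal (s ^ 2 / ‖den s z‖ ^ 4) * g (flow s z)
      ≤ ∫⁻ z in ball (0 : ℂ) 1, g z := by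
  have h := lintegral_image_eq_lintegral_abs_det_fderiv_mul volume
    (f := flow s) (f' := fun z => (ContinuousLinearMap.toSpanSingleton ℂ
      (s / den s z ^ 2)).restrictScalars ℝ) (measurableSet_ball (x := (0 : ℂ)) (ε := 1))
    (fun z hz => ((hasDerivAt_flow (den_ne_zero h0.le h1
      (by simpa using hz))).hasFDerivAt.restrictScalars ℝ).hasFDerivWithinAt)
    (injOn_flow h0 h1) g
  calc _ = ∫⁻ z in flow s '' ball (0 : ℂ) 1, g z := by
        rw [h]
        refine lintegral_congr fun z => ?_
        rw [det_restrictScalars_toSpanSingleton, abs_of_nonneg (by positivity), norm_div, norm_pow,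
          Complex.norm_real, Real.norm_of_nonneg h0.le, div_pow, ← pow_mul]
    _ ≤ _ := by
        refine lintegral_mono_set ?_
        rintro _ ⟨z, hz, rfl⟩
        simpa using norm_flow_lt_one h0.le h1 (by simpa using hz)


/-! ### Norm estimates for the weighted composition operators and their averages. -/

theorem measurable_diskDensity (μ : ℝ) :
    Measurable fun z : ℂ => ENNReal.ofReal ((1 - ‖z‖) ^ μ / Real.pi) := by fun_prop

theorem lintegral_diskMeasure (μ : ℝ) {g : ℂ → ℝ≥0∞} (hg : Measurable g) :
    ∫⁻ z, g z ∂diskMeasure μ =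
      ∫⁻ z in ball (0 : ℂ) 1, ENNReal.ofReal ((1 - ‖z‖) ^ μ / Real.pi) * g z := by
  rw [diskMeasure, lintegral_withDensity_eq_lintegral_mul _ (measurable_diskDensity μ) hg]
  rfl

instance (μ : ℝ) : SFinite (diskMeasure μ) := by
  unfold diskMeasure; infer_instance

/-- The weight accounts for the power `2 μ` of `‖den s z‖` and the Jacobian for the power `4`. By
`he` the leftover exponent `2 μ + 4 - e` is nonpositive, so `‖den s z‖ ≥ s` bounds it by a power of
`s`. -/
theorem weight_le_flow {μ e s : ℝ} (hμ : 0 ≤ μ) (he : 4 + 2 * μ ≤ e) (h0 : 0 < s) (h1 : s ≤ 1)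
    {z : ℂ} (hz : ‖z‖ < 1) :
    (1 - ‖z‖) ^ μ * ‖den s z‖ ^ (-e) ≤
      2 ^ μ * s ^ (μ + 2 - e) * (s ^ 2 / ‖den s z‖ ^ 4 * (1 - ‖flow s z‖) ^ μ) := by
  have hd : 0 < ‖den s z‖ := norm_pos_iff.2 (den_ne_zero h0.le h1 hz)
  have hf : 0 < 1 - ‖flow s z‖ := sub_pos.2 (norm_flow_lt_one h0.le h1 hz)
  set D := ‖den s z‖
  have key : (1 - ‖z‖) ^ μ ≤ 2 ^ μ * s ^ (-μ) * D ^ (2 * μ) * (1 - ‖flow s z‖) ^ μ := by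
    calc (1 - ‖z‖) ^ μ ≤ (2 * s⁻¹ * D ^ 2 * (1 - ‖flow s z‖)) ^ μ :=
          Real.rpow_le_rpow (by linarith) (one_sub_norm_le_flow h0 h1 hz) hμ
      _ = _ := by
          rw [Real.mul_rpow (by positivity) hf.le, Real.mul_rpow (by positivity) (by positivity),
            Real.mul_rpow (by positivity) (by positivity), Real.inv_rpow h0.le,
            Real.rpow_neg h0.le, Real.rpow_mul hd.le, Real.rpow_two]
  have key2 : D ^ (2 * μ + 4 - e) ≤ s ^ (2 * μ + 4 - e) :=
    Real.rpow_le_rpow_of_nonpos h0 (self_le_norm_den h1 hz.le) (by linarith)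
  have e1 : D ^ (2 * μ) * D ^ (-e) = D ^ (2 * μ + 4 - e) / D ^ 4 := by
    rw [← Real.rpow_add hd, ← Real.rpow_natCast D 4, ← Real.rpow_sub hd]
    congr 1; push_cast; ring
  have e2 : s ^ (-μ) * s ^ (2 * μ + 4 - e) = s ^ (μ + 2 - e) * s ^ 2 := by
    rw [← Real.rpow_add h0, ← Real.rpow_natCast s 2, ← Real.rpow_add h0]
    congr 1; push_cast; ring
  calc (1 - ‖z‖) ^ μ * D ^ (-e)
      ≤ 2 ^ μ * s ^ (-μ) * D ^ (2 * μ) * (1 - ‖flow s z‖) ^ μ * D ^ (-e) := by gcongr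
    _ = 2 ^ μ * s ^ (-μ) * (D ^ (2 * μ) * D ^ (-e)) * (1 - ‖flow s z‖) ^ μ := by ring
    _ = 2 ^ μ * s ^ (-μ) * (D ^ (2 * μ + 4 - e) / D ^ 4) * (1 - ‖flow s z‖) ^ μ := by rw [e1]
    _ ≤ 2 ^ μ * s ^ (-μ) * (s ^ (2 * μ + 4 - e) / D ^ 4) * (1 - ‖flow s z‖) ^ μ := by gcongr
    _ = 2 ^ μ * (s ^ (-μ) * s ^ (2 * μ + 4 - e)) / D ^ 4 * (1 - ‖flow s z‖) ^ μ := by ring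
    _ = _ := by rw [e2]; ring

/-- The weighted composition operators induced by the semigroup `flow` are bounded on weighted
Bergman spaces, with a sharp dependence of the norm on `s`. -/
theorem lintegral_den_flow_le {μ e s : ℝ} (hμ : 0 ≤ μ) (he : 4 + 2 * μ ≤ e) (h0 : 0 < s)
    (h1 : s ≤ 1) {g : ℂ → ℝ≥0∞} (hg : Measurable g) :
    ∫⁻ z, ENNReal.ofReal (‖den s z‖ ^ (-e)) * g (flow s z) ∂diskMeasure μ ≤
      ENNReal.ofReal (2 ^ μ * s ^ (μ + 2 - e)) * ∫⁻ z, g z ∂diskMeasure μ := by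
  have hmf : Measurable (flow s) := measurable_flow.comp measurable_prodMk_left
  have hmd : Measurable (den s) := (continuous_den.comp (by fun_prop : Continuous fun z : ℂ =>
    (s, z))).measurable
  rw [lintegral_diskMeasure μ hg, lintegral_diskMeasure μ (by fun_prop)]
  calc _ ≤ ∫⁻ z in ball (0 : ℂ) 1, ENNReal.ofReal (2 ^ μ * s ^ (μ + 2 - e)) *
          (ENNReal.ofReal (s ^ 2 / ‖den s z‖ ^ 4) *
          (ENNReal.ofReal ((1 - ‖flow s z‖) ^ μ / Real.pi) * g (flow s z))) := by
        refine setLIntegral_mono_ae' measurableSet_ball (.of_forall fun z hz => ?_)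
        have hz' : ‖z‖ < 1 := by simpa using hz
        have hf : 0 < 1 - ‖flow s z‖ := sub_pos.2 (norm_flow_lt_one h0.le h1 hz')
        have key : ENNReal.ofReal ((1 - ‖z‖) ^ μ / Real.pi) * ENNReal.ofReal (‖den s z‖ ^ (-e)) ≤
            ENNReal.ofReal (2 ^ μ * s ^ (μ + 2 - e)) * (ENNReal.ofReal (s ^ 2 / ‖den s z‖ ^ 4) *
              ENNReal.ofReal ((1 - ‖flow s z‖) ^ μ / Real.pi)) := by
          have hz0 : 0 < 1 - ‖z‖ := by linarith
          rw [← ENNReal.ofReal_mul (by positivity), ← ENNReal.ofReal_mul (by positivity),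
            ← ENNReal.ofReal_mul (by positivity)]
          refine ENNReal.ofReal_le_ofReal ?_
          have := weight_le_flow hμ he h0 h1 hz'
          calc _ = ((1 - ‖z‖) ^ μ * ‖den s z‖ ^ (-e)) / Real.pi := by ring
            _ ≤ _ := div_le_div_of_nonneg_right this Real.pi_pos.le
            _ = _ := by ring
        calc _ = _ * _ * g (flow s z) := (mul_assoc _ _ _).symm
          _ ≤ _ * g (flow s z) := mul_le_mul' key le_rfl
          _ = _ := by simp only [mul_assoc]
    _ ≤ _ := by
        rw [lintegral_const_mul' _ _ ENNReal.ofReal_ne_top]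
        exact mul_le_mul' le_rfl
          (lintegral_flow h0 h1 fun z => ENNReal.ofReal ((1 - ‖z‖) ^ μ / Real.pi) * g z)

/-- Hölder against the constant one. -/
theorem lintegral_rpow_le {X : Type*} [MeasurableSpace X] (ν : Measure X) {q : ℝ} (hq : 1 < q)
    {f : X → ℝ≥0∞} (hf : AEMeasurable f ν) :
    (∫⁻ x, f x ∂ν) ^ q ≤ ν Set.univ ^ (q - 1) * ∫⁻ x, f x ^ q ∂ν := by
  have hq0 : 0 < q := by linarith
  have hc := Real.HolderConjugate.conjExponent hq
  have h := ENNReal.lintegral_mul_le_Lp_mul_Lq ν hc hf (aemeasurable_const (b := (1 : ℝ≥0∞)))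
  simp only [Pi.mul_apply, mul_one, ENNReal.one_rpow, lintegral_const, one_mul] at h
  calc _ ≤ ((∫⁻ x, f x ^ q ∂ν) ^ (1 / q) * ν Set.univ ^ (1 / q.conjExponent)) ^ q := by gcongr
    _ = _ := by
        rw [ENNReal.mul_rpow_of_nonneg _ _ hq0.le, ← ENNReal.rpow_mul, ← ENNReal.rpow_mul,
          one_div_mul_cancel hq0.ne', ENNReal.rpow_one, mul_comm]
        congr 2
        rw [Real.conjExponent]
        field_simp

/-- The critical line enters here: the `s`-th operator has norm of order `s ^ ((μ + 2) / q - (N +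
1))`, and multiplying by `s ^ (N - a)` leaves a function integrable at `0` exactly under `ha`. -/
theorem lintegral_rpow_lintegral_flow_le {μ q a : ℝ} (hμ : 0 ≤ μ) (hq : 1 < q) (N : ℕ)
    (hN : 4 + 2 * μ ≤ (N + 1) * q) (ha : a * q < μ + 2) :
    ∃ K : ℝ≥0∞, K ≠ ∞ ∧ ∀ g : ℂ → ℝ≥0∞, Measurable g →
      ∫⁻ z, (∫⁻ s in Set.Ioc (0 : ℝ) 1, ENNReal.ofReal (s ^ (N - a)) *
        (ENNReal.ofReal (‖den s z‖ ^ (-(N + 1 : ℝ))) * g (flow s z))) ^ q ∂diskMeasure μ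
      ≤ K * ∫⁻ z, g z ^ q ∂diskMeasure μ := by
  have hq0 : 0 < q := by linarith
  -- The weight splits as `s ^ (N - a) = s ^ (c - 1) * s ^ (-e / q)`. The first factor defines a
  -- finite measure; the second cancels the operator norm. Hölder in `s` and Tonelli then replace
  -- Minkowski's integral inequality.
  set c := (μ + 2) / q - a with hc
  have hc0 : 0 < c := sub_pos.2 (by rwa [lt_div_iff₀ hq0])
  set e := μ + 2 - (N + 1) * q with he
  have hmw : Measurable fun s : ℝ => ENNReal.ofReal (s ^ (c - 1)) := by fun_prop
  set ν : Measure ℝ := (volume.restrict (Set.Ioc (0 : ℝ) 1)).withDensity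
    fun s => ENNReal.ofReal (s ^ (c - 1)) with hν
  have hνtop : ν Set.univ ≠ ∞ := by
    rw [hν, withDensity_apply _ MeasurableSet.univ, Measure.restrict_univ]
    have : IntervalIntegrable (fun s : ℝ => s ^ (c - 1)) volume 0 1 :=
      intervalIntegral.intervalIntegrable_rpow' (by linarith)
    rw [intervalIntegrable_iff_integrableOn_Ioc_of_le zero_le_one] at this
    exact this.lintegral_lt_top.ne
  refine ⟨ν Set.univ ^ (q - 1) * (ENNReal.ofReal (2 ^ μ) * ν Set.univ), ?_, fun g hg => ?_⟩
  · exact ENNReal.mul_ne_top (ENNReal.rpow_ne_top_of_nonneg (by linarith) hνtop)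
      (ENNReal.mul_ne_top ENNReal.ofReal_ne_top hνtop)
  have hmd : Measurable fun x : ℝ × ℂ => den x.1 x.2 := continuous_den.measurable
  have hmf := measurable_flow
  set H : ℝ × ℂ → ℝ≥0∞ := fun x => ENNReal.ofReal (x.1 ^ (-e / q)) *
    (ENNReal.ofReal (‖den x.1 x.2‖ ^ (-(N + 1 : ℝ))) * g (flow x.1 x.2)) with hH
  have hHm : Measurable H := by
    have h1 : Measurable fun x : ℝ × ℂ => g (flow x.1 x.2) := hg.comp hmf
    fun_prop
  have hHz : ∀ z, Measurable fun s => H (s, z) := fun z => hHm.comp measurable_prodMk_right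
  have step1 : ∀ z, ∫⁻ s in Set.Ioc (0 : ℝ) 1, ENNReal.ofReal (s ^ (N - a)) *
        (ENNReal.ofReal (‖den s z‖ ^ (-(N + 1 : ℝ))) * g (flow s z)) = ∫⁻ s, H (s, z) ∂ν := by
    intro z
    rw [hν, lintegral_withDensity_eq_lintegral_mul _ hmw (hHz z)]
    refine setLIntegral_congr_fun measurableSet_Ioc fun s hs => ?_
    simp only [Pi.mul_apply, hH]
    have e1 : (N : ℝ) - a = c - 1 + -e / q := by
      rw [hc, he]
      field_simp
      ring
    rw [e1, Real.rpow_add hs.1, ENNReal.ofReal_mul (Real.rpow_nonneg hs.1.le _), mul_assoc]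
  have step2 : ∀ᵐ s ∂ν, ∫⁻ z, H (s, z) ^ q ∂diskMeasure μ ≤
      ENNReal.ofReal (2 ^ μ) * ∫⁻ z, g z ^ q ∂diskMeasure μ := by
    have hac : ν ≪ volume.restrict (Set.Ioc (0 : ℝ) 1) := withDensity_absolutelyContinuous _ _
    refine hac.ae_le ((ae_restrict_mem measurableSet_Ioc).mono fun s hs => ?_)
    have h := lintegral_den_flow_le hμ hN hs.1 hs.2 (hg.pow_const q)
    have e1 : ∀ z ∈ ball (0 : ℂ) 1, H (s, z) ^ q = ENNReal.ofReal (s ^ (-e)) *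
        (ENNReal.ofReal (‖den s z‖ ^ (-((N + 1) * q : ℝ))) * g (flow s z) ^ q) := by
      intro z hz
      have hd : 0 < ‖den s z‖ := norm_pos_iff.2 (den_ne_zero hs.1.le hs.2 (by simpa using hz))
      simp only [hH]
      rw [ENNReal.mul_rpow_of_nonneg _ _ hq0.le, ENNReal.mul_rpow_of_nonneg _ _ hq0.le,
        ENNReal.ofReal_rpow_of_pos (Real.rpow_pos_of_pos hs.1 _),
        ENNReal.ofReal_rpow_of_pos (Real.rpow_pos_of_pos hd _), ← Real.rpow_mul hs.1.le,
        ← Real.rpow_mul hd.le, div_mul_cancel₀ _ hq0.ne', neg_mul]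
    have hball : ∀ᵐ z ∂diskMeasure μ, z ∈ ball (0 : ℂ) 1 :=
      (withDensity_absolutelyContinuous _ _).ae_le (ae_restrict_mem measurableSet_ball)
    rw [lintegral_congr_ae (hball.mono e1), lintegral_const_mul' _ _ ENNReal.ofReal_ne_top]
    calc _ ≤ ENNReal.ofReal (s ^ (-e)) * (ENNReal.ofReal (2 ^ μ * s ^ e) *
            ∫⁻ z, g z ^ q ∂diskMeasure μ) := by gcongr
      _ = _ := by
          rw [← mul_assoc, ← ENNReal.ofReal_mul (Real.rpow_nonneg hs.1.le _)]
          congr 2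
          rw [mul_left_comm, ← Real.rpow_add hs.1, neg_add_cancel, Real.rpow_zero, mul_one]
  calc _ = ∫⁻ z, (∫⁻ s, H (s, z) ∂ν) ^ q ∂diskMeasure μ := by simp_rw [step1]
    _ ≤ ∫⁻ z, ν Set.univ ^ (q - 1) * ∫⁻ s, H (s, z) ^ q ∂ν ∂diskMeasure μ :=
        lintegral_mono fun z => lintegral_rpow_le ν hq (hHz z).aemeasurable
    _ = ν Set.univ ^ (q - 1) * ∫⁻ z, ∫⁻ s, H (s, z) ^ q ∂ν ∂diskMeasure μ :=
        lintegral_const_mul' _ _ (ENNReal.rpow_ne_top_of_nonneg (by linarith) hνtop)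
    _ = ν Set.univ ^ (q - 1) * ∫⁻ s, ∫⁻ z, H (s, z) ^ q ∂diskMeasure μ ∂ν := by
        rw [lintegral_lintegral_swap]
        exact ((hHm.comp measurable_swap).pow_const q).aemeasurable
    _ ≤ ν Set.univ ^ (q - 1) * ∫⁻ s, ENNReal.ofReal (2 ^ μ) *
          ∫⁻ z, g z ^ q ∂diskMeasure μ ∂ν := by
        exact mul_le_mul' le_rfl (lintegral_mono_ae step2)
    _ = _ := by rw [lintegral_const]; ring


/-! ### Sub-mean value property. -/

theorem measurable_indicator_ball {f : ℂ → ℂ} {c : ℂ} {R : ℝ} (hf : ContinuousOn f (ball c R)) :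
    Measurable ((ball c R).indicator f) := by
  classical
  rw [← Set.piecewise_eq_indicator]
  exact hf.measurable_piecewise continuousOn_const measurableSet_ball

theorem two_pi_mul_enorm_le {f : ℂ → ℂ} {c : ℂ} {R r : ℝ} (hf : DifferentiableOn ℂ f (ball c R))
    (h0 : 0 < r) (hr : r < R) :
    ENNReal.ofReal (2 * Real.pi) * ‖f c‖ₑ ≤
      ∫⁻ θ in Set.Ioo (-Real.pi) Real.pi, ‖f (circleMap c r θ)‖ₑ := by
  have hd : DiffContOnCl ℂ f (ball c |r|) := by
    rw [abs_of_pos h0]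
    refine (hf.mono ?_).diffContOnCl
    rw [closure_ball _ h0.ne']
    exact closedBall_subset_ball hr
  have h := hd.circleAverage
  rw [Real.circleAverage_def] at h
  -- Periodicity moves the circle average from `[0, 2π]` to `(-π, π)`, the angular range of polar
  -- coordinates.
  have hper : Function.Periodic (fun θ => f (circleMap c r θ)) (2 * Real.pi) :=
    fun θ => by simp only [periodic_circleMap c r θ]
  have h2 := hper.intervalIntegral_add_eq (-Real.pi) 0
  rw [zero_add, show -Real.pi + 2 * Real.pi = Real.pi by ring] at h2
  rw [← h2, intervalIntegral.integral_of_le (by linarith [Real.pi_pos]),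
    integral_Ioc_eq_integral_Ioo] at h
  rw [← h, enorm_smul, ← mul_assoc]
  have h3 : ENNReal.ofReal (2 * Real.pi) * ‖(2 * Real.pi)⁻¹‖ₑ = 1 := by
    rw [← ofReal_norm, Real.norm_of_nonneg (by positivity),
      ← ENNReal.ofReal_mul (by positivity), mul_inv_cancel₀ (by positivity), ENNReal.ofReal_one]
  rw [h3, one_mul]
  exact enorm_integral_le_lintegral_enorm _

/-- The area sub-mean value property of `|f|`. -/
theorem area_mul_enorm_le {f : ℂ → ℂ} {c : ℂ} {R : ℝ} (hf : DifferentiableOn ℂ f (ball c R))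
    (hR : 0 < R) :
    ENNReal.ofReal (Real.pi * R ^ 2) * ‖f c‖ₑ ≤ ∫⁻ z in ball c R, ‖f z‖ₑ := by
  -- With the cut-off, the integral over the plane can be translated to `c` and written in polar
  -- coordinates; radii beyond `R` are discarded at the end.
  set g : ℂ → ℝ≥0∞ := (ball c R).indicator fun z => ‖f z‖ₑ with hg
  have hgm : Measurable g := by
    have : Measurable ((ball c R).indicator f) :=
      measurable_indicator_ball hf.continuousOn
    have h2 : g = fun z => ‖(ball c R).indicator f z‖ₑ := by
      funext z
      by_cases hz : z ∈ ball c R <;> simp [hg, hz]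
    rw [h2]
    exact this.enorm
  rw [← lintegral_indicator measurableSet_ball, ← hg,
    ← lintegral_add_left_eq_self (μ := volume) g c, ← Complex.lintegral_comp_polarCoord_symm,
    polarCoord_target, Measure.volume_eq_prod, setLIntegral_prod]
  · have h1 : ∫⁻ r in Set.Ioo 0 R, ENNReal.ofReal r * (ENNReal.ofReal (2 * Real.pi) * ‖f c‖ₑ) =
        ENNReal.ofReal (Real.pi * R ^ 2) * ‖f c‖ₑ := by
      rw [lintegral_mul_const _ (by fun_prop)]
      have : ∫⁻ r in Set.Ioo 0 R, ENNReal.ofReal r = ENNReal.ofReal (R ^ 2 / 2) := by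
        rw [← ofReal_integral_eq_lintegral_ofReal, ← integral_Ioc_eq_integral_Ioo,
          ← intervalIntegral.integral_of_le hR.le, integral_id]
        · simp
        · exact (continuous_id.integrableOn_Icc (a := 0) (b := R)).mono_set Set.Ioo_subset_Icc_self
        · exact (ae_restrict_mem measurableSet_Ioo).mono fun x hx => hx.1.le
      rw [this, ← mul_assoc, ← ENNReal.ofReal_mul (by positivity)]
      congr 2
      ring
    rw [← h1]
    calc _ ≤ ∫⁻ r in Set.Ioo 0 R, ∫⁻ θ in Set.Ioo (-Real.pi) Real.pi,
          ENNReal.ofReal r • g (c + Complex.polarCoord.symm (r, θ)) := by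
          refine setLIntegral_mono_ae' measurableSet_Ioo (.of_forall fun r hr => ?_)
          simp only [smul_eq_mul]
          rw [lintegral_const_mul' _ _ ENNReal.ofReal_ne_top]
          refine mul_le_mul' le_rfl ((two_pi_mul_enorm_le hf hr.1 hr.2).trans_eq ?_)
          refine lintegral_congr fun θ => ?_
          have e1 : c + Complex.polarCoord.symm (r, θ) = circleMap c r θ := by
            rw [Complex.polarCoord_symm_apply, circleMap, Complex.exp_mul_I]
            push_cast
            rfl
          rw [e1, hg, Set.indicator_of_mem]
          rw [mem_ball_iff_norm, circleMap_sub_center, norm_circleMap_zero, abs_of_pos hr.1]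
          exact hr.2
      _ ≤ _ := lintegral_mono_set fun r hr => hr.1
  · refine Measurable.aemeasurable ?_
    have : Measurable fun x : ℝ × ℝ => Complex.polarCoord.symm x := by
      simp only [Complex.polarCoord_symm_apply]
      fun_prop
    fun_prop


/-! ### Weighted Bergman spaces: domination, growth, backward shift. -/

theorem holo_eq_indicator {f : ℂ → ℂ} (hf : f ∈ holo) : (ball (0 : ℂ) 1).indicator f = f := by
  funext z
  by_cases hz : z ∈ ball (0 : ℂ) 1
  · simp [hz]
  · rw [Set.indicator_of_notMem hz, hf.2 z hz]

theorem measurable_of_holo {f : ℂ → ℂ} (hf : f ∈ holo) : Measurable f := by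
  rw [← holo_eq_indicator hf]
  exact measurable_indicator_ball hf.1.continuousOn

theorem indicator_mem_holo {f : ℂ → ℂ} (hf : DifferentiableOn ℂ f (ball 0 1)) :
    (ball (0 : ℂ) 1).indicator f ∈ holo :=
  ⟨hf.congr fun _ hz => Set.indicator_of_mem hz f, fun _ hz => Set.indicator_of_notMem hz f⟩

theorem mem_bergman_of_lt_top {p : ℝ≥0∞} {μ : ℝ} {f : ℂ → ℂ} (hf : f ∈ holo)
    (h : eLpNorm f p (diskMeasure μ) < ∞) : f ∈ bergman p μ :=
  ⟨hf, (measurable_of_holo hf).aestronglyMeasurable, h⟩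

/-- The norm of the weighted Bergman space as a function on all functions. -/
def bnorm (p : ℝ≥0∞) (μ : ℝ) (f : ℂ → ℂ) : ℝ := (eLpNorm f p (diskMeasure μ)).toReal

theorem bnorm_nonneg (p : ℝ≥0∞) (μ : ℝ) (f : ℂ → ℂ) : 0 ≤ bnorm p μ f := ENNReal.toReal_nonneg

theorem ofReal_bnorm {p : ℝ≥0∞} {μ : ℝ} {f : ℂ → ℂ} (hf : f ∈ bergman p μ) :
    ENNReal.ofReal (bnorm p μ f) = eLpNorm f p (diskMeasure μ) :=
  ENNReal.ofReal_toReal hf.2.2.ne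

theorem bnorm_add_le {p : ℝ≥0∞} [Fact (1 ≤ p)] {μ : ℝ} {f g : ℂ → ℂ} (hf : f ∈ bergman p μ)
    (hg : g ∈ bergman p μ) : bnorm p μ (f + g) ≤ bnorm p μ f + bnorm p μ g := by
  rw [bnorm, bnorm, bnorm, ← ENNReal.toReal_add hf.2.2.ne hg.2.2.ne]
  exact ENNReal.toReal_mono (ENNReal.add_ne_top.2 ⟨hf.2.2.ne, hg.2.2.ne⟩)
    (eLpNorm_add_le hf.2.1 hg.2.1 Fact.out)

theorem bnorm_smul (p : ℝ≥0∞) (μ : ℝ) (f : ℂ → ℂ) (c : ℂ) :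
    bnorm p μ (c • f) = ‖c‖ * bnorm p μ f := by
  rw [bnorm, bnorm, eLpNorm_const_smul, ENNReal.toReal_mul, toReal_enorm]

theorem diskMeasure_univ_ne_top {μ : ℝ} (hμ : 0 ≤ μ) : diskMeasure μ Set.univ ≠ ∞ := by
  rw [diskMeasure, withDensity_apply _ MeasurableSet.univ, Measure.restrict_univ]
  refine ne_top_of_le_ne_top (b := ∫⁻ z in ball (0 : ℂ) 1, 1) ?_ ?_
  · rw [lintegral_one, Measure.restrict_apply_univ]
    exact measure_ball_lt_top.ne
  · refine setLIntegral_mono_ae' measurableSet_ball (.of_forall fun z hz => ?_)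
    have hz' : ‖z‖ < 1 := by simpa using hz
    rw [← ENNReal.ofReal_one]
    refine ENNReal.ofReal_le_ofReal ?_
    rw [div_le_one Real.pi_pos]
    calc (1 - ‖z‖) ^ μ ≤ 1 := Real.rpow_le_one (by linarith) (by linarith [norm_nonneg z]) hμ
      _ ≤ Real.pi := by linarith [Real.pi_gt_three]

theorem eLpNorm_le_of_norm_le {p : ℝ≥0∞} [Fact (1 ≤ p)] (hpt : p ≠ ∞) {μ : ℝ} {f h : ℂ → ℂ} {a b : ℝ}
    (ha : 0 ≤ a) (hb : 0 ≤ b) (hf : f ∈ bergman p μ)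
    (hle : ∀ z ∈ ball (0 : ℂ) 1, ‖h z‖ ≤ a * ‖f z‖ + b) :
    eLpNorm h p (diskMeasure μ) ≤ ENNReal.ofReal a * eLpNorm f p (diskMeasure μ) +
      ENNReal.ofReal b * diskMeasure μ Set.univ ^ (1 / p.toReal) := by
  have hball : ∀ᵐ z ∂diskMeasure μ, z ∈ ball (0 : ℂ) 1 :=
    (withDensity_absolutelyContinuous _ _).ae_le (ae_restrict_mem measurableSet_ball)
  have hp : (1 : ℝ≥0∞) ≤ p := Fact.out
  have hp0 : p ≠ 0 := (one_pos.trans_le hp).ne'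
  calc eLpNorm h p (diskMeasure μ)
      ≤ eLpNorm ((fun z => a * ‖f z‖) + fun _ => b) p (diskMeasure μ) :=
        eLpNorm_mono_ae_real (hball.mono hle)
    _ ≤ eLpNorm (fun z => a * ‖f z‖) p (diskMeasure μ) +
          eLpNorm (fun _ => b) p (diskMeasure μ) :=
        eLpNorm_add_le (hf.2.1.norm.const_mul a) aestronglyMeasurable_const hp
    _ = _ := by
        congr 1
        · have := eLpNorm_const_smul a (fun z => ‖f z‖) p (diskMeasure μ)
          rw [eLpNorm_norm, Real.enorm_eq_ofReal ha] at this
          exact this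
        · rw [eLpNorm_const' _ hp0 hpt, Real.enorm_eq_ofReal hb]

/-- A function dominated by `a |f| + b` with `f` in the Bergman space is in the Bergman space. -/
theorem mem_bergman_of_norm_le {p : ℝ≥0∞} [Fact (1 ≤ p)] (hpt : p ≠ ∞) {μ : ℝ} (hμ : 0 ≤ μ)
    {f h : ℂ → ℂ} {a b : ℝ} (ha : 0 ≤ a) (hb : 0 ≤ b) (hf : f ∈ bergman p μ) (hh : h ∈ holo)
    (hle : ∀ z ∈ ball (0 : ℂ) 1, ‖h z‖ ≤ a * ‖f z‖ + b) :
    h ∈ bergman p μ ∧ bnorm p μ h ≤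
      a * bnorm p μ f + b * (diskMeasure μ Set.univ ^ (1 / p.toReal)).toReal := by
  have hM : diskMeasure μ Set.univ ^ (1 / p.toReal) ≠ ∞ :=
    ENNReal.rpow_ne_top_of_nonneg (by positivity) (diskMeasure_univ_ne_top hμ)
  have h1 := eLpNorm_le_of_norm_le hpt ha hb hf hle
  have h2 : ENNReal.ofReal a * eLpNorm f p (diskMeasure μ) ≠ ∞ :=
    ENNReal.mul_ne_top ENNReal.ofReal_ne_top hf.2.2.ne
  have h3 : ENNReal.ofReal b * diskMeasure μ Set.univ ^ (1 / p.toReal) ≠ ∞ :=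
    ENNReal.mul_ne_top ENNReal.ofReal_ne_top hM
  refine ⟨mem_bergman_of_lt_top hh (h1.trans_lt (ENNReal.add_lt_top.2 ⟨h2.lt_top, h3.lt_top⟩)), ?_⟩
  have h4 := ENNReal.toReal_mono (ENNReal.add_ne_top.2 ⟨h2, h3⟩) h1
  rwa [ENNReal.toReal_add h2 h3, ENNReal.toReal_mul, ENNReal.toReal_mul, ENNReal.toReal_ofReal ha,
    ENNReal.toReal_ofReal hb] at h4

theorem mem_bergman_of_bounded {p : ℝ≥0∞} [Fact (1 ≤ p)] (hpt : p ≠ ∞) {μ : ℝ} (hμ : 0 ≤ μ)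
    {h : ℂ → ℂ} {b : ℝ} (hb : 0 ≤ b) (hh : h ∈ holo) (hle : ∀ z ∈ ball (0 : ℂ) 1, ‖h z‖ ≤ b) :
    h ∈ bergman p μ :=
  (mem_bergman_of_norm_le hpt hμ le_rfl hb (bergman p μ).zero_mem hh
    (fun z hz => by simpa using hle z hz)).1

/-- The growth constant of the weighted Bergman space. -/
def growth (p : ℝ≥0∞) (μ : ℝ) (z : ℂ) : ℝ := ((1 - ‖z‖) / 2) ^ (-((μ + 2) / p.toReal))

/-- The pointwise growth estimate for functions in the weighted Bergman space. -/
theorem norm_le_growth_mul {p : ℝ≥0∞} [Fact (1 ≤ p)] (hpt : p ≠ ∞) {μ : ℝ} (hμ : 0 ≤ μ)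
    {f : ℂ → ℂ} (hf : f ∈ bergman p μ) {z : ℂ} (hz : ‖z‖ < 1) :
    ‖f z‖ ≤ growth p μ z * bnorm p μ f := by
  have hp : (1 : ℝ≥0∞) ≤ p := Fact.out
  have hp0 : p ≠ 0 := (one_pos.trans_le hp).ne'
  have hq : 0 < p.toReal := ENNReal.toReal_pos hp0 hpt
  set q := p.toReal with hqdef
  set R := (1 - ‖z‖) / 2 with hR
  have hR0 : 0 < R := by rw [hR]; linarith
  have hsub : ball z R ⊆ ball (0 : ℂ) 1 := by
    refine ball_subset_ball' ?_
    rw [dist_zero_right, hR]; linarith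
  have hπ := Real.pi_pos
  -- On `ball z R` one has `1 - ‖w‖ ≥ R`, so the weight is at least `R ^ μ / π` there. The sub-mean
  -- value inequality and Hölder on this ball then give the estimate.
  have hmeas : volume.restrict (ball z R) ≤
      ENNReal.ofReal (Real.pi * R ^ (-μ)) • diskMeasure μ := by
    refine Measure.le_iff.2 fun s hs => ?_
    rw [Measure.smul_apply, diskMeasure, withDensity_apply _ hs, smul_eq_mul,
      ← lintegral_const_mul' _ _ ENNReal.ofReal_ne_top, Measure.restrict_apply hs,
      Measure.restrict_restrict hs, ← setLIntegral_one]
    refine (lintegral_mono_set (Set.inter_subset_inter_right s hsub)).trans' ?_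
    refine setLIntegral_mono_ae' (hs.inter measurableSet_ball) (.of_forall fun w hw => ?_)
    have hw' : R ≤ 1 - ‖w‖ := by
      have h1 : ‖w - z‖ < R := mem_ball_iff_norm.1 hw.2
      have h2 : ‖w‖ ≤ ‖z‖ + ‖w - z‖ := by simpa using norm_add_le z (w - z)
      rw [hR] at h1 ⊢; linarith
    rw [← ENNReal.ofReal_mul (by positivity), ← ENNReal.ofReal_one]
    refine ENNReal.ofReal_le_ofReal ?_
    have h3 : R ^ μ ≤ (1 - ‖w‖) ^ μ := Real.rpow_le_rpow hR0.le hw' hμ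
    calc (1 : ℝ) = Real.pi * R ^ (-μ) * (R ^ μ / Real.pi) := by
          rw [Real.rpow_neg hR0.le]; field_simp
      _ ≤ _ := by gcongr
  have h1 := area_mul_enorm_le (hf.1.1.mono hsub) hR0
  have h2 := eLpNorm_le_eLpNorm_mul_rpow_measure_univ hp
    (measurable_of_holo hf.1).aestronglyMeasurable (μ := volume.restrict (ball z R))
  rw [eLpNorm_one_eq_lintegral_enorm, Measure.restrict_apply_univ, Complex.volume_ball,
    ENNReal.toReal_one] at h2
  have hvol : ENNReal.ofReal R ^ 2 * NNReal.pi = ENNReal.ofReal (Real.pi * R ^ 2) := by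
    rw [mul_comm, ENNReal.ofReal_mul hπ.le, ENNReal.ofReal_pow hR0.le, ← NNReal.coe_real_pi,
      ENNReal.ofReal_coe_nnreal]
  have h3 := (eLpNorm_mono_measure f hmeas (p := p)).trans (eLpNorm_smul_measure_le _ f p _)
  rw [hvol] at h2
  rw [smul_eq_mul, ← ofReal_bnorm hf, ENNReal.toReal_div, ENNReal.toReal_one, ← hqdef] at h3
  have h4 := h1.trans (h2.trans (mul_le_mul' h3 le_rfl))
  have hb := bnorm_nonneg p μ f
  rw [ENNReal.ofReal_rpow_of_pos (by positivity), ENNReal.ofReal_rpow_of_pos (by positivity),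
    ← ofReal_norm, ← ENNReal.ofReal_mul (by positivity), ← ENNReal.ofReal_mul (by positivity),
    ← ENNReal.ofReal_mul (by positivity), ENNReal.ofReal_le_ofReal_iff (by positivity)] at h4
  -- The powers of `π` combine to a single `π`, so the factor in front of `R ^ (-((μ + 2) / q))` is
  -- the area of the ball and cancels.
  have h5 : (Real.pi * R ^ (-μ)) ^ (1 / q) * (Real.pi * R ^ 2) ^ (1 / (1 : ℝ) - 1 / q) =
      (Real.pi * R ^ 2) * R ^ (-((μ + 2) / q)) := by
    rw [div_one, Real.rpow_sub (by positivity), Real.rpow_one, Real.mul_rpow hπ.le (by positivity),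
      Real.mul_rpow hπ.le (by positivity), ← Real.rpow_natCast R 2, ← Real.rpow_mul hR0.le,
      ← Real.rpow_mul hR0.le]
    have e1 : -μ * (1 / q) = -((μ + 2) / q) + (2 : ℕ) * (1 / q) := by push_cast; ring
    rw [e1, Real.rpow_add hR0]
    field_simp
  rw [growth, ← hR]
  refine le_of_mul_le_mul_left (a := Real.pi * R ^ 2) ?_ (by positivity)
  calc _ ≤ _ := h4
    _ = (Real.pi * R ^ (-μ)) ^ (1 / q) * (Real.pi * R ^ 2) ^ (1 / (1 : ℝ) - 1 / q) *
        bnorm p μ f := by ring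
    _ = _ := by rw [h5]; ring

theorem growth_nonneg {p : ℝ≥0∞} {μ : ℝ} {z : ℂ} (hz : ‖z‖ < 1) : 0 ≤ growth p μ z := by
  unfold growth
  have : 0 ≤ 1 - ‖z‖ := by linarith
  positivity

theorem growth_mono {p : ℝ≥0∞} {μ : ℝ} (hμ : 0 ≤ μ) {z w : ℂ} (h : ‖z‖ ≤ ‖w‖) (hw : ‖w‖ < 1) :
    growth p μ z ≤ growth p μ w := by
  unfold growth
  refine Real.rpow_le_rpow_of_nonpos (by linarith) (by linarith) ?_
  have : 0 ≤ (μ + 2) / p.toReal := by positivity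
  linarith

/-- The backward shift is bounded on weighted Bergman spaces. -/
theorem exists_backward_shift {p : ℝ≥0∞} [Fact (1 ≤ p)] (hpt : p ≠ ∞) {μ : ℝ} (hμ : 0 ≤ μ) :
    ∃ K : ℝ, 0 ≤ K ∧ ∀ f ∈ bergman p μ, ∃ h ∈ bergman p μ,
      (∀ z, f z = (ball (0 : ℂ) 1).indicator (fun _ => f 0) z + z * h z) ∧
      bnorm p μ h ≤ K * bnorm p μ f := by
  set G := growth p μ ((1 / 2 : ℝ) : ℂ) with hG
  have hhalf : ‖((1 / 2 : ℝ) : ℂ)‖ = 1 / 2 := by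
    rw [Complex.norm_real, Real.norm_of_nonneg (by norm_num)]
  have hG0 : 0 ≤ G := growth_nonneg (by rw [hhalf]; norm_num)
  set M := (diskMeasure μ Set.univ ^ (1 / p.toReal)).toReal with hM
  have hM0 : 0 ≤ M := ENNReal.toReal_nonneg
  refine ⟨2 + 4 * G * M, by positivity, fun f hf => ?_⟩
  have hb := bnorm_nonneg p μ f
  have hd : DifferentiableOn ℂ (dslope f 0) (ball 0 1) :=
    (Complex.differentiableOn_dslope (ball_mem_nhds 0 one_pos)).2 hf.1.1
  have hsmall : ∀ z : ℂ, ‖z‖ ≤ 1 / 2 → ‖f z‖ ≤ G * bnorm p μ f := fun z hz =>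
    (norm_le_growth_mul hpt hμ hf (by linarith)).trans (by
      gcongr
      exact growth_mono hμ (by rw [hhalf]; exact hz) (by rw [hhalf]; norm_num))
  have hf0 : ‖f 0‖ ≤ G * bnorm p μ f := hsmall 0 (by simp)
  -- Division by `z` costs at most a factor two for `‖z‖ ≥ 1 / 2`; the maximum principle carries the
  -- bound from that circle inwards.
  have hout : ∀ z : ℂ, 1 / 2 ≤ ‖z‖ → ‖dslope f 0 z‖ ≤ 2 * ‖f z‖ + 2 * (G * bnorm p μ f) := by
    intro z hz
    have hz0 : z ≠ 0 := norm_pos_iff.1 (by linarith)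
    rw [dslope_of_ne _ hz0, slope_def_field, sub_zero, norm_div, div_le_iff₀ (by linarith)]
    have h1 : ‖f z - f 0‖ ≤ ‖f z‖ + G * bnorm p μ f :=
      (norm_sub_le _ _).trans (by linarith)
    have h2 : 0 ≤ ‖f z‖ + G * bnorm p μ f := by positivity
    nlinarith
  have hin : ∀ z : ℂ, ‖z‖ ≤ 1 / 2 → ‖dslope f 0 z‖ ≤ 4 * (G * bnorm p μ f) := by
    intro z hz
    have hdc : DiffContOnCl ℂ (dslope f 0) (ball 0 (1 / 2)) := by
      refine (hd.mono ?_).diffContOnCl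
      rw [closure_ball _ (by norm_num)]
      exact closedBall_subset_ball (by norm_num)
    refine Complex.norm_le_of_forall_mem_frontier_norm_le isBounded_ball hdc (fun w hw => ?_) ?_
    · rw [frontier_ball _ (by norm_num)] at hw
      have hw' : ‖w‖ = 1 / 2 := by simpa using hw
      have := hout w hw'.ge
      have := hsmall w hw'.le
      linarith
    · rw [closure_ball _ (by norm_num)]
      simpa using hz
  have hle : ∀ z ∈ ball (0 : ℂ) 1, ‖(ball (0 : ℂ) 1).indicator (dslope f 0) z‖ ≤
      2 * ‖f z‖ + 4 * (G * bnorm p μ f) := by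
    intro z hz
    rw [Set.indicator_of_mem hz]
    rcases le_total ‖z‖ (1 / 2) with h | h
    · have := hin z h
      have := norm_nonneg (f z)
      linarith
    · have := hout z h
      have : 0 ≤ G * bnorm p μ f := by positivity
      linarith
  have hmem := mem_bergman_of_norm_le hpt hμ (by norm_num) (by positivity) hf
    (indicator_mem_holo hd) hle
  refine ⟨_, hmem.1, fun z => ?_, hmem.2.trans_eq (by rw [← hM]; ring)⟩
  by_cases hz : z ∈ ball (0 : ℂ) 1
  · rw [Set.indicator_of_mem hz, Set.indicator_of_mem hz]
    have := sub_smul_dslope f 0 z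
    rw [sub_zero, smul_eq_mul] at this
    rw [this]; ring
  · rw [Set.indicator_of_notMem hz, Set.indicator_of_notMem hz, hf.1.2 z hz]; simp


/-! ### The flow integral and its differential equation. -/

/-- The kernel `k(flow_s z) / den_s(z)^(N+1)`. -/
def flowKer (N : ℕ) (k : ℂ → ℂ) (s : ℝ) (z : ℂ) : ℂ := k (flow s z) / den s z ^ (N + 1)

/-- The derivative of `flowKer` in `z`. -/
def flowKerDeriv (N : ℕ) (k : ℂ → ℂ) (s : ℝ) (z : ℂ) : ℂ :=
  deriv k (flow s z) * s / den s z ^ (N + 3) +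
    (N + 1) * (1 - s) * k (flow s z) / den s z ^ (N + 2)

/-- The operator `k ↦ ∫₀¹ s^(N-γ) k(flow_s z) / den_s(z)^(N+1) ds`. -/
def flowInt (N : ℕ) (γ : ℂ) (k : ℂ → ℂ) (z : ℂ) : ℂ :=
  ∫ s in (0 : ℝ)..1, (s : ℂ) ^ (N - γ) * flowKer N k s z

section FlowInt

variable {N : ℕ} {γ : ℂ} {k : ℂ → ℂ}

theorem hasDerivAt_flowKer (hk : DifferentiableOn ℂ k (ball 0 1)) {s : ℝ} (h0 : 0 ≤ s)
    (h1 : s ≤ 1) {z : ℂ} (hz : ‖z‖ < 1) :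
    HasDerivAt (flowKer N k s) (flowKerDeriv N k s z) z := by
  have hd := den_ne_zero h0 h1 hz
  have hf : flow s z ∈ ball (0 : ℂ) 1 := by simpa using norm_flow_lt_one h0 h1 hz
  have hk' := (hk.differentiableAt (isOpen_ball.mem_nhds hf)).hasDerivAt
  have h := (hk'.comp z (hasDerivAt_flow hd)).div ((hasDerivAt_den s z).pow (N + 1))
    (pow_ne_zero _ hd)
  refine h.congr_deriv ?_
  simp only [flowKerDeriv, Function.comp, Pi.pow_apply]
  field_simp
  push_cast
  ring

theorem hasDerivAt_flowKer_param (hk : DifferentiableOn ℂ k (ball 0 1)) {s : ℝ} (h0 : 0 ≤ s)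
    (h1 : s ≤ 1) {z : ℂ} (hz : ‖z‖ < 1) :
    HasDerivAt (fun t : ℝ => flowKer N k t z) (deriv k (flow s z) * (z * (1 - z)) /
      den s z ^ (N + 3) - (N + 1) * z * k (flow s z) / den s z ^ (N + 2)) s := by
  have hd := den_ne_zero h0 h1 hz
  have hf : flow s z ∈ ball (0 : ℂ) 1 := by simpa using norm_flow_lt_one h0 h1 hz
  have hk' := (hk.differentiableAt (isOpen_ball.mem_nhds hf)).hasDerivAt
  have h := (hk'.comp s (hasDerivAt_flow_param hd)).div ((hasDerivAt_den_param s z).pow (N + 1))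
    (pow_ne_zero _ hd)
  refine h.congr_deriv ?_
  simp only [Function.comp, Pi.pow_apply]
  field_simp
  push_cast
  ring

theorem continuousOn_flow :
    ContinuousOn (fun x : ℝ × ℂ => flow x.1 x.2) (Set.Icc 0 1 ×ˢ ball 0 1) := by
  unfold flow
  refine ContinuousOn.div (by fun_prop) continuous_den.continuousOn fun x hx => ?_
  exact den_ne_zero hx.1.1 hx.1.2 (by simpa using hx.2)

theorem mapsTo_flow : Set.MapsTo (fun x : ℝ × ℂ => flow x.1 x.2) (Set.Icc 0 1 ×ˢ ball 0 1)
    (ball 0 1) := fun x hx => by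
  simpa using norm_flow_lt_one hx.1.1 hx.1.2 (by simpa using hx.2)

theorem continuousOn_flowKer (hk : DifferentiableOn ℂ k (ball 0 1)) :
    ContinuousOn (fun x : ℝ × ℂ => flowKer N k x.1 x.2) (Set.Icc 0 1 ×ˢ ball 0 1) := by
  unfold flowKer
  refine ContinuousOn.div (hk.continuousOn.comp continuousOn_flow mapsTo_flow)
    (continuous_den.continuousOn.pow _) fun x hx => pow_ne_zero _ ?_
  exact den_ne_zero hx.1.1 hx.1.2 (by simpa using hx.2)

theorem continuousOn_flowKerDeriv (hk : DifferentiableOn ℂ k (ball 0 1)) :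
    ContinuousOn (fun x : ℝ × ℂ => flowKerDeriv N k x.1 x.2) (Set.Icc 0 1 ×ˢ ball 0 1) := by
  have h1 := (hk.deriv isOpen_ball).continuousOn.comp continuousOn_flow mapsTo_flow
  have h2 := hk.continuousOn.comp continuousOn_flow mapsTo_flow
  have h3 : ∀ n : ℕ, ∀ x ∈ (Set.Icc (0 : ℝ) 1 ×ˢ ball (0 : ℂ) 1), den x.1 x.2 ^ n ≠ 0 :=
    fun n x hx => pow_ne_zero _ (den_ne_zero hx.1.1 hx.1.2 (by simpa using hx.2))
  unfold flowKerDeriv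
  refine ContinuousOn.add ?_ ?_
  · refine ContinuousOn.div (h1.mul (by fun_prop)) (continuous_den.continuousOn.pow _) (h3 _)
  · exact ContinuousOn.div (ContinuousOn.mul (by fun_prop) h2)
      (continuous_den.continuousOn.pow _) (h3 _)

theorem norm_cpow_le_one (hγ : γ.re ≤ N) {s : ℝ} (h0 : 0 < s) (h1 : s ≤ 1) :
    ‖(s : ℂ) ^ (N - γ)‖ ≤ 1 := by
  rw [Complex.norm_cpow_eq_rpow_re_of_pos h0]
  exact Real.rpow_le_one h0.le h1 (by simpa using hγ)

theorem continuousOn_ofReal_cpow (c : ℂ) :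
    ContinuousOn (fun s : ℝ => (s : ℂ) ^ c) (Set.Ioc 0 1) := fun s hs =>
  (Complex.continuousAt_ofReal_cpow_const s c (Or.inr hs.1.ne')).continuousWithinAt

theorem intervalIntegrable_cpow_mul (hγ : γ.re ≤ N) {g : ℝ → ℂ} (hg : ContinuousOn g (Set.Icc 0 1)) :
    IntervalIntegrable (fun s : ℝ => (s : ℂ) ^ (N - γ) * g s) volume 0 1 := by
  obtain ⟨C, hC⟩ := isCompact_Icc.exists_bound_of_continuousOn hg
  rw [intervalIntegrable_iff_integrableOn_Ioc_of_le zero_le_one]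
  refine IntegrableOn.of_bound (C := C) (by simp)
    (((continuousOn_ofReal_cpow _).mul (hg.mono Set.Ioc_subset_Icc_self)).aestronglyMeasurable
      measurableSet_Ioc) ?_
  refine (ae_restrict_mem measurableSet_Ioc).mono fun s hs => ?_
  rw [norm_mul]
  have h1 := norm_cpow_le_one hγ hs.1 hs.2
  have h2 := hC s ⟨hs.1.le, hs.2⟩
  have := norm_nonneg (g s)
  nlinarith [norm_nonneg ((s : ℂ) ^ (N - γ))]

theorem continuousOn_slice {g : ℝ × ℂ → ℂ} (hg : ContinuousOn g (Set.Icc 0 1 ×ˢ ball 0 1))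
    {z : ℂ} (hz : z ∈ ball (0 : ℂ) 1) : ContinuousOn (fun s => g (s, z)) (Set.Icc 0 1) :=
  hg.comp (by fun_prop) fun _ hs => ⟨hs, hz⟩

/-- Since `‖s ^ (N - γ)‖ ≤ 1` and the kernel derivative is continuous up to `s = 0`, a constant
dominates the differentiated integrand for `z` in a smaller disc. -/
theorem hasDerivAt_flowInt (hk : DifferentiableOn ℂ k (ball 0 1)) (hγ : γ.re ≤ N) {z : ℂ}
    (hz : ‖z‖ < 1) :
    HasDerivAt (flowInt N γ k) (∫ s in (0 : ℝ)..1, (s : ℂ) ^ (N - γ) * flowKerDeriv N k s z) z := by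
  set r := (1 + ‖z‖) / 2 with hr
  have hzr : ‖z‖ < r := by rw [hr]; linarith
  have hr1 : r < 1 := by rw [hr]; linarith
  have hsub : closedBall (0 : ℂ) r ⊆ ball 0 1 := closedBall_subset_ball hr1
  have hcomp : IsCompact (Set.Icc (0 : ℝ) 1 ×ˢ closedBall (0 : ℂ) r) :=
    isCompact_Icc.prod (isCompact_closedBall _ _)
  obtain ⟨C, hC⟩ := hcomp.exists_bound_of_continuousOn
    ((continuousOn_flowKerDeriv (N := N) hk).mono (Set.prod_mono subset_rfl hsub))
  have hzD : z ∈ ball (0 : ℂ) 1 := by simpa using hz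
  have hmem : ∀ᶠ w in 𝓝 z, w ∈ ball (0 : ℂ) 1 := isOpen_ball.mem_nhds hzD
  refine (intervalIntegral.hasDerivAt_integral_of_dominated_loc_of_deriv_le
    (F := fun z s => (s : ℂ) ^ (N - γ) * flowKer N k s z)
    (F' := fun z s => (s : ℂ) ^ (N - γ) * flowKerDeriv N k s z) (s := ball 0 r)
    (bound := fun _ => C) (isOpen_ball.mem_nhds (by simpa using hzr)) ?_ ?_ ?_ ?_ ?_ ?_).2
  · refine hmem.mono fun w hw => ?_
    exact (intervalIntegrable_iff.1 (intervalIntegrable_cpow_mul hγ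
      (continuousOn_slice (continuousOn_flowKer hk) hw))).aestronglyMeasurable
  · exact intervalIntegrable_cpow_mul hγ (continuousOn_slice (continuousOn_flowKer hk) hzD)
  · exact (intervalIntegrable_iff.1 (intervalIntegrable_cpow_mul hγ
      (continuousOn_slice (continuousOn_flowKerDeriv hk) hzD))).aestronglyMeasurable
  · refine .of_forall fun s hs w hw => ?_
    rw [Set.uIoc_of_le zero_le_one] at hs
    rw [norm_mul]
    have h1 := norm_cpow_le_one hγ hs.1 hs.2
    have h2 := hC (s, w) ⟨⟨hs.1.le, hs.2⟩, ball_subset_closedBall hw⟩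
    have := norm_nonneg (flowKerDeriv N k s w)
    nlinarith [norm_nonneg ((s : ℂ) ^ (N - γ))]
  · exact intervalIntegrable_const
  · refine .of_forall fun s hs w hw => ?_
    rw [Set.uIoc_of_le zero_le_one] at hs
    have hw' : ‖w‖ < 1 := by
      have : ‖w‖ < r := by simpa using hw
      linarith
    exact (hasDerivAt_flowKer hk hs.1.le hs.2 hw').const_mul _

theorem differentiableOn_flowInt (hk : DifferentiableOn ℂ k (ball 0 1)) (hγ : γ.re ≤ N) :
    DifferentiableOn ℂ (flowInt N γ k) (ball 0 1) := fun z hz =>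
  (hasDerivAt_flowInt hk hγ (by simpa using hz)).differentiableAt.differentiableWithinAt

/-- The first-order differential equation solved by `flowInt`. -/
theorem flowInt_ode (hk : DifferentiableOn ℂ k (ball 0 1)) (hγ : γ.re ≤ N) {z : ℂ}
    (hz : ‖z‖ < 1) :
    (N + 1) * (1 - z) * flowInt N γ k z + z * (1 - z) * deriv (flowInt N γ k) z =
      k z + γ * flowInt N γ k z := by
  have hzD : z ∈ ball (0 : ℂ) 1 := by simpa using hz
  have i1 := intervalIntegrable_cpow_mul hγ (continuousOn_slice (continuousOn_flowKer
    (N := N) hk) hzD)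
  have i2 := intervalIntegrable_cpow_mul hγ (continuousOn_slice (continuousOn_flowKerDeriv
    (N := N) hk) hzD)
  have hre : 0 < ((N : ℂ) + 1 - γ).re := by simp; linarith
  have hne : (N : ℂ) + 1 - γ ≠ 0 := fun h => by rw [h] at hre; simp at hre
  -- The integrand is the `s`-derivative of `s ^ (N + 1 - γ) * flowKer N k s z`, because `s ∂_s`
  -- acts on the kernel as `z (1 - z) ∂_z - (N + 1) z`. The boundary values are `k z` at `s = 1` and
  -- `0` at `s = 0`.
  have key : ∫ s in (0 : ℝ)..1, (((N + 1) * (1 - z) - γ) * ((s : ℂ) ^ (N - γ) * flowKer N k s z) +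
      z * (1 - z) * ((s : ℂ) ^ (N - γ) * flowKerDeriv N k s z)) = k z := by
    have hcont : ContinuousOn (fun s : ℝ => (s : ℂ) ^ (N + 1 - γ) * flowKer N k s z)
        (Set.Icc 0 1) := by
      refine ContinuousOn.mul (Complex.continuous_ofReal_cpow_const hre).continuousOn
        (continuousOn_slice (continuousOn_flowKer hk) hzD)
    have h := intervalIntegral.integral_eq_sub_of_hasDerivAt_of_le zero_le_one hcont
      (f' := fun s : ℝ => ((N + 1) * (1 - z) - γ) * ((s : ℂ) ^ (N - γ) * flowKer N k s z) +
        z * (1 - z) * ((s : ℂ) ^ (N - γ) * flowKerDeriv N k s z)) (fun s hs => ?_)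
      ((i1.const_mul _).add (i2.const_mul _))
    · rw [h]
      simp [flowKer, flow, den, Complex.zero_cpow hne]
    · have hd := den_ne_zero hs.1.le hs.2.le hz
      have hs0 : (s : ℂ) ≠ 0 := by exact_mod_cast hs.1.ne'
      have hp : HasDerivAt (fun t : ℝ => (t : ℂ) ^ (N + 1 - γ))
          ((N + 1 - γ) * (s : ℂ) ^ (N - γ)) s := by
        have := (hasDerivAt_id (s : ℂ)).cpow_const (c := N + 1 - γ)
          (Complex.ofReal_mem_slitPlane.2 hs.1)
        have h2 := this.comp_ofReal
        refine h2.congr_deriv ?_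
        simp only [id, mul_one]
        congr 2
        ring
      refine (hp.mul (hasDerivAt_flowKer_param hk hs.1.le hs.2.le hz)).congr_deriv ?_
      have e1 : (s : ℂ) ^ (N + 1 - γ) = (s : ℂ) ^ (N - γ) * s := by
        rw [show (N : ℂ) + 1 - γ = (N - γ) + 1 by ring, Complex.cpow_add _ _ hs0, Complex.cpow_one]
      rw [e1]
      simp only [flowKer, flowKerDeriv]
      field_simp
      simp only [den]
      ring
  rw [intervalIntegral.integral_add (i1.const_mul _) (i2.const_mul _),
    intervalIntegral.integral_const_mul, intervalIntegral.integral_const_mul,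
    ← (hasDerivAt_flowInt hk hγ hz).deriv] at key
  rw [← key]
  unfold flowInt
  ring


end FlowInt

/-! ### The Cesàro operator as a differential equation. -/

/-- `H` is the Cesàro transform of `f` on the disc, in differential form. -/
structure IsCesaro (f H : ℂ → ℂ) : Prop where
  differentiableOn_left : DifferentiableOn ℂ f (ball 0 1)
  differentiableOn_right : DifferentiableOn ℂ H (ball 0 1)
  ode : ∀ z ∈ ball (0 : ℂ) 1, (1 - z) * (H z + z * deriv H z) = f z

theorem one_sub_ne_zero {z : ℂ} (hz : z ∈ ball (0 : ℂ) 1) : 1 - z ≠ 0 := by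
  intro h
  rw [← sub_eq_zero.1 h] at hz
  simp at hz

namespace IsCesaro

variable {f g H G : ℂ → ℂ}

theorem hasDerivAt_right (h : IsCesaro f H) {z : ℂ} (hz : z ∈ ball (0 : ℂ) 1) :
    HasDerivAt H (deriv H z) z :=
  (h.differentiableOn_right.differentiableAt (isOpen_ball.mem_nhds hz)).hasDerivAt

theorem add (h : IsCesaro f H) (h' : IsCesaro g G) :
    IsCesaro (fun z => f z + g z) (fun z => H z + G z) where
  differentiableOn_left := h.1.add h'.1
  differentiableOn_right := h.2.add h'.2
  ode z hz := by
    have hd : deriv (fun z => H z + G z) z = deriv H z + deriv G z :=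
      ((h.hasDerivAt_right hz).add (h'.hasDerivAt_right hz)).deriv
    rw [hd, ← h.ode z hz, ← h'.ode z hz]
    ring

theorem const_mul (h : IsCesaro f H) (c : ℂ) :
    IsCesaro (fun z => c * f z) (fun z => c * H z) where
  differentiableOn_left := h.1.const_mul c
  differentiableOn_right := h.2.const_mul c
  ode z hz := by
    rw [((h.hasDerivAt_right hz).const_mul c).deriv, ← h.ode z hz]
    ring

theorem congr (h : IsCesaro f H) (hf : ∀ z ∈ ball (0 : ℂ) 1, g z = f z)
    (hH : ∀ z ∈ ball (0 : ℂ) 1, G z = H z) : IsCesaro g G where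
  differentiableOn_left := h.1.congr hf
  differentiableOn_right := h.2.congr hH
  ode z hz := by
    have : G =ᶠ[𝓝 z] H := Filter.eventuallyEq_of_mem (isOpen_ball.mem_nhds hz) hH
    rw [this.deriv_eq, hf z hz, hH z hz, h.ode z hz]

/-- The differential form of the Cesàro operator determines its values. -/
theorem cesaro_eq (h : IsCesaro f H) {z : ℂ} (hz : z ∈ ball (0 : ℂ) 1) : cesaro f z = H z := by
  rw [cesaro]
  split_ifs with hz0
  · subst hz0
    simpa using (h.ode 0 hz).symm
  have hmem : ∀ t ∈ Set.Icc (0 : ℝ) 1, (t : ℂ) * z ∈ ball (0 : ℂ) 1 := by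
    intro t ht
    have hz' : ‖z‖ < 1 := by simpa using hz
    rw [mem_ball_zero_iff, norm_mul, Complex.norm_real, Real.norm_of_nonneg ht.1]
    nlinarith [ht.1, ht.2, norm_nonneg z]
  have hd : ∀ t ∈ Set.uIcc (0 : ℝ) 1, HasDerivAt (fun t : ℝ => (t * z) * H (t * z))
      (f (t * z) / (1 - t * z) * z) t := by
    intro t ht
    rw [Set.uIcc_of_le zero_le_one] at ht
    have h0 : HasDerivAt (fun t : ℝ => (t : ℂ) * z) z t := by
      simpa using (Complex.ofRealCLM.hasDerivAt (x := t)).mul_const z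
    refine (h0.mul ((h.hasDerivAt_right (hmem t ht)).comp t h0)).congr_deriv ?_
    have h1 := one_sub_ne_zero (hmem t ht)
    rw [← h.ode _ (hmem t ht), mul_div_cancel_left₀ _ h1]
    simp only [Function.comp]
    ring
  have hc : ContinuousOn (fun t : ℝ => f (t * z) / (1 - t * z) * z) (Set.uIcc 0 1) := by
    rw [Set.uIcc_of_le zero_le_one]
    refine ContinuousOn.mul (ContinuousOn.div ?_ (by fun_prop) fun t ht =>
      one_sub_ne_zero (hmem t ht)) continuousOn_const
    exact h.1.continuousOn.comp (by fun_prop) hmem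
  rw [intervalIntegral.integral_eq_sub_of_hasDerivAt hd hc.intervalIntegrable]
  simp
  field_simp

theorem eqOn (h : IsCesaro f H) (h' : IsCesaro f G) {z : ℂ} (hz : z ∈ ball (0 : ℂ) 1) :
    H z = G z := by rw [← h.cesaro_eq hz, h'.cesaro_eq hz]

end IsCesaro

/-- For a primitive `Φ` of `f / (1 - z)`, the quotient `(Φ z - Φ 0) / z` solves the equation and is
holomorphic at `0`; `cesaro_eq` identifies it with the integral. -/
theorem isCesaro_cesaro {f : ℂ → ℂ} (hf : DifferentiableOn ℂ f (ball 0 1)) :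
    IsCesaro f (cesaro f) := by
  have hg : DifferentiableOn ℂ (fun z => f z / (1 - z)) (ball 0 1) :=
    hf.div (by fun_prop) fun z hz => one_sub_ne_zero hz
  obtain ⟨Φ, hΦ⟩ := hg.isExactOn_ball
  have hΦd : DifferentiableOn ℂ Φ (ball 0 1) := fun z hz =>
    (hΦ z hz).differentiableAt.differentiableWithinAt
  have hd : DifferentiableOn ℂ (dslope Φ 0) (ball 0 1) :=
    (Complex.differentiableOn_dslope (ball_mem_nhds 0 one_pos)).2 hΦd
  have h : IsCesaro f (dslope Φ 0) := by
    refine ⟨hf, hd, fun z hz => ?_⟩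
    have h1 := (hasDerivAt_id z).mul
      ((hd.differentiableAt (isOpen_ball.mem_nhds hz)).hasDerivAt)
    have h2 : (id * dslope Φ 0) = fun w => Φ w - Φ 0 := by
      funext w
      simpa using sub_smul_dslope Φ 0 w
    rw [h2] at h1
    have h3 := h1.unique ((hΦ z hz).sub_const (Φ 0))
    simp only [id, one_mul] at h3
    rw [h3]
    field_simp [one_sub_ne_zero hz]
  exact h.congr (fun _ _ => rfl) fun z hz => h.cesaro_eq hz

/-- `C` is triangular with respect to the order of vanishing at `0`, with diagonal entries `1 / (n +
1)`. This drives all the descents in the degree below. -/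
theorem isCesaro_pow_sub (n : ℕ) :
    IsCesaro (fun z => z ^ n - z ^ (n + 1)) (fun z => z ^ n / (n + 1)) where
  differentiableOn_left := by fun_prop
  differentiableOn_right := by fun_prop
  ode z hz := by
    have hn : (n : ℂ) + 1 ≠ 0 := by exact_mod_cast n.succ_ne_zero
    rw [((hasDerivAt_pow n z).div_const ((n : ℂ) + 1)).deriv]
    rcases n with _ | n
    · simp
    · simp only [Nat.add_sub_cancel]
      field_simp
      push_cast
      ring

/-- The factor `z ^ N` turns `H + z H'` into `z ^ N ((N + 1) W + z W')`, so `flowInt_ode` becomes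
the Cesàro equation. -/
theorem isCesaro_flowInt {N : ℕ} {γ : ℂ} {k : ℂ → ℂ} (hk : DifferentiableOn ℂ k (ball 0 1))
    (hγ : γ.re ≤ N) :
    IsCesaro (fun z => z ^ N * (k z + γ * flowInt N γ k z)) (fun z => z ^ N * flowInt N γ k z) := by
  have hW := differentiableOn_flowInt hk hγ
  refine ⟨by fun_prop, by fun_prop, fun z hz => ?_⟩
  have h1 := (hasDerivAt_pow N z).mul
    ((hW.differentiableAt (isOpen_ball.mem_nhds hz)).hasDerivAt)
  have h2 := flowInt_ode hk hγ (by simpa using hz)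
  have h3 : deriv (fun z => z ^ N * flowInt N γ k z) z = _ := h1.deriv
  rw [h3, ← h2]
  rcases N with _ | n
  · simp; ring
  · simp only [Nat.add_sub_cancel]
    push_cast
    ring

/-- The Cesàro operator has no holomorphic eigenfunctions for `λ ≠ 1 / (n + 1)`. -/
theorem eq_zero_of_isCesaro {f : ℂ → ℂ} {l : ℂ} (hl : ∀ n : ℕ, l * (n + 1) ≠ 1)
    (h : IsCesaro f (fun z => l * f z)) {z : ℂ} (hz : z ∈ ball (0 : ℂ) 1) : f z = 0 := by
  have h0 : (0 : ℂ) ∈ ball (0 : ℂ) 1 := mem_ball_self one_pos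
  have han : AnalyticOnNhd ℂ f (ball 0 1) := h.1.analyticOnNhd isOpen_ball
  suffices hev : ∀ᶠ w in 𝓝 (0 : ℂ), f w = 0 from
    han.eqOn_zero_of_preconnected_of_eventuallyEq_zero (convex_ball 0 1).isPreconnected h0 hev hz
  by_contra hev
  -- Write `f = z ^ n g` with `g 0 ≠ 0`. After division by `z ^ n`, letting `z → 0` yields `l (n +
  -- 1) g 0 = g 0`.
  obtain ⟨n, g, hg, hg0, hfg⟩ := (han 0 h0).exists_eventuallyEq_pow_smul_nonzero_iff.2 hev
  have hev2 : ∀ᶠ w in 𝓝 (0 : ℂ), w ^ n * (l * (1 - w) * ((n + 1) * g w + w * deriv g w) - g w)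
      = 0 := by
    filter_upwards [hfg.eventually_nhds, hg.eventually_analyticAt, isOpen_ball.mem_nhds h0]
      with w hw hgw hwD
    have hode := h.ode w hwD
    have hfd := (h.1.differentiableAt (isOpen_ball.mem_nhds hwD)).hasDerivAt
    have hw' : f =ᶠ[𝓝 w] fun z => z ^ n * g z := hw.mono fun x hx => by simpa using hx
    have hd : deriv f w = n * w ^ (n - 1) * g w + w ^ n * deriv g w := by
      rw [hw'.deriv_eq]
      exact ((hasDerivAt_pow n w).mul hgw.differentiableAt.hasDerivAt).deriv
    rw [(hfd.const_mul l).deriv, hd, hw'.eq_of_nhds] at hode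
    rcases n with _ | n
    · simp at hode ⊢
      linear_combination hode
    · simp only [Nat.add_sub_cancel] at hode
      push_cast at hode ⊢
      linear_combination hode
  have hev3 : ∀ᶠ w in 𝓝[≠] (0 : ℂ), l * (1 - w) * ((n + 1) * g w + w * deriv g w) - g w = 0 := by
    filter_upwards [hev2.filter_mono nhdsWithin_le_nhds, self_mem_nhdsWithin] with w hw hw0
    exact (mul_eq_zero.1 hw).resolve_left (pow_ne_zero _ hw0)
  have hcont : ContinuousAt
      (fun w => l * (1 - w) * ((n + 1) * g w + w * deriv g w) - g w) (0 : ℂ) := by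
    have := hg.continuousAt
    have := hg.deriv.continuousAt
    fun_prop
  have hlim := tendsto_nhds_unique (hcont.tendsto.mono_left nhdsWithin_le_nhds)
    ((tendsto_congr' hev3).2 tendsto_const_nhds)
  simp only [sub_zero, mul_one, zero_mul, add_zero] at hlim
  refine hl n (mul_right_cancel₀ hg0 ?_)
  linear_combination hlim

/-! ### Boundedness of the flow integral and of the Cesàro operator. -/

/-- Only `|s ^ (N - γ)| = s ^ (N - Re γ)` matters, so `lintegral_rpow_lintegral_flow_le` applies
with `a = Re γ`. -/
theorem flowInt_bounded {p : ℝ≥0∞} (hp : 1 < p) (hpt : p ≠ ∞) {μ : ℝ} (hμ : 0 ≤ μ)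
    {N : ℕ} {γ : ℂ} (hN : 4 + 2 * μ ≤ (N + 1) * p.toReal) (hγN : γ.re ≤ N)
    (hγ : γ.re * p.toReal < μ + 2) :
    ∃ K : ℝ, 0 ≤ K ∧ ∀ k ∈ bergman p μ, ∃ h ∈ bergman p μ,
      (∀ z ∈ ball (0 : ℂ) 1, h z = flowInt N γ k z) ∧ bnorm p μ h ≤ K * bnorm p μ k := by
  have hp0 : p ≠ 0 := (one_pos.trans hp).ne'
  have hq : 1 < p.toReal := by
    rw [← ENNReal.toReal_one]
    exact (ENNReal.toReal_lt_toReal ENNReal.one_ne_top hpt).2 hp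
  have hq0 : 0 < p.toReal := by linarith
  obtain ⟨K, hK, hbd⟩ := lintegral_rpow_lintegral_flow_le hμ hq N hN hγ
  refine ⟨(K ^ (1 / p.toReal)).toReal, ENNReal.toReal_nonneg, fun k hk => ?_⟩
  set h := (ball (0 : ℂ) 1).indicator (flowInt N γ k) with hh
  have hholo : h ∈ holo := indicator_mem_holo (differentiableOn_flowInt hk.1.1 hγN)
  have hball : ∀ᵐ z ∂diskMeasure μ, z ∈ ball (0 : ℂ) 1 :=
    (withDensity_absolutelyContinuous _ _).ae_le (ae_restrict_mem measurableSet_ball)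
  have hpt2 : ∀ z ∈ ball (0 : ℂ) 1, ‖h z‖ₑ ≤ ∫⁻ s in Set.Ioc (0 : ℝ) 1,
      ENNReal.ofReal (s ^ (N - γ.re)) *
        (ENNReal.ofReal (‖den s z‖ ^ (-(N + 1 : ℝ))) * ‖k (flow s z)‖ₑ) := by
    intro z hz
    rw [hh, Set.indicator_of_mem hz, flowInt, intervalIntegral.integral_of_le zero_le_one]
    refine (enorm_integral_le_lintegral_enorm _).trans_eq ?_
    refine setLIntegral_congr_fun measurableSet_Ioc fun s hs => ?_
    have hd : 0 < ‖den s z‖ := norm_pos_iff.2 (den_ne_zero hs.1.le hs.2 (by simpa using hz))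
    simp only [flowKer]
    rw [enorm_mul, ← ofReal_norm, Complex.norm_cpow_eq_rpow_re_of_pos hs.1]
    congr 1
    rw [div_eq_mul_inv, enorm_mul, mul_comm]
    congr 1
    rw [← ofReal_norm, norm_inv, norm_pow, Real.rpow_neg hd.le]
    congr 2
    exact_mod_cast (Real.rpow_natCast ‖den s z‖ (N + 1)).symm
  have hle : eLpNorm h p (diskMeasure μ) ≤
      K ^ (1 / p.toReal) * eLpNorm k p (diskMeasure μ) := by
    rw [eLpNorm_eq_lintegral_rpow_enorm_toReal hp0 hpt,
      eLpNorm_eq_lintegral_rpow_enorm_toReal hp0 hpt,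
      ← ENNReal.mul_rpow_of_nonneg _ _ (by positivity)]
    refine ENNReal.rpow_le_rpow ?_ (by positivity)
    refine le_trans ?_ (hbd (fun z => ‖k z‖ₑ) (measurable_of_holo hk.1).enorm)
    exact lintegral_mono_ae (hball.mono fun z hz => ENNReal.rpow_le_rpow (hpt2 z hz) hq0.le)
  have hK' : K ^ (1 / p.toReal) ≠ ∞ := ENNReal.rpow_ne_top_of_nonneg (by positivity) hK
  have hne : K ^ (1 / p.toReal) * eLpNorm k p (diskMeasure μ) ≠ ∞ :=
    ENNReal.mul_ne_top hK' hk.2.2.ne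
  refine ⟨h, mem_bergman_of_lt_top hholo (hle.trans_lt hne.lt_top),
    fun z hz => Set.indicator_of_mem hz _, ?_⟩
  have := ENNReal.toReal_mono hne hle
  rwa [ENNReal.toReal_mul] at this


/-- The constant function one on the disc, extended by zero. -/
def discOne : ℂ → ℂ := (ball (0 : ℂ) 1).indicator fun _ => 1

theorem discOne_apply {z : ℂ} (hz : z ∈ ball (0 : ℂ) 1) : discOne z = 1 :=
  Set.indicator_of_mem hz _

theorem discOne_mem {p : ℝ≥0∞} [Fact (1 ≤ p)] (hpt : p ≠ ∞) {μ : ℝ} (hμ : 0 ≤ μ) :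
    discOne ∈ bergman p μ :=
  mem_bergman_of_bounded hpt hμ zero_le_one (indicator_mem_holo (differentiableOn_const _))
    fun z hz => by rw [discOne_apply hz]; simp

theorem pow_mul_mem {p : ℝ≥0∞} [Fact (1 ≤ p)] (hpt : p ≠ ∞) {μ : ℝ} (hμ : 0 ≤ μ)
    {f : ℂ → ℂ} (hf : f ∈ bergman p μ) (n : ℕ) :
    (fun z => z ^ n * f z) ∈ bergman p μ ∧ bnorm p μ (fun z => z ^ n * f z) ≤ bnorm p μ f := by
  have hh : (fun z => z ^ n * f z) ∈ holo :=
    ⟨DifferentiableOn.mul (by fun_prop) hf.1.1, fun z hz => by simp [hf.1.2 z hz]⟩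
  have := mem_bergman_of_norm_le hpt hμ zero_le_one le_rfl hf hh fun z hz => by
    rw [norm_mul, norm_pow, add_zero]
    gcongr
    exact pow_le_one₀ (norm_nonneg z) (by simpa using (mem_ball_zero_iff.1 hz).le)
  simpa using this

theorem norm_zero_le {p : ℝ≥0∞} [Fact (1 ≤ p)] (hpt : p ≠ ∞) {μ : ℝ} (hμ : 0 ≤ μ)
    {f : ℂ → ℂ} (hf : f ∈ bergman p μ) : ‖f 0‖ ≤ growth p μ 0 * bnorm p μ f :=
  norm_le_growth_mul hpt hμ hf (by simp)

theorem exists_flowInt_exponent {q μ a : ℝ} (hq : 1 < q) :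
    ∃ N : ℕ, 4 + 2 * μ ≤ (N + 1) * q ∧ a ≤ N := by
  obtain ⟨N, hN⟩ := exists_nat_ge (max (max (4 + 2 * μ) a) 0)
  have h1 : 4 + 2 * μ ≤ N := ((le_max_left _ _).trans (le_max_left _ _)).trans hN
  have h2 : a ≤ N := ((le_max_right _ _).trans (le_max_left _ _)).trans hN
  have h3 : (0 : ℝ) ≤ N := (le_max_right _ _).trans hN
  exact ⟨N, by nlinarith, h2⟩

theorem one_lt_toReal {p : ℝ≥0∞} (hp : 1 < p) (hpt : p ≠ ∞) : 1 < p.toReal := by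
  rw [← ENNReal.toReal_one]
  exact (ENNReal.toReal_lt_toReal ENNReal.one_ne_top hpt).2 hp

section

variable {p : ℝ≥0∞} [Fact (1 ≤ p)] {μ : ℝ}

theorem bnorm_smul_add_le {f g : ℂ → ℂ} {c : ℂ} {A B K : ℝ} (hf : f ∈ bergman p μ)
    (hg : g ∈ bergman p μ) (hc : ‖c‖ ≤ A * K) (hgK : bnorm p μ g ≤ B * K) :
    bnorm p μ (c • f + g) ≤ (A * bnorm p μ f + B) * K := by
  have h1 := bnorm_add_le ((bergman p μ).smul_mem c hf) hg
  rw [bnorm_smul] at h1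
  have h2 := mul_le_mul_of_nonneg_right hc (bnorm_nonneg p μ f)
  calc _ ≤ _ := h1
    _ ≤ A * K * bnorm p μ f + B * K := add_le_add h2 hgK
    _ = _ := by ring

/-- The Cesàro operator is bounded on weighted Bergman spaces. -/
theorem cesaro_bounded (hp : 1 < p) (hpt : p ≠ ∞) (hμ : 0 ≤ μ) :
    ∃ K : ℝ, 0 ≤ K ∧ ∀ k ∈ bergman p μ, ∃ H ∈ bergman p μ, IsCesaro k H ∧
      bnorm p μ H ≤ K * bnorm p μ k := by
  obtain ⟨N, hN, -⟩ := exists_flowInt_exponent (μ := μ) (a := 0) (one_lt_toReal hp hpt)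
  -- For `γ = 0`, `C (z ^ N k) = z ^ N * flowInt N 0 k`, which settles degree `N`. The decomposition
  -- `k = k 0 + z h` reduces degree `n` to `n + 1` and the single function `C (z ^ n)`.
  suffices h : ∀ n ≤ N, ∃ K : ℝ, 0 ≤ K ∧ ∀ k ∈ bergman p μ, ∃ H ∈ bergman p μ,
      IsCesaro (fun z => z ^ n * k z) H ∧ bnorm p μ H ≤ K * bnorm p μ k by
    obtain ⟨K, hK, h0⟩ := h 0 (Nat.zero_le _)
    refine ⟨K, hK, fun k hk => ?_⟩
    obtain ⟨H, hH, h1, h2⟩ := h0 k hk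
    exact ⟨H, hH, h1.congr (by simp) (by simp), h2⟩
  intro n hn
  induction hn using Nat.decreasingInduction with
  | self =>
    have hre : (0 : ℂ).re ≤ N := by simp
    obtain ⟨K, hK, hW⟩ := flowInt_bounded hp hpt hμ hN hre (by simp; linarith)
    refine ⟨K, hK, fun k hk => ?_⟩
    obtain ⟨h, hh, heq, hb⟩ := hW k hk
    have hm := pow_mul_mem hpt hμ hh N
    refine ⟨_, hm.1, (isCesaro_flowInt hk.1.1 hre).congr (fun z _ => by simp)
      (fun z hz => by simp only [heq z hz]), hm.2.trans hb⟩
  | of_succ n hn ih =>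
    obtain ⟨K, hK, ih⟩ := ih
    obtain ⟨U, hU, hU1, -⟩ := ih discOne (discOne_mem hpt hμ)
    obtain ⟨KB, hKB, hB⟩ := exists_backward_shift hpt hμ (p := p)
    have hm := (pow_mul_mem hpt hμ (discOne_mem hpt hμ) n (p := p)).1
    -- This is `C (z ^ n)`, computed from `z ^ n = (z ^ n - z ^ (n + 1)) + z ^ (n + 1)`.
    set e : ℂ → ℂ := (1 / ((n : ℂ) + 1)) • (fun z => z ^ n * discOne z) + U with he
    have hemem : e ∈ bergman p μ :=
      (bergman p μ).add_mem ((bergman p μ).smul_mem _ hm) hU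
    have heC : IsCesaro (fun z => z ^ n) e := by
      refine ((isCesaro_pow_sub n).add hU1).congr (fun z hz => ?_) (fun z hz => ?_)
      · rw [discOne_apply hz]; ring
      · simp only [he, Pi.add_apply, Pi.smul_apply, smul_eq_mul, discOne_apply hz]; ring
    have hg0 : 0 ≤ growth p μ 0 := growth_nonneg (by simp)
    have hbe := bnorm_nonneg p μ e
    refine ⟨growth p μ 0 * bnorm p μ e + K * KB, by positivity, fun k hk => ?_⟩
    obtain ⟨h, hh, hkh, hhb⟩ := hB k hk
    obtain ⟨H, hH, hH1, hHb⟩ := ih h hh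
    refine ⟨k 0 • e + H, (bergman p μ).add_mem ((bergman p μ).smul_mem _ hemem) hH, ?_, ?_⟩
    · refine ((heC.const_mul (k 0)).add hH1).congr (fun z hz => ?_) (fun z hz => rfl)
      rw [hkh z, Set.indicator_of_mem hz]; ring
    · refine bnorm_smul_add_le hemem hH (norm_zero_le hpt hμ hk) ?_
      calc _ ≤ K * bnorm p μ h := hHb
        _ ≤ K * (KB * bnorm p μ k) := by gcongr
        _ = _ := by ring

/-! ### Resolvent estimates and eigenfunctions. -/

/-- The equation `(λ - C) f = z^n k` can be solved boundedly with a zero of order `n` at the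
origin. -/
def SolvableFrom (p : ℝ≥0∞) (μ : ℝ) (l : ℂ) (n : ℕ) : Prop :=
  ∃ K : ℝ, 0 ≤ K ∧ ∀ k ∈ bergman p μ, ∃ f ∈ bergman p μ,
    IsCesaro (fun z => z ^ n * f z) (fun z => l * (z ^ n * f z) - z ^ n * k z) ∧
      bnorm p μ f ≤ K * bnorm p μ k

/-- The function is `e = 1 - z + l z f`, with `f` the degree `n + 1` solution for `k = 1`. It
satisfies `(l - C) (z ^ n e) = (l - 1 / (n + 1)) z ^ n`: either degree `n` becomes solvable, or `l =
1 / (n + 1)` and `z ^ n e` is an eigenfunction. -/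
theorem SolvableFrom.exists_of_succ (hpt : p ≠ ∞) (hμ : 0 ≤ μ) {l : ℂ} {n : ℕ}
    (h : SolvableFrom p μ l (n + 1)) :
    ∃ e ∈ bergman p μ, e 0 = 1 ∧ IsCesaro (fun z => z ^ n * e z)
      (fun z => l * (z ^ n * e z) - (l - 1 / (n + 1)) * z ^ n) := by
  obtain ⟨K, -, h⟩ := h
  have h1 := discOne_mem hpt hμ (p := p)
  obtain ⟨f, hf, hC, -⟩ := h discOne h1
  have hm1 := (pow_mul_mem hpt hμ h1 1).1
  have hmf := (pow_mul_mem hpt hμ hf 1).1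
  refine ⟨discOne + (l • (fun z => z ^ 1 * f z) + (-1 : ℂ) • fun z => z ^ 1 * discOne z),
    (bergman p μ).add_mem h1 ((bergman p μ).add_mem ((bergman p μ).smul_mem _ hmf)
      ((bergman p μ).smul_mem _ hm1)), ?_, ?_⟩
  · simp [discOne]
  · refine ((isCesaro_pow_sub n).add (hC.const_mul l)).congr (fun z hz => ?_) (fun z hz => ?_)
    all_goals
      simp only [Pi.add_apply, Pi.smul_apply, smul_eq_mul, discOne_apply hz]
      ring

/-- With `W = flowInt N γ k`, the solution is `γ k + γ ^ 2 W`, since `C (z ^ N (k + γ W)) = z ^ N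
W`. -/
theorem solvableFrom_large (hp : 1 < p) (hpt : p ≠ ∞) (hμ : 0 ≤ μ) {γ : ℂ} (hγ0 : γ ≠ 0)
    (hγ : γ.re * p.toReal < μ + 2) (n : ℕ) : ∃ N, n ≤ N ∧ SolvableFrom p μ γ⁻¹ N := by
  obtain ⟨N, hN, ha⟩ := exists_flowInt_exponent (μ := μ) (a := max γ.re n) (one_lt_toReal hp hpt)
  have hre : γ.re ≤ N := (le_max_left _ _).trans ha
  have hn : n ≤ N := by exact_mod_cast (le_max_right _ _).trans ha
  obtain ⟨K, hK, hW⟩ := flowInt_bounded hp hpt hμ hN hre hγ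
  refine ⟨N, hn, ‖γ‖ + ‖γ ^ 2‖ * K, by positivity, fun k hk => ?_⟩
  obtain ⟨h, hh, heq, hb⟩ := hW k hk
  refine ⟨γ • k + γ ^ 2 • h, (bergman p μ).add_mem ((bergman p μ).smul_mem _ hk)
    ((bergman p μ).smul_mem _ hh), ?_, ?_⟩
  · refine ((isCesaro_flowInt hk.1.1 hre).const_mul γ).congr (fun z hz => ?_) (fun z hz => ?_)
    all_goals
      simp only [Pi.add_apply, Pi.smul_apply, smul_eq_mul, heq z hz]
      field_simp
      try ring
  · have h1 := bnorm_add_le ((bergman p μ).smul_mem γ hk) ((bergman p μ).smul_mem (γ ^ 2) hh)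
    rw [bnorm_smul, bnorm_smul] at h1
    calc _ ≤ _ := h1
      _ ≤ ‖γ‖ * bnorm p μ k + ‖γ ^ 2‖ * (K * bnorm p μ k) := by gcongr
      _ = _ := by ring

/-- Split `z ^ n k = k 0 z ^ n + z ^ (n + 1) g`. The first term is solved by a multiple of `z ^ n e`
because `l ≠ 1 / (n + 1)`, the second by hypothesis. -/
theorem SolvableFrom.of_succ (hpt : p ≠ ∞) (hμ : 0 ≤ μ) {l : ℂ} {n : ℕ}
    (hl : l * (n + 1) ≠ 1) (h : SolvableFrom p μ l (n + 1)) : SolvableFrom p μ l n := by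
  obtain ⟨e, he, -, heC⟩ := h.exists_of_succ hpt hμ
  obtain ⟨K, hK, h⟩ := h
  obtain ⟨KB, hKB, hB⟩ := exists_backward_shift hpt hμ (p := p)
  have hn : (n : ℂ) + 1 ≠ 0 := by exact_mod_cast n.succ_ne_zero
  set δ := l - 1 / ((n : ℂ) + 1) with hδdef
  have hδ : δ ≠ 0 := by
    intro h0
    apply hl
    rw [sub_eq_zero.1 h0]
    field_simp
  have hg0 : 0 ≤ growth p μ 0 := growth_nonneg (by simp)
  have hbe := bnorm_nonneg p μ e
  refine ⟨‖δ⁻¹‖ * growth p μ 0 * bnorm p μ e + K * KB, by positivity, fun k hk => ?_⟩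
  obtain ⟨g, hg, hkg, hgb⟩ := hB k hk
  obtain ⟨f, hf, hfC, hfb⟩ := h g hg
  have hmf := pow_mul_mem hpt hμ hf 1
  refine ⟨(δ⁻¹ * k 0) • e + fun z => z ^ 1 * f z,
    (bergman p μ).add_mem ((bergman p μ).smul_mem _ he) hmf.1, ?_, ?_⟩
  · refine ((heC.const_mul (δ⁻¹ * k 0)).add hfC).congr (fun z hz => ?_) (fun z hz => ?_)
    · simp only [Pi.add_apply, Pi.smul_apply, smul_eq_mul]
      ring
    · rw [hkg z, Set.indicator_of_mem hz]
      simp only [Pi.add_apply, Pi.smul_apply, smul_eq_mul]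
      field_simp
      ring
  · refine bnorm_smul_add_le he hmf.1 ?_ ?_
    · rw [norm_mul, mul_assoc]
      gcongr
      exact norm_zero_le hpt hμ hk
    · calc _ ≤ _ := hmf.2
        _ ≤ K * bnorm p μ g := hfb
        _ ≤ K * (KB * bnorm p μ k) := by gcongr
        _ = _ := by ring

theorem solvableFrom_of_forall (hp : 1 < p) (hpt : p ≠ ∞) (hμ : 0 ≤ μ) {l : ℂ} (hl0 : l ≠ 0)
    (hl : l⁻¹.re * p.toReal < μ + 2) (n : ℕ) (hn : ∀ m : ℕ, n ≤ m → l * (m + 1) ≠ 1) :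
    SolvableFrom p μ l n := by
  obtain ⟨N, hN, h⟩ := solvableFrom_large hp hpt hμ (inv_ne_zero hl0) hl n
  rw [inv_inv] at h
  refine Nat.decreasingInduction' (P := fun m => SolvableFrom p μ l m) (fun m _ hm ih => ?_) hN h
  exact ih.of_succ hpt hμ (hn m hm)

/-- The resolvent of the Cesàro operator on weighted Bergman spaces. -/
theorem resolvent_bounded (hp : 1 < p) (hpt : p ≠ ∞) (hμ : 0 ≤ μ) {l : ℂ} (hl0 : l ≠ 0)
    (hl : l⁻¹.re * p.toReal < μ + 2) (hn : ∀ m : ℕ, l * (m + 1) ≠ 1) :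
    ∃ K : ℝ, 0 ≤ K ∧ ∀ k ∈ bergman p μ, ∃ f ∈ bergman p μ, IsCesaro f (fun z => l * f z - k z) ∧
      bnorm p μ f ≤ K * bnorm p μ k := by
  obtain ⟨K, hK, h⟩ := solvableFrom_of_forall hp hpt hμ hl0 hl 0 fun m _ => hn m
  refine ⟨K, hK, fun k hk => ?_⟩
  obtain ⟨f, hf, hC, hb⟩ := h k hk
  exact ⟨f, hf, hC.congr (by simp) (by simp), hb⟩

/-- The reciprocals `1 / (n + 1)` that are not too small are eigenvalues. -/
theorem exists_eigenfunction (hp : 1 < p) (hpt : p ≠ ∞) (hμ : 0 ≤ μ) {l : ℂ} {n : ℕ}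
    (hl : l⁻¹.re * p.toReal < μ + 2) (hn : l * (n + 1) = 1) :
    ∃ f ∈ bergman p μ, f ≠ 0 ∧ IsCesaro f (fun z => l * f z) := by
  have hl0 : l ≠ 0 := by rintro rfl; simp at hn
  have hn0 : (n : ℂ) + 1 ≠ 0 := by exact_mod_cast n.succ_ne_zero
  -- The only exceptional degree is `n` itself, so all degrees from `n + 1` on are solvable.
  have h := solvableFrom_of_forall hp hpt hμ hl0 hl (n + 1) fun m hm heq => by
    have h1 : (m : ℂ) + 1 = n + 1 := mul_left_cancel₀ hl0 (heq.trans hn.symm)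
    have h2 : m = n := by exact_mod_cast add_right_cancel h1
    omega
  obtain ⟨e, he, he0, hC⟩ := h.exists_of_succ hpt hμ
  refine ⟨_, (pow_mul_mem hpt hμ he n).1, fun h0 => ?_, hC.congr (fun _ _ => rfl) fun z _ => ?_⟩
  · have hc : ContinuousAt e 0 :=
      (he.1.1.differentiableAt (ball_mem_nhds 0 one_pos)).continuousAt
    have hev : ∀ᶠ z in 𝓝[≠] (0 : ℂ), e z = 0 := by
      filter_upwards [self_mem_nhdsWithin] with z hz
      exact (mul_eq_zero.1 (congrFun h0 z)).resolve_left (pow_ne_zero _ hz)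
    have := tendsto_nhds_unique (hc.tendsto.mono_left nhdsWithin_le_nhds)
      ((tendsto_congr' hev).2 tendsto_const_nhds)
    rw [he0] at this
    exact one_ne_zero this
  · have : l = 1 / ((n : ℂ) + 1) := by rw [eq_div_iff hn0, hn]
    rw [this, sub_self]; ring

end


/-! ### Behaviour at the boundary point one and failure of surjectivity. -/

theorem ofReal_mem_ball {x : ℝ} (h0 : 0 ≤ x) (h1 : x < 1) : (x : ℂ) ∈ ball (0 : ℂ) 1 := by
  rw [mem_ball_zero_iff, Complex.norm_real, Real.norm_of_nonneg h0]
  exact h1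

/-- `x ^ (N + 1 - γ) (1 - x) ^ γ` is an integrating factor for `flowInt_ode` with `k = 1` on the
real segment; an incomplete Beta integral results. -/
theorem flowInt_one_eq_integral {N : ℕ} {γ : ℂ} (h0 : 0 < γ.re) (hγ : γ.re ≤ N) {x : ℝ}
    (hx0 : 0 ≤ x) (hx1 : x < 1) :
    (x : ℂ) ^ (N + 1 - γ) * (1 - x : ℂ) ^ γ * flowInt N γ (fun _ => 1) x =
      ∫ t in (0 : ℝ)..x, (t : ℂ) ^ (N + 1 - γ - 1) * (1 - (t : ℂ)) ^ (γ - 1) := by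
  have hk : DifferentiableOn ℂ (fun _ : ℂ => (1 : ℂ)) (ball 0 1) := differentiableOn_const _
  have hre : 0 < ((N : ℂ) + 1 - γ).re := by simp; linarith
  have hne : (N : ℂ) + 1 - γ ≠ 0 := fun h => by rw [h] at hre; simp at hre
  have hslit : ∀ t : ℝ, t < 1 → (1 - t : ℂ) ∈ Complex.slitPlane := fun t ht => by
    rw [← Complex.ofReal_one, ← Complex.ofReal_sub]
    exact Complex.ofReal_mem_slitPlane.2 (by linarith)
  have hint : IntervalIntegrable
      (fun t : ℝ => (t : ℂ) ^ (N + 1 - γ - 1) * (1 - (t : ℂ)) ^ (γ - 1)) volume 0 x := by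
    refine (Complex.betaIntegral_convergent hre h0).mono_set ?_
    rw [Set.uIcc_of_le hx0, Set.uIcc_of_le zero_le_one]
    exact Set.Icc_subset_Icc_right hx1.le
  have hcont : ContinuousOn (fun t : ℝ => (t : ℂ) ^ (N + 1 - γ) * (1 - t : ℂ) ^ γ *
      flowInt N γ (fun _ => 1) t) (Set.Icc 0 x) := by
    refine ((Complex.continuous_ofReal_cpow_const hre).continuousOn.mul ?_).mul ?_
    · exact ContinuousOn.cpow_const (by fun_prop) fun t ht => hslit t (ht.2.trans_lt hx1)
    · exact (differentiableOn_flowInt hk hγ).continuousOn.comp (by fun_prop)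
        fun t ht => ofReal_mem_ball ht.1 (ht.2.trans_lt hx1)
  rw [intervalIntegral.integral_eq_sub_of_hasDerivAt_of_le hx0 hcont (fun t ht => ?_) hint]
  · simp [Complex.zero_cpow hne]
  · have ht1 : t < 1 := ht.2.trans hx1
    have ht0 : (t : ℂ) ≠ 0 := by exact_mod_cast ht.1.ne'
    have h1t : (1 - t : ℂ) ≠ 0 := Complex.slitPlane_ne_zero (hslit t ht1)
    have hmem := ofReal_mem_ball ht.1.le ht1
    have d1 := (hasDerivAt_id (t : ℂ)).cpow_const (c := N + 1 - γ)
      (Complex.ofReal_mem_slitPlane.2 ht.1)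
    have d2 := ((hasDerivAt_id (t : ℂ)).const_sub 1).cpow_const (c := γ) (hslit t ht1)
    have d3 := ((differentiableOn_flowInt hk hγ).differentiableAt
      (isOpen_ball.mem_nhds hmem)).hasDerivAt
    refine ((d1.mul d2).mul d3).comp_ofReal.congr_deriv ?_
    have hode := flowInt_ode hk hγ (mem_ball_zero_iff.1 hmem)
    have e1 : (t : ℂ) ^ (N + 1 - γ) = (t : ℂ) ^ (N + 1 - γ - 1) * t := by
      rw [Complex.cpow_sub _ 1 ht0, Complex.cpow_one]; field_simp
    have e2 : (1 - t : ℂ) ^ γ = (1 - t : ℂ) ^ (γ - 1) * (1 - t) := by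
      rw [Complex.cpow_sub _ 1 h1t, Complex.cpow_one]; field_simp
    simp only [id, Pi.mul_apply]
    rw [e1, e2]
    linear_combination ((t : ℂ) ^ (N + 1 - γ - 1) * (1 - t : ℂ) ^ (γ - 1)) * hode

theorem tendsto_flowInt_one {N : ℕ} {γ : ℂ} (h0 : 0 < γ.re) (hγ : γ.re ≤ N) :
    Tendsto (fun x : ℝ => (1 - x : ℂ) ^ γ * flowInt N γ (fun _ => 1) x) (𝓝[<] 1)
      (𝓝 (Complex.betaIntegral (N + 1 - γ) γ)) := by
  have hre : 0 < ((N : ℂ) + 1 - γ).re := by simp; linarith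
  have hc := intervalIntegral.continuousOn_primitive_interval (a := 0) (b := 1)
    ((intervalIntegrable_iff' (by simp)).1 (Complex.betaIntegral_convergent hre h0))
  have h1 : Tendsto (fun x : ℝ => ∫ t in (0 : ℝ)..x, (t : ℂ) ^ (N + 1 - γ - 1) *
      (1 - (t : ℂ)) ^ (γ - 1)) (𝓝[<] 1) (𝓝 (Complex.betaIntegral (N + 1 - γ) γ)) := by
    have := hc 1 Set.right_mem_uIcc
    refine this.mono_left ?_
    rw [Set.uIcc_of_le zero_le_one, nhdsWithin_Icc_eq_nhdsLE zero_lt_one]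
    exact nhdsWithin_mono _ Set.Iio_subset_Iic_self
  have h2 : Tendsto (fun x : ℝ => ((x : ℂ) ^ (N + 1 - γ))⁻¹) (𝓝[<] 1) (𝓝 1) := by
    have := ((Complex.continuous_ofReal_cpow_const hre).tendsto 1).inv₀ (by simp)
    simp only [Complex.ofReal_one, Complex.one_cpow, inv_one] at this
    exact this.mono_left nhdsWithin_le_nhds
  have h3 := h2.mul h1
  rw [one_mul] at h3
  refine h3.congr' ?_
  filter_upwards [Ioo_mem_nhdsLT (zero_lt_one' ℝ)] with x hx
  have hx0 : (x : ℂ) ^ (N + 1 - γ) ≠ 0 := by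
    simp [Complex.cpow_eq_zero_iff, hx.1.ne']
  rw [← flowInt_one_eq_integral h0 hγ hx.1.le hx.2]
  field_simp

/-- The growth exponent `(μ + 2) / p` is strictly smaller than `Re γ`. -/
theorem tendsto_cpow_mul_of_mem {p : ℝ≥0∞} [Fact (1 ≤ p)] (hpt : p ≠ ∞) {μ : ℝ} (hμ : 0 ≤ μ)
    {f : ℂ → ℂ} (hf : f ∈ bergman p μ) {γ : ℂ} (hγ : (μ + 2) / p.toReal < γ.re) :
    Tendsto (fun x : ℝ => (1 - x : ℂ) ^ γ * f x) (𝓝[<] 1) (𝓝 0) := by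
  set b := (μ + 2) / p.toReal with hb
  set C := 2 ^ b * bnorm p μ f with hC
  have hlim : Tendsto (fun x : ℝ => (1 - x) ^ (γ.re - b) * C) (𝓝[<] 1) (𝓝 0) := by
    have h1 : ContinuousAt (fun x : ℝ => (1 - x) ^ (γ.re - b) * C) 1 := by
      refine ContinuousAt.mul (ContinuousAt.rpow_const (by fun_prop) (Or.inr ?_))
        continuousAt_const
      linarith
    have h2 := h1.tendsto.mono_left (nhdsWithin_le_nhds (s := Set.Iio 1))
    rwa [sub_self, Real.zero_rpow (by linarith), zero_mul] at h2
  refine squeeze_zero_norm' ?_ hlim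
  filter_upwards [Ioo_mem_nhdsLT (zero_lt_one' ℝ)] with x hx
  have hmem := ofReal_mem_ball hx.1.le hx.2
  have h1x : 0 < 1 - x := by linarith [hx.2]
  have hg := norm_le_growth_mul hpt hμ hf (mem_ball_zero_iff.1 hmem)
  rw [growth, Complex.norm_real, Real.norm_of_nonneg hx.1.le, ← hb,
    Real.div_rpow h1x.le (by norm_num), Real.rpow_neg (by norm_num : (0 : ℝ) ≤ 2)] at hg
  rw [norm_mul, ← Complex.ofReal_one, ← Complex.ofReal_sub,
    Complex.norm_cpow_eq_rpow_re_of_pos h1x]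
  calc _ ≤ (1 - x) ^ γ.re * ((1 - x) ^ (-b) / (2 ^ b)⁻¹ * bnorm p μ f) := by gcongr
    _ = _ := by
        have e : (1 - x) ^ (γ.re - b) = (1 - x) ^ γ.re * (1 - x) ^ (-b) := by
          rw [← Real.rpow_add h1x, ← sub_eq_add_neg]
        rw [e, hC, div_inv_eq_mul]
        ring

theorem betaIntegral_ne_zero {u v : ℂ} (hu : 0 < u.re) (hv : 0 < v.re) :
    Complex.betaIntegral u v ≠ 0 := by
  intro h
  have := Complex.Gamma_mul_Gamma_eq_betaIntegral hu hv
  rw [h, mul_zero] at this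
  exact mul_ne_zero (Complex.Gamma_ne_zero_of_re_pos hu) (Complex.Gamma_ne_zero_of_re_pos hv) this

/-- Monomials of large degree are not in the range of `λ - C` on weighted Bergman spaces if
`Re (1 / λ)` is large. -/
theorem not_isCesaro_pow {p : ℝ≥0∞} [Fact (1 ≤ p)] (hpt : p ≠ ∞) {μ : ℝ} (hμ : 0 ≤ μ)
    {f : ℂ → ℂ} (hf : f ∈ bergman p μ) {l : ℂ} (hl : (μ + 2) / p.toReal < l⁻¹.re)
    (hn : ∀ m : ℕ, l * (m + 1) ≠ 1) {N : ℕ} (hN : l⁻¹.re ≤ N)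
    (h : IsCesaro f (fun z => l * f z - z ^ N)) : False := by
  have h0 : 0 < l⁻¹.re := lt_of_le_of_lt (by positivity) hl
  have hl0 : l ≠ 0 := by rintro rfl; simp at h0
  obtain ⟨γ, rfl⟩ : ∃ γ : ℂ, l = γ⁻¹ := ⟨l⁻¹, (inv_inv l).symm⟩
  rw [inv_inv] at h0 hl hN
  have hγ0 : γ ≠ 0 := fun h => hl0 (by simp [h])
  have hk : DifferentiableOn ℂ (fun _ : ℂ => (1 : ℂ)) (ball 0 1) := differentiableOn_const _
  set W := flowInt N γ (fun _ => 1) with hW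
  -- `γ z ^ N (1 + γ W)` solves the same equation, so it equals `f` by uniqueness. Multiplied by `(1
  -- - x) ^ γ` it tends to `γ ^ 2` times a nonzero Beta value, whereas membership of `f` forces the
  -- limit `0`.
  have hsol := (isCesaro_flowInt hk hN).const_mul (-γ)
  have hzero : ∀ z ∈ ball (0 : ℂ) 1, f z + -γ * (z ^ N * (1 + γ * W z)) = 0 := fun z hz =>
    eq_zero_of_isCesaro hn ((h.add hsol).congr (fun _ _ => rfl)
      (fun w _ => by rw [← hW]; field_simp; ring)) hz
  have hpow : Tendsto (fun x : ℝ => (1 - x : ℂ) ^ γ) (𝓝[<] 1) (𝓝 0) := by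
    have h1 : ContinuousAt (fun x : ℝ => ((1 - x : ℝ) : ℂ) ^ γ) 1 :=
      (Complex.continuous_ofReal_cpow_const h0).continuousAt.comp (by fun_prop)
    have h2 := h1.tendsto.mono_left (nhdsWithin_le_nhds (s := Set.Iio 1))
    simp only [sub_self, Complex.ofReal_zero, Complex.zero_cpow hγ0] at h2
    simpa using h2
  have hpow2 : Tendsto (fun x : ℝ => (x : ℂ) ^ N) (𝓝[<] 1) (𝓝 1) := by
    have h1 : ContinuousAt (fun x : ℝ => (x : ℂ) ^ N) 1 := by fun_prop
    have h2 := h1.tendsto.mono_left (nhdsWithin_le_nhds (s := Set.Iio 1))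
    simpa using h2
  have hA := hpow2.mul (((tendsto_flowInt_one h0 hN).const_mul γ).add hpow)
  have hA' := hA.const_mul γ
  have hB := tendsto_cpow_mul_of_mem hpt hμ hf hl
  have hEq : (fun x : ℝ => (1 - x : ℂ) ^ γ * f x) =ᶠ[𝓝[<] 1] fun x : ℝ =>
      γ * ((x : ℂ) ^ N * (γ * ((1 - x : ℂ) ^ γ * flowInt N γ (fun _ => 1) x) +
        (1 - x : ℂ) ^ γ)) := by
    filter_upwards [Ioo_mem_nhdsLT (zero_lt_one' ℝ)] with x hx
    have := hzero x (ofReal_mem_ball hx.1.le hx.2)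
    rw [← hW]
    linear_combination (1 - x : ℂ) ^ γ * this
  have hu := tendsto_nhds_unique (hB.congr' hEq) hA'
  have hre : 0 < ((N : ℂ) + 1 - γ).re := by simp; linarith
  have hb := betaIntegral_ne_zero hre h0
  simp only [one_mul, add_zero] at hu
  exact mul_ne_zero hγ0 (mul_ne_zero hγ0 hb) hu.symm

/-! ### Test functions for non-compactness. -/

/-- Powers of `1 / (1 - (1 - s) z)`, which peak at the boundary point one. -/
def peak (N : ℕ) (s : ℝ) (z : ℂ) : ℂ := (den s z ^ (N + 1))⁻¹

/-- The preimages of the functions `peak` under the Cesàro operator. -/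
def prePeak (N : ℕ) (s : ℝ) : ℂ → ℂ := (ball (0 : ℂ) 1).indicator fun z =>
  (1 - z) * (peak N s z + z * ((N + 1) * (1 - s) / den s z ^ (N + 2)))

theorem hasDerivAt_peak (N : ℕ) {s : ℝ} {z : ℂ} (hd : den s z ≠ 0) :
    HasDerivAt (peak N s) ((N + 1) * (1 - s) / den s z ^ (N + 2)) z := by
  refine (((hasDerivAt_den s z).pow (N + 1)).inv (pow_ne_zero _ hd)).congr_deriv ?_
  simp only [Pi.pow_apply, Nat.add_sub_cancel]
  field_simp
  push_cast
  ring

theorem isCesaro_prePeak (N : ℕ) {s : ℝ} (h0 : 0 ≤ s) (h1 : s ≤ 1) :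
    IsCesaro (prePeak N s) (peak N s) := by
  have hd : ∀ z ∈ ball (0 : ℂ) 1, den s z ≠ 0 := fun z hz =>
    den_ne_zero h0 h1 (mem_ball_zero_iff.1 hz)
  have hden : Differentiable ℂ (den s) := fun z => (hasDerivAt_den s z).differentiableAt
  have hpk : DifferentiableOn ℂ (peak N s) (ball 0 1) := fun z hz =>
    (hasDerivAt_peak N (hd z hz)).differentiableAt.differentiableWithinAt
  refine ⟨(indicator_mem_holo ?_).1, hpk, fun z hz => ?_⟩
  · refine DifferentiableOn.mul (by fun_prop) (hpk.add (DifferentiableOn.mul (by fun_prop) ?_))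
    exact DifferentiableOn.div (by fun_prop) (hden.pow _).differentiableOn
      fun z hz => pow_ne_zero _ (hd z hz)
  · rw [(hasDerivAt_peak N (hd z hz)).deriv, prePeak, Set.indicator_of_mem hz]

/-- Differentiating `peak` costs one factor `1 / ‖den s z‖`, which `‖1 - z‖ ≤ 2 ‖den s z‖` absorbs.
Hence `prePeak` is no larger than its image under `C`, uniformly in `s`. -/
theorem norm_prePeak_le (N : ℕ) {s : ℝ} (h0 : 0 ≤ s) (h1 : s ≤ 1) {z : ℂ}
    (hz : z ∈ ball (0 : ℂ) 1) : ‖prePeak N s z‖ ≤ (2 * N + 4) * ‖peak N s z‖ := by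
  have hz' : ‖z‖ < 1 := mem_ball_zero_iff.1 hz
  have hd : 0 < ‖den s z‖ := norm_pos_iff.2 (den_ne_zero h0 h1 hz')
  rw [prePeak, Set.indicator_of_mem hz, norm_mul]
  have e1 : ‖1 - z‖ ≤ 2 := (norm_sub_le _ _).trans (by rw [norm_one]; linarith)
  have e2 : ‖1 - z‖ ≤ 2 * ‖den s z‖ := by
    have : 1 - z = den s z - s * z := by rw [den]; ring
    rw [this]
    refine (norm_sub_le _ _).trans ?_
    rw [norm_mul, Complex.norm_real, Real.norm_of_nonneg h0]
    have := self_le_norm_den h1 hz'.le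
    nlinarith [norm_nonneg z]
  have e3 : ‖z * ((N + 1) * (1 - s) / den s z ^ (N + 2))‖ ≤ (N + 1) / ‖den s z‖ ^ (N + 2) := by
    have hN : ‖(N : ℂ) + 1‖ = N + 1 := by
      rw [← Nat.cast_succ, Complex.norm_natCast, Nat.cast_succ]
    have hs : ‖(1 : ℂ) - s‖ = 1 - s := by
      rw [← Complex.ofReal_one, ← Complex.ofReal_sub, Complex.norm_real,
        Real.norm_of_nonneg (by linarith)]
    rw [norm_mul, norm_div, norm_mul, norm_pow, hN, hs]
    calc _ ≤ 1 * ((N + 1) * 1 / ‖den s z‖ ^ (N + 2)) := by gcongr; linarith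
      _ = _ := by ring
  have e4 : ‖peak N s z‖ = 1 / ‖den s z‖ ^ (N + 1) := by
    rw [peak, norm_inv, norm_pow, one_div]
  calc _ ≤ ‖1 - z‖ * (‖peak N s z‖ + (N + 1) / ‖den s z‖ ^ (N + 2)) := by
        gcongr
        exact (norm_add_le _ _).trans (by gcongr)
    _ = ‖1 - z‖ * ‖peak N s z‖ + ‖1 - z‖ * ((N + 1) / ‖den s z‖ ^ (N + 2)) := by ring
    _ ≤ 2 * ‖peak N s z‖ + 2 * ‖den s z‖ * ((N + 1) / ‖den s z‖ ^ (N + 2)) := by gcongr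
    _ = _ := by
        rw [e4]
        field_simp
        ring

theorem norm_peak_le (N : ℕ) {s : ℝ} (h0 : 0 < s) (h1 : s ≤ 1) {z : ℂ}
    (hz : z ∈ ball (0 : ℂ) 1) : ‖peak N s z‖ ≤ (s ^ (N + 1))⁻¹ := by
  have := self_le_norm_den h1 (mem_ball_zero_iff.1 hz).le
  rw [peak, norm_inv, norm_pow]
  gcongr

theorem prePeak_mem_holo (N : ℕ) {s : ℝ} (h0 : 0 ≤ s) (h1 : s ≤ 1) : prePeak N s ∈ holo :=
  ⟨(isCesaro_prePeak N h0 h1).1, fun _ hz => Set.indicator_of_notMem hz _⟩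

theorem prePeak_mem {p : ℝ≥0∞} [Fact (1 ≤ p)] (hpt : p ≠ ∞) {μ : ℝ} (hμ : 0 ≤ μ) (N : ℕ) {s : ℝ}
    (h0 : 0 < s) (h1 : s ≤ 1) : prePeak N s ∈ bergman p μ :=
  mem_bergman_of_bounded (b := (2 * N + 4) * (s ^ (N + 1))⁻¹) hpt hμ (by positivity)
    (prePeak_mem_holo N h0.le h1) fun z hz =>
    (norm_prePeak_le N h0.le h1 hz).trans (by gcongr; exact norm_peak_le N h0 h1 hz)

/-- The composition estimate with `g = 1` and `e = (N + 1) p` is a sharp enough norm bound for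
`peak`. -/
theorem bnorm_prePeak_le {p : ℝ≥0∞} (hp : 1 < p) (hpt : p ≠ ∞) {μ : ℝ} (hμ : 0 ≤ μ) {N : ℕ}
    (hN : 4 + 2 * μ ≤ (N + 1) * p.toReal) :
    ∃ K : ℝ, 0 < K ∧ ∀ s : ℝ, 0 < s → s ≤ 1 →
      bnorm p μ (prePeak N s) ≤ K * s ^ ((μ + 2) / p.toReal - (N + 1)) := by
  have hp0 : p ≠ 0 := (one_pos.trans hp).ne'
  have hq0 : 0 < p.toReal := by linarith [one_lt_toReal hp hpt]
  set M := (diskMeasure μ Set.univ ^ (1 / p.toReal)).toReal with hM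
  have hMtop : diskMeasure μ Set.univ ^ (1 / p.toReal) ≠ ∞ :=
    ENNReal.rpow_ne_top_of_nonneg (by positivity) (diskMeasure_univ_ne_top hμ)
  have hM0 : 0 ≤ M := ENNReal.toReal_nonneg
  -- The summand `1` only makes the constant positive, so that it can be divided by.
  refine ⟨(2 * N + 4) * (2 ^ μ) ^ (1 / p.toReal) * M + 1, by positivity, fun s h0 h1 => ?_⟩
  set E := 2 ^ μ * s ^ (μ + 2 - (N + 1) * p.toReal) with hE
  have hball : ∀ᵐ z ∂diskMeasure μ, z ∈ ball (0 : ℂ) 1 :=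
    (withDensity_absolutelyContinuous _ _).ae_le (ae_restrict_mem measurableSet_ball)
  have hpk : eLpNorm (peak N s) p (diskMeasure μ) ≤
      ENNReal.ofReal (E ^ (1 / p.toReal)) * diskMeasure μ Set.univ ^ (1 / p.toReal) := by
    have h := lintegral_den_flow_le hμ hN h0 h1 (measurable_const (a := (1 : ℝ≥0∞)))
    rw [← ENNReal.ofReal_rpow_of_pos (by positivity), ← ENNReal.mul_rpow_of_nonneg _ _
      (by positivity), eLpNorm_eq_lintegral_rpow_enorm_toReal hp0 hpt]
    refine ENNReal.rpow_le_rpow ?_ (by positivity)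
    simp only [mul_one, lintegral_const, one_mul] at h
    refine le_trans (lintegral_mono_ae (hball.mono fun z hz => ?_)) h
    have hd : 0 < ‖den s z‖ := norm_pos_iff.2 (den_ne_zero h0.le h1 (mem_ball_zero_iff.1 hz))
    rw [← ofReal_norm, ENNReal.ofReal_rpow_of_nonneg (norm_nonneg _) hq0.le, peak, norm_inv,
      norm_pow, Real.inv_rpow (by positivity), ← Real.rpow_natCast, ← Real.rpow_mul hd.le,
      ← Real.rpow_neg hd.le]
    push_cast
    exact le_rfl
  have hpre : eLpNorm (prePeak N s) p (diskMeasure μ) ≤ ENNReal.ofReal (2 * N + 4) *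
      (ENNReal.ofReal (E ^ (1 / p.toReal)) * diskMeasure μ Set.univ ^ (1 / p.toReal)) := by
    refine le_trans ?_ (mul_le_mul' le_rfl hpk)
    refine eLpNorm_le_mul_eLpNorm_of_ae_le_mul (hball.mono fun z hz => ?_) p
    exact norm_prePeak_le N h0.le h1 hz
  have h2 := ENNReal.toReal_mono (ENNReal.mul_ne_top ENNReal.ofReal_ne_top
    (ENNReal.mul_ne_top ENNReal.ofReal_ne_top hMtop)) hpre
  rw [ENNReal.toReal_mul, ENNReal.toReal_mul, ENNReal.toReal_ofReal (by positivity),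
    ENNReal.toReal_ofReal (by positivity), ← hM, hE, Real.mul_rpow (by positivity) (by positivity),
    ← Real.rpow_mul h0.le] at h2
  have h3 : (μ + 2 - (N + 1) * p.toReal) * (1 / p.toReal) = (μ + 2) / p.toReal - (N + 1) := by
    field_simp
  rw [h3] at h2
  have h4 : 0 < s ^ ((μ + 2) / p.toReal - (N + 1)) := by positivity
  calc _ ≤ _ := h2
    _ ≤ _ := by nlinarith

theorem le_norm_peak (N : ℕ) {s : ℝ} (h0 : 0 < s) (h1 : s ≤ 1) :
    ((2 * s) ^ (N + 1))⁻¹ ≤ ‖peak N s ((1 - s : ℝ) : ℂ)‖ := by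
  have e : den s ((1 - s : ℝ) : ℂ) = ((2 * s - s ^ 2 : ℝ) : ℂ) := by
    rw [den]; push_cast; ring
  have h2 : 0 < 2 * s - s ^ 2 := by nlinarith
  rw [peak, e, norm_inv, norm_pow, Complex.norm_real, Real.norm_of_nonneg h2.le]
  gcongr
  nlinarith


/-! ### From the differential equation to the spectrum. -/

theorem holo_ext {f g : ℂ → ℂ} (hf : f ∈ holo) (hg : g ∈ holo)
    (h : ∀ z ∈ ball (0 : ℂ) 1, f z = g z) : f = g := by
  funext z
  by_cases hz : z ∈ ball (0 : ℂ) 1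
  · exact h z hz
  · rw [hf.2 z hz, hg.2 z hz]

theorem eq_of_isCesaro_sub {l : ℂ} (hl : ∀ n : ℕ, l * (n + 1) ≠ 1) {f f' g : ℂ → ℂ}
    (hf : f ∈ holo) (hf' : f' ∈ holo) (h : IsCesaro f (fun z => l * f z - g z))
    (h' : IsCesaro f' (fun z => l * f' z - g z)) : f = f' :=
  holo_ext hf hf' fun z hz => by
    have := eq_zero_of_isCesaro hl ((h.add (h'.const_mul (-1))).congr (fun _ _ => rfl)
      fun w _ => by ring) hz
    linear_combination this

section Abstract

variable {X : Type*} [AddCommGroup X] [Module ℂ X] [TopologicalSpace X] [IsTopologicalAddGroup X]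
  [ContinuousSMul ℂ X] {ι : X →ₗ[ℂ] (ℂ → ℂ)} {T : X →L[ℂ] X} {l : ℂ}

theorem isCesaro_of_mem_resolvent (hT : ∀ f, IsCesaro (ι f) (ι (T f))) (hl : l ∉ spectrum ℂ T)
    (g : X) : ∃ f : X, IsCesaro (ι f) (fun z => l * ι f z - ι g z) := by
  rw [spectrum.notMem_iff] at hl
  obtain ⟨u, hu⟩ := hl
  refine ⟨u.inv g, (hT _).congr (fun _ _ => rfl) fun z _ => ?_⟩
  have h1 : (algebraMap ℂ (X →L[ℂ] X) l - T) (u.inv g) = g := by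
    rw [← hu]
    exact congrArg (fun A : X →L[ℂ] X => A g) u.val_inv
  have h2 : l • u.inv g - T (u.inv g) = g := h1
  have h3 := congrFun (congrArg ι h2) z
  simp only [map_sub, map_smul, Pi.sub_apply, Pi.smul_apply, smul_eq_mul] at h3
  linear_combination h3

/-- Injectivity of `l - T` comes from uniqueness for the equation, surjectivity from `hsurj`.
Continuity of the inverse is kept as a hypothesis, to be checked by norm estimates in each step
space instead of an open mapping theorem. -/
theorem notMem_spectrum_of_isCesaro (hι : Function.Injective ι) (hholo : ∀ f, ι f ∈ holo)
    (hT : ∀ f, IsCesaro (ι f) (ι (T f))) (hl : ∀ n : ℕ, l * (n + 1) ≠ 1)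
    (hsurj : ∀ g, ∃ f, IsCesaro (ι f) (fun z => l * ι f z - ι g z))
    (hcont : ∀ R : X →ₗ[ℂ] X, (∀ g, IsCesaro (ι (R g)) (fun z => l * ι (R g) z - ι g z)) →
      Continuous R) : l ∉ spectrum ℂ T := by
  set A : X →L[ℂ] X := algebraMap ℂ (X →L[ℂ] X) l - T with hA
  have hAapp : ∀ f, A f = l • f - T f := fun _ => rfl
  have hsol : ∀ f, IsCesaro (ι f) (fun z => l * ι f z - ι (A f) z) := fun f =>
    (hT f).congr (fun _ _ => rfl) fun z _ => by
      simp only [hAapp, map_sub, map_smul, Pi.sub_apply, Pi.smul_apply, smul_eq_mul]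
      ring
  have hsolA : ∀ f g, IsCesaro (ι f) (fun z => l * ι f z - ι g z) → A f = g := fun f g h =>
    hι (holo_ext (hholo _) (hholo _) fun z hz => by
      have := (hsol f).eqOn h hz
      linear_combination -this)
  have hbij : Function.Bijective A.toLinearMap := by
    refine ⟨fun f f' h => ?_, fun g => ?_⟩
    · have h' : A f = A f' := h
      refine hι (eq_of_isCesaro_sub hl (hholo _) (hholo _) (hsol f) ?_)
      rw [h']
      exact hsol f'
    · obtain ⟨f, hf⟩ := hsurj g
      exact ⟨f, hsolA f g hf⟩
  set E := LinearEquiv.ofBijective A.toLinearMap hbij with hE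
  have hR1 : ∀ g, A (E.symm g) = g := fun g => E.apply_symm_apply g
  have hR2 : ∀ f, E.symm (A f) = f := fun f => E.symm_apply_apply f
  have hRc : Continuous E.symm.toLinearMap := hcont _ fun g => by
    have := hsol (E.symm g)
    rw [hR1] at this
    exact this
  rw [spectrum.notMem_iff]
  let R : X →L[ℂ] X := ⟨E.symm.toLinearMap, hRc⟩
  exact ⟨⟨A, R, ContinuousLinearMap.ext hR1, ContinuousLinearMap.ext hR2⟩, rfl⟩

end Abstract

/-- The Cesàro transform, extended by zero outside of the disc. -/
def cesaroDisc (f : ℂ → ℂ) : ℂ → ℂ := (ball (0 : ℂ) 1).indicator (cesaro f)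

theorem isCesaro_cesaroDisc {f : ℂ → ℂ} (hf : f ∈ holo) : IsCesaro f (cesaroDisc f) :=
  (isCesaro_cesaro hf.1).congr (fun _ _ => rfl) fun _ hz => Set.indicator_of_mem hz _

theorem cesaroDisc_mem_holo {f : ℂ → ℂ} (hf : f ∈ holo) : cesaroDisc f ∈ holo :=
  indicator_mem_holo (isCesaro_cesaro hf.1).2

theorem eq_cesaroDisc {f H : ℂ → ℂ} (hf : f ∈ holo) (hH : H ∈ holo) (h : IsCesaro f H) :
    H = cesaroDisc f :=
  holo_ext hH (cesaroDisc_mem_holo hf) fun _ hz => h.eqOn (isCesaro_cesaroDisc hf) hz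

theorem cesaroDisc_add {f g : ℂ → ℂ} (hf : f ∈ holo) (hg : g ∈ holo) :
    cesaroDisc (f + g) = cesaroDisc f + cesaroDisc g :=
  (eq_cesaroDisc (holo.add_mem hf hg)
    (holo.add_mem (cesaroDisc_mem_holo hf) (cesaroDisc_mem_holo hg))
    ((isCesaro_cesaroDisc hf).add (isCesaro_cesaroDisc hg))).symm

theorem cesaroDisc_smul {f : ℂ → ℂ} (hf : f ∈ holo) (c : ℂ) :
    cesaroDisc (c • f) = c • cesaroDisc f :=
  (eq_cesaroDisc (holo.smul_mem c hf) (holo.smul_mem c (cesaroDisc_mem_holo hf))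
    ((isCesaro_cesaroDisc hf).const_mul c)).symm

theorem cesaroDisc_bounded {p : ℝ≥0∞} [Fact (1 ≤ p)] (hp : 1 < p) (hpt : p ≠ ∞) {μ : ℝ}
    (hμ : 0 ≤ μ) : ∃ K : ℝ, 0 ≤ K ∧ ∀ f ∈ bergman p μ, cesaroDisc f ∈ bergman p μ ∧
      bnorm p μ (cesaroDisc f) ≤ K * bnorm p μ f := by
  obtain ⟨K, hK, h⟩ := cesaro_bounded hp hpt hμ
  refine ⟨K, hK, fun f hf => ?_⟩
  obtain ⟨H, hH, hC, hb⟩ := h f hf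
  rw [← eq_cesaroDisc hf.1 hH.1 hC]
  exact ⟨hH, hb⟩

theorem bnorm_mono {p : ℝ≥0∞} {μ ν : ℝ} (h : μ ≤ ν) {f : ℂ → ℂ} (hf : f ∈ bergman p μ) :
    bnorm p ν f ≤ bnorm p μ f := by
  refine ENNReal.toReal_mono hf.2.2.ne (eLpNorm_mono_measure f (withDensity_mono ?_))
  filter_upwards [ae_restrict_mem measurableSet_ball] with z hz
  have hz' : 0 < 1 - ‖z‖ := by simpa using hz
  have : (1 - ‖z‖) ^ ν ≤ (1 - ‖z‖) ^ μ :=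
    Real.rpow_le_rpow_of_exponent_ge hz' (by linarith [norm_nonneg z]) h
  gcongr

/-! ### The Cesàro operator on the Fréchet space `A^p_{α+}`. -/

section Plus

variable {p : ℝ≥0∞} {α : ℝ}

variable (p α) in
/-- The inclusion of `A^p_{α+}` into the functions. -/
def plusVal : BergmanPlus p α →ₗ[ℂ] (ℂ → ℂ) := (bergmanPlus p α).subtype

/-- Constructor for elements of `A^p_{α+}`. -/
def plusMk (f : ℂ → ℂ) (hf : ∀ μ, α < μ → f ∈ bergman p μ) : BergmanPlus p α :=
  (⟨f, hf⟩ : bergmanPlus p α)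

theorem plusVal_mk (f : ℂ → ℂ) (hf : ∀ μ, α < μ → f ∈ bergman p μ) : plusVal p α (plusMk f hf) = f := rfl

theorem plusVal_injective : Function.Injective (plusVal p α) := Subtype.val_injective

theorem plusVal_mem (f : BergmanPlus p α) {μ : ℝ} (hμ : α < μ) : plusVal p α f ∈ bergman p μ :=
  f.2 μ hμ

theorem plusVal_holo (f : BergmanPlus p α) : plusVal p α f ∈ holo :=
  (plusVal_mem f (lt_add_one α)).1

variable [Fact (1 ≤ p)]

theorem plusNorms_apply (n : ℕ) (f : BergmanPlus p α) :
    plusNorms p α n f = bnorm p (α + 1 / ((n : ℝ) + 1)) (plusVal p α f) := rfl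

theorem continuous_plus (R : BergmanPlus p α →ₗ[ℂ] BergmanPlus p α)
    (h : ∀ μ, α < μ → ∃ K : ℝ, 0 ≤ K ∧ ∀ f, bnorm p μ (plusVal p α (R f)) ≤
      K * bnorm p μ (plusVal p α f)) : Continuous R := by
  refine WithSeminorms.continuous_of_isBounded (withSeminorms_plusNorms p α)
    (withSeminorms_plusNorms p α) R fun n => ?_
  obtain ⟨K, hK, hb⟩ := h (α + 1 / ((n : ℝ) + 1)) (lt_add_of_pos_right α Nat.one_div_pos_of_nat)
  refine ⟨{n}, ⟨K, hK⟩, fun f => ?_⟩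
  rw [Finset.sup_singleton]
  exact hb f

/-- The Cesàro operator on `A^p_{α+}`. -/
def cesaroPlusLin (hp : 1 < p) (hpt : p ≠ ∞) (hα : 0 < α) :
    BergmanPlus p α →ₗ[ℂ] BergmanPlus p α where
  toFun f := plusMk (cesaroDisc (plusVal p α f)) fun _ hμ =>
    ((cesaroDisc_bounded hp hpt (hα.trans hμ).le).choose_spec.2 _ (plusVal_mem f hμ)).1
  map_add' f g := plusVal_injective (cesaroDisc_add (plusVal_holo f) (plusVal_holo g))
  map_smul' c f := plusVal_injective (cesaroDisc_smul (plusVal_holo f) c)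

/-- The Cesàro operator on `A^p_{α+}`, as a continuous linear map. -/
def cesaroPlus (hp : 1 < p) (hpt : p ≠ ∞) (hα : 0 < α) :
    BergmanPlus p α →L[ℂ] BergmanPlus p α where
  toLinearMap := cesaroPlusLin hp hpt hα
  cont := continuous_plus _ fun μ hμ => by
    obtain ⟨K, hK, h⟩ := cesaroDisc_bounded hp hpt (hα.trans hμ).le
    exact ⟨K, hK, fun f => (h _ (plusVal_mem f hμ)).2⟩

theorem isCesaro_cesaroPlus (hp : 1 < p) (hpt : p ≠ ∞) (hα : 0 < α) (f : BergmanPlus p α) :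
    IsCesaro (plusVal p α f) (plusVal p α (cesaroPlus hp hpt hα f)) :=
  isCesaro_cesaroDisc (plusVal_holo f)

/-- Equality is allowed in `hl`: each `μ > α` makes the inequality strict. Solutions found in
different `A^p_μ` agree by uniqueness, so one solution lies in all of them. -/
theorem notMem_spectrum_cesaroPlus (hp : 1 < p) (hpt : p ≠ ∞) (hα : 0 < α) {l : ℂ} (hl0 : l ≠ 0)
    (hl : l⁻¹.re * p.toReal ≤ α + 2) (hn : ∀ m : ℕ, l * (m + 1) ≠ 1) :
    l ∉ spectrum ℂ (cesaroPlus hp hpt hα) := by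
  have hres : ∀ μ, α < μ → ∃ K : ℝ, 0 ≤ K ∧ ∀ k ∈ bergman p μ, ∃ f ∈ bergman p μ,
      IsCesaro f (fun z => l * f z - k z) ∧ bnorm p μ f ≤ K * bnorm p μ k := fun μ hμ =>
    resolvent_bounded hp hpt (hα.trans hμ).le hl0 (by linarith) hn
  refine notMem_spectrum_of_isCesaro plusVal_injective plusVal_holo
    (isCesaro_cesaroPlus hp hpt hα) hn (fun g => ?_) fun R hR => ?_
  · obtain ⟨K, -, h⟩ := hres (α + 1) (lt_add_one α)
    obtain ⟨f, hf, hC, -⟩ := h _ (plusVal_mem g (lt_add_one α))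
    refine ⟨plusMk f fun μ hμ => ?_, hC⟩
    obtain ⟨K', -, h'⟩ := hres μ hμ
    obtain ⟨f', hf', hC', -⟩ := h' _ (plusVal_mem g hμ)
    rwa [eq_of_isCesaro_sub hn hf.1 hf'.1 hC hC']
  · refine continuous_plus R fun μ hμ => ?_
    obtain ⟨K, hK, h⟩ := hres μ hμ
    refine ⟨K, hK, fun g => ?_⟩
    obtain ⟨f, hf, hC, hb⟩ := h _ (plusVal_mem g hμ)
    rwa [eq_of_isCesaro_sub hn (plusVal_holo _) hf.1 (hR g) hC]

end Plus

/-- Monomials restricted to the disc. -/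
def discPow (N : ℕ) : ℂ → ℂ := fun z => z ^ N * discOne z

theorem discPow_apply (N : ℕ) {z : ℂ} (hz : z ∈ ball (0 : ℂ) 1) : discPow N z = z ^ N := by
  rw [discPow, discOne_apply hz, mul_one]

theorem discPow_mem {p : ℝ≥0∞} [Fact (1 ≤ p)] (hpt : p ≠ ∞) {μ : ℝ} (hμ : 0 ≤ μ) (N : ℕ) :
    discPow N ∈ bergman p μ := (pow_mul_mem hpt hμ (discOne_mem hpt hμ) N).1

theorem mem_spectrum_cesaroPlus {p : ℝ≥0∞} [Fact (1 ≤ p)] {α : ℝ} (hp : 1 < p) (hpt : p ≠ ∞)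
    (hα : 0 < α) {l : ℂ} (hl : (α + 2) / p.toReal < l⁻¹.re) (hn : ∀ m : ℕ, l * (m + 1) ≠ 1) :
    l ∈ spectrum ℂ (cesaroPlus hp hpt hα) := by
  by_contra hspec
  have hq0 : 0 < p.toReal := by linarith [one_lt_toReal hp hpt]
  obtain ⟨N, hN⟩ := exists_nat_ge l⁻¹.re
  -- The step `μ = b p - 2 > α` has critical value `b`, still below `Re (1 / l)`.
  obtain ⟨b, hb1, hb2⟩ := exists_between hl
  have hμ : α < b * p.toReal - 2 := by rw [div_lt_iff₀ hq0] at hb1; linarith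
  obtain ⟨f, hf⟩ := isCesaro_of_mem_resolvent (isCesaro_cesaroPlus hp hpt hα) hspec
    (plusMk (discPow N) fun μ hμ => discPow_mem hpt (hα.trans hμ).le N)
  refine not_isCesaro_pow hpt (hα.trans hμ).le (plusVal_mem f hμ) ?_ hn hN
    (hf.congr (fun _ _ => rfl) fun z hz => ?_)
  · rw [sub_add_cancel, mul_div_cancel_right₀ _ hq0.ne']
    exact hb2
  · rw [plusVal_mk, discPow_apply N hz]


/-! ### The Cesàro operator on the inductive limit `A^p_{α-}`. -/

theorem norm_bergman {p : ℝ≥0∞} [Fact (1 ≤ p)] {μ : ℝ} (f : Bergman p μ) :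
    ‖f‖ = bnorm p μ f.1 := rfl

section Minus

variable {p : ℝ≥0∞} {α : ℝ}

variable (p α) in
/-- The inclusion of `A^p_{α-}` into the functions. -/
def minusVal : BergmanMinus p α →ₗ[ℂ] (ℂ → ℂ) := (bergmanMinus p α).subtype

/-- Constructor for elements of `A^p_{α-}`. -/
def minusMk (f : ℂ → ℂ) (hf : ∃ μ : ℝ, μ < α ∧ f ∈ bergman p μ) : BergmanMinus p α :=
  (⟨f, hf⟩ : bergmanMinus p α)

theorem minusVal_mk (f : ℂ → ℂ) (hf : ∃ μ : ℝ, μ < α ∧ f ∈ bergman p μ) :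
    minusVal p α (minusMk f hf) = f := rfl

/-- Constructor for elements of `A^p_μ`. -/
def bergmanMk {μ : ℝ} (f : ℂ → ℂ) (hf : f ∈ bergman p μ) : Bergman p μ := (⟨f, hf⟩ : bergman p μ)

theorem minusVal_bergmanToMinus {μ : ℝ} (h : μ < α) (f : Bergman p μ) :
    minusVal p α (bergmanToMinus p α h f) = f.1 := rfl

theorem bergmanMk_val {μ : ℝ} (f : ℂ → ℂ) (hf : f ∈ bergman p μ) : (bergmanMk f hf).1 = f := rfl

theorem minusVal_injective : Function.Injective (minusVal p α) := Subtype.val_injective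

theorem exists_minusVal_mem (f : BergmanMinus p α) {μ₀ : ℝ} (h₀ : μ₀ < α) :
    ∃ μ : ℝ, μ₀ < μ ∧ μ < α ∧ minusVal p α f ∈ bergman p μ := by
  obtain ⟨μ, hμ, hf⟩ : ∃ μ : ℝ, μ < α ∧ minusVal p α f ∈ bergman p μ := f.2
  obtain ⟨ν, h1, h2⟩ := exists_between (max_lt h₀ hμ)
  exact ⟨ν, (le_max_left _ _).trans_lt h1, h2, bergman_mono ((le_max_right _ _).trans h1.le) hf⟩

theorem minusVal_holo (f : BergmanMinus p α) : minusVal p α f ∈ holo := by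
  obtain ⟨μ, -, -, h⟩ := exists_minusVal_mem f (sub_one_lt α)
  exact h.1

/-- The inclusion `A^p_μ → A^p_ν` for `μ ≤ ν`. -/
def bergmanIncl {μ ν : ℝ} (h : μ ≤ ν) : Bergman p μ →ₗ[ℂ] Bergman p ν where
  toFun f := bergmanMk f.1 (bergman_mono h f.2)
  map_add' _ _ := rfl
  map_smul' _ _ := rfl

theorem bergmanIncl_val {μ ν : ℝ} (h : μ ≤ ν) (f : Bergman p μ) :
    (bergmanIncl h f).1 = f.1 := by
  have key : ∀ (g : ℂ → ℂ) (hg : g ∈ bergman p μ), (bergmanIncl h (bergmanMk g hg)).1 = g :=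
    fun _ _ => rfl
  exact key f.1 f.2

theorem bergmanToMinus_incl {μ ν : ℝ} (h : μ ≤ ν) (hν : ν < α) (f : Bergman p μ) :
    bergmanToMinus p α hν (bergmanIncl h f) = bergmanToMinus p α (h.trans_lt hν) f := by
  apply minusVal_injective
  rw [minusVal_bergmanToMinus, minusVal_bergmanToMinus, bergmanIncl_val]

variable [Fact (1 ≤ p)]

theorem continuous_bergmanIncl {μ ν : ℝ} (h : μ ≤ ν) :
    Continuous (bergmanIncl (p := p) h) :=
  AddMonoidHomClass.continuous_of_bound (bergmanIncl (p := p) h) 1 fun f => by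
    rw [one_mul, norm_bergman, norm_bergman, bergmanIncl_val]
    exact bnorm_mono h f.2

theorem continuous_bergmanToMinus {μ : ℝ} (h : μ < α) : Continuous (bergmanToMinus p α h) :=
  continuous_sInf_rng.2 fun _ ht => ht.2.2.2 μ h

instance : LocallyConvexSpace ℝ (BergmanMinus p α) :=
  LocallyConvexSpace.sInf fun _ ht => ht.2.2.1

/-- The universal property of the inductive limit topology, with a cofinal family of steps. -/
theorem continuous_minus {E : Type*} [AddCommGroup E] [Module ℂ E] [TopologicalSpace E]
    [IsTopologicalAddGroup E] [ContinuousSMul ℂ E] [LocallyConvexSpace ℝ E]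
    (L : BergmanMinus p α →ₗ[ℂ] E) {μ₀ : ℝ} (h₀ : μ₀ < α)
    (h : ∀ μ, μ₀ < μ → ∀ hμ : μ < α, Continuous fun f => L (bergmanToMinus p α hμ f)) :
    Continuous L := by
  rw [continuous_iff_le_induced]
  -- The topology pulled back along `L` is one of the competing topologies, hence coarser than the
  -- inductive limit topology. A step `μ ≤ μ₀` factors through a larger one above `μ₀`.
  refine sInf_le ⟨topologicalAddGroup_induced L, continuousSMul_induced L,
    LocallyConvexSpace.induced (L.restrictScalars ℝ), fun μ hμ => ?_⟩
  rw [continuous_induced_rng]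
  obtain ⟨ν, h1, h2⟩ := exists_between (max_lt h₀ hμ)
  have hμν : μ ≤ ν := (le_max_right _ _).trans h1.le
  have heq : L ∘ bergmanToMinus p α hμ =
      (fun f => L (bergmanToMinus p α h2 f)) ∘ bergmanIncl hμν :=
    funext fun f => congrArg L (bergmanToMinus_incl hμν h2 f).symm
  rw [heq]
  exact (h ν ((le_max_left _ _).trans_lt h1) h2).comp (continuous_bergmanIncl hμν)

theorem continuous_minus_of_bound (R : BergmanMinus p α →ₗ[ℂ] BergmanMinus p α) {μ₀ : ℝ}
    (h₀ : μ₀ < α) (h : ∀ μ, μ₀ < μ → μ < α → ∃ K : ℝ, ∀ f : BergmanMinus p α,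
      minusVal p α f ∈ bergman p μ → minusVal p α (R f) ∈ bergman p μ ∧
        bnorm p μ (minusVal p α (R f)) ≤ K * bnorm p μ (minusVal p α f)) : Continuous R := by
  refine continuous_minus R h₀ fun μ hμ0 hμ => ?_
  obtain ⟨K, hK⟩ := h μ hμ0 hμ
  have hmem : ∀ f : Bergman p μ, minusVal p α (R (bergmanToMinus p α hμ f)) ∈ bergman p μ :=
    fun f => (hK _ f.2).1
  let S : Bergman p μ →ₗ[ℂ] Bergman p μ :=
    { toFun := fun f => bergmanMk _ (hmem f)
      map_add' := fun f g => Subtype.ext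
        (by simp only [bergmanMk, map_add]; rfl)
      map_smul' := fun c f => Subtype.ext
        (by simp only [bergmanMk, map_smul]; rfl) }
  have hS : Continuous S := AddMonoidHomClass.continuous_of_bound S K fun f => (hK _ f.2).2
  exact (continuous_bergmanToMinus hμ).comp hS

/-- The Cesàro operator on `A^p_{α-}`. -/
def cesaroMinusLin (hp : 1 < p) (hpt : p ≠ ∞) (hα : 0 < α) :
    BergmanMinus p α →ₗ[ℂ] BergmanMinus p α where
  toFun f := minusMk (cesaroDisc (minusVal p α f)) <| by
    obtain ⟨μ, h0, h1, hf⟩ := exists_minusVal_mem f hα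
    exact ⟨μ, h1, ((cesaroDisc_bounded hp hpt h0.le).choose_spec.2 _ hf).1⟩
  map_add' f g := minusVal_injective (cesaroDisc_add (minusVal_holo f) (minusVal_holo g))
  map_smul' c f := minusVal_injective (cesaroDisc_smul (minusVal_holo f) c)

/-- The Cesàro operator on `A^p_{α-}`, as a continuous linear map. -/
def cesaroMinus (hp : 1 < p) (hpt : p ≠ ∞) (hα : 0 < α) :
    BergmanMinus p α →L[ℂ] BergmanMinus p α where
  toLinearMap := cesaroMinusLin hp hpt hα
  cont := continuous_minus_of_bound _ hα fun μ h0 _ => by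
    obtain ⟨K, hK, h⟩ := cesaroDisc_bounded hp hpt h0.le
    exact ⟨K, fun f hf => h _ hf⟩

theorem isCesaro_cesaroMinus (hp : 1 < p) (hpt : p ≠ ∞) (hα : 0 < α) (f : BergmanMinus p α) :
    IsCesaro (minusVal p α f) (minusVal p α (cesaroMinus hp hpt hα f)) :=
  isCesaro_cesaroDisc (minusVal_holo f)

/-- Strictness in `hl` leaves room for all steps close enough to `α` to lie left of their critical
line, and these are cofinal. -/
theorem notMem_spectrum_cesaroMinus (hp : 1 < p) (hpt : p ≠ ∞) (hα : 0 < α) {l : ℂ} (hl0 : l ≠ 0)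
    (hl : l⁻¹.re * p.toReal < α + 2) (hn : ∀ m : ℕ, l * (m + 1) ≠ 1) :
    l ∉ spectrum ℂ (cesaroMinus hp hpt hα) := by
  have h₀ : max 0 (l⁻¹.re * p.toReal - 2) < α := max_lt hα (by linarith)
  have hres : ∀ μ, max 0 (l⁻¹.re * p.toReal - 2) < μ → ∃ K : ℝ, 0 ≤ K ∧ ∀ k ∈ bergman p μ,
      ∃ f ∈ bergman p μ, IsCesaro f (fun z => l * f z - k z) ∧
        bnorm p μ f ≤ K * bnorm p μ k := fun μ hμ =>
    resolvent_bounded hp hpt ((le_max_left _ _).trans_lt hμ).le hl0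
      (by linarith [(le_max_right _ _).trans_lt hμ]) hn
  refine notMem_spectrum_of_isCesaro minusVal_injective minusVal_holo
    (isCesaro_cesaroMinus hp hpt hα) hn (fun g => ?_) fun R hR => ?_
  · obtain ⟨μ, h0, h1, hg⟩ := exists_minusVal_mem g h₀
    obtain ⟨K, -, h⟩ := hres μ h0
    obtain ⟨f, hf, hC, -⟩ := h _ hg
    exact ⟨minusMk f ⟨μ, h1, hf⟩, hC⟩
  · refine continuous_minus_of_bound R h₀ fun μ h0 h1 => ?_
    obtain ⟨K, hK, h⟩ := hres μ h0
    refine ⟨K, fun g hg => ?_⟩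
    obtain ⟨f, hf, hC, hb⟩ := h _ hg
    rw [eq_of_isCesaro_sub hn (minusVal_holo _) hf.1 (hR g) hC]
    exact ⟨hf, hb⟩

theorem mem_spectrum_cesaroMinus (hp : 1 < p) (hpt : p ≠ ∞)
    (hα : 0 < α) {l : ℂ} (hl : (α + 2) / p.toReal < l⁻¹.re) (hn : ∀ m : ℕ, l * (m + 1) ≠ 1) :
    l ∈ spectrum ℂ (cesaroMinus hp hpt hα) := by
  by_contra hspec
  have hq0 : 0 < p.toReal := by linarith [one_lt_toReal hp hpt]
  obtain ⟨N, hN⟩ := exists_nat_ge l⁻¹.re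
  obtain ⟨f, hf⟩ := isCesaro_of_mem_resolvent (isCesaro_cesaroMinus hp hpt hα) hspec
    (minusMk (discPow N) ⟨α / 2, by linarith, discPow_mem hpt (by linarith) N⟩)
  -- A solution lies in a single step `μ < α`, whose critical value is at most `(α + 2) / p`.
  obtain ⟨μ, h0, h1, hmem⟩ := exists_minusVal_mem f hα
  refine not_isCesaro_pow hpt h0.le hmem (hl.trans_le' (by gcongr)) hn hN
    (hf.congr (fun _ _ => rfl) fun z hz => ?_)
  rw [minusVal_mk, discPow_apply N hz]

theorem hasEigenvalue_cesaroMinus (hp : 1 < p) (hpt : p ≠ ∞) (hα : 0 < α) {l : ℂ} {n : ℕ}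
    (hl : l⁻¹.re * p.toReal < α + 2) (hn : l * (n + 1) = 1) :
    Module.End.HasEigenvalue (cesaroMinus hp hpt hα : Module.End ℂ (BergmanMinus p α)) l := by
  obtain ⟨μ, h1, h2⟩ := exists_between (max_lt hα (by linarith : l⁻¹.re * p.toReal - 2 < α))
  obtain ⟨f, hf, hf0, hC⟩ := exists_eigenfunction hp hpt ((le_max_left _ _).trans_lt h1).le
    (by linarith [(le_max_right _ _).trans_lt h1]) hn
  refine Module.End.hasEigenvalue_of_hasEigenvector (x := minusMk f ⟨μ, h2, hf⟩) ⟨?_, ?_⟩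
  · rw [Module.End.mem_eigenspace_iff]
    exact minusVal_injective
      (eq_cesaroDisc hf.1 (holo.smul_mem l hf.1) (hC.congr (fun _ _ => rfl) fun _ _ => rfl)).symm
  · intro h
    exact hf0 (congrArg (minusVal p α) h)

end Minus


/-! ### Non-compactness. -/

theorem growth_one_sub {p : ℝ≥0∞} {μ s : ℝ} (h0 : 0 < s) (h1 : s ≤ 1) :
    growth p μ ((1 - s : ℝ) : ℂ) = 2 ^ ((μ + 2) / p.toReal) * s ^ (-((μ + 2) / p.toReal)) := by
  rw [growth, Complex.norm_real, Real.norm_of_nonneg (by linarith), sub_sub_cancel,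
    Real.div_rpow h0.le (by norm_num), Real.rpow_neg (by norm_num : (0 : ℝ) ≤ 2), div_inv_eq_mul,
    mul_comm]

/-- Every ball of `A^p_μ` contains multiples of `prePeak` whose images at `1 - s` have the largest
order of growth permitted in `A^p_μ`, with `κ` independent of `s`. -/
theorem exists_scaled_prePeak {p : ℝ≥0∞} [Fact (1 ≤ p)] (hp : 1 < p) (hpt : p ≠ ∞) {μ : ℝ}
    (hμ : 0 ≤ μ) {N : ℕ} (hN : 4 + 2 * μ ≤ (N + 1) * p.toReal) {r : ℝ} (hr : 0 < r) :
    ∃ κ : ℝ, 0 < κ ∧ ∀ s : ℝ, 0 < s → s ≤ 1 → ∃ c : ℂ, bnorm p μ (c • prePeak N s) < r ∧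
      κ * s ^ (-((μ + 2) / p.toReal)) ≤ ‖c * peak N s ((1 - s : ℝ) : ℂ)‖ := by
  obtain ⟨K, hK, h⟩ := bnorm_prePeak_le hp hpt hμ hN
  set b := (μ + 2) / p.toReal
  refine ⟨r / (2 * K) * (2 ^ (N + 1))⁻¹, by positivity, fun s h0 h1 => ?_⟩
  set c : ℝ := r / (2 * K) * s ^ ((N + 1) - b) with hc
  have hc0 : 0 < c := by positivity
  have hnc : ‖(c : ℂ)‖ = c := by rw [Complex.norm_real, Real.norm_of_nonneg hc0.le]
  refine ⟨c, ?_, ?_⟩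
  · rw [bnorm_smul, hnc]
    calc c * bnorm p μ (prePeak N s) ≤ c * (K * s ^ (b - (N + 1))) := by gcongr; exact h s h0 h1
      _ = r / (2 * K) * K * (s ^ ((N + 1) - b) * s ^ (b - (N + 1))) := by rw [hc]; ring
      _ = r / 2 := by
          rw [← Real.rpow_add h0, show ((N : ℝ) + 1 - b) + (b - (N + 1)) = 0 by ring,
            Real.rpow_zero]
          field_simp
      _ < r := by linarith
  · rw [norm_mul, hnc]
    calc _ = c * ((2 * s) ^ (N + 1))⁻¹ := by
          have e : s ^ ((N : ℝ) + 1 - b) = s ^ (N + 1) * s ^ (-b) := by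
            rw [← Real.rpow_natCast, ← Real.rpow_add h0]
            push_cast
            rfl
          rw [hc, e, mul_pow]
          field_simp
      _ ≤ _ := by gcongr; exact le_norm_peak N h0 h1

theorem cesaroDisc_smul_prePeak (N : ℕ) {s : ℝ} (h0 : 0 < s) (h1 : s ≤ 1) (c : ℂ) :
    cesaroDisc (c • prePeak N s) ((1 - s : ℝ) : ℂ) = c * peak N s ((1 - s : ℝ) : ℂ) := by
  have hmem := ofReal_mem_ball (x := 1 - s) (by linarith) (by linarith)
  have hh := prePeak_mem_holo N h0.le h1
  rw [cesaroDisc_smul hh, Pi.smul_apply, smul_eq_mul,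
    (isCesaro_cesaroDisc hh).eqOn (isCesaro_prePeak N h0.le h1) hmem]

theorem plusNorms_anti {p : ℝ≥0∞} [Fact (1 ≤ p)] {α : ℝ} : Monotone (plusNorms p α) := by
  intro m n hmn f
  have hmn' : (m : ℝ) ≤ n := by exact_mod_cast hmn
  rw [plusNorms_apply, plusNorms_apply]
  refine bnorm_mono ?_ (plusVal_mem f (lt_add_of_pos_right α Nat.one_div_pos_of_nat))
  gcongr

/-- A neighbourhood of `0` contains a ball of some norm `n`, and a compact set is bounded in the
stronger norm `n + 1`. So images of peaks of order `s ^ (-bμ)` would be at most of order `s ^ (-bν)`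
with `bν < bμ`, which fails as `s → 0`. -/
theorem not_isCompactOperator_cesaroPlus {p : ℝ≥0∞} [Fact (1 ≤ p)] (hp : 1 < p) (hpt : p ≠ ∞)
    {α : ℝ} (hα : 0 < α) : ¬ IsCompactOperator (cesaroPlus (α := α) hp hpt hα) := by
  rintro ⟨C, hC, hU⟩
  have hq := one_lt_toReal hp hpt
  have hq0 : 0 < p.toReal := by linarith
  have hW := withSeminorms_plusNorms p α
  obtain ⟨S, r, hr, hSr⟩ := (hW.mem_nhds_iff _ _).1 hU
  set n := S.sup id with hn
  set μ := α + 1 / ((n : ℝ) + 1) with hμ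
  set ν := α + 1 / (((n + 1 : ℕ) : ℝ) + 1) with hν
  have hn0 : (0 : ℝ) < (n : ℝ) + 1 := by positivity
  have hαμ : α < μ := lt_add_of_pos_right α (by positivity)
  have hαν : α < ν := lt_add_of_pos_right α (by positivity)
  have hνμ : ν < μ := by
    rw [hμ, hν]
    gcongr
    linarith
  have hball : ∀ f, bnorm p μ (plusVal p α f) < r → cesaroPlus hp hpt hα f ∈ C := by
    intro f hf
    refine hSr ?_
    rw [Seminorm.mem_ball_zero]
    refine lt_of_le_of_lt ?_ hf
    exact Finset.sup_le (fun i hi => plusNorms_anti (Finset.le_sup (f := id) hi) :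
      ∀ i ∈ S, plusNorms p α i ≤ plusNorms p α n) f
  obtain ⟨M, hM⟩ := (hC.image (hW.continuous_seminorm (n + 1))).isBounded.bddAbove
  have hMb : ∀ g ∈ C, bnorm p ν (plusVal p α g) ≤ M := fun g hg => hM ⟨g, hg, rfl⟩
  obtain ⟨N, hN, -⟩ := exists_flowInt_exponent (μ := μ) (a := 0) hq
  obtain ⟨κ, hκ, hpk⟩ := exists_scaled_prePeak hp hpt (hα.trans hαμ).le hN hr
  set bμ := (μ + 2) / p.toReal with hbμ
  set bν := (ν + 2) / p.toReal with hbν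
  have hb : bν < bμ := by rw [hbμ, hbν]; gcongr
  have key : ∀ s : ℝ, 0 < s → s ≤ 1 → κ ≤ 2 ^ bν * M * s ^ (bμ - bν) := by
    intro s h0 h1
    obtain ⟨c, hc1, hc2⟩ := hpk s h0 h1
    let f : BergmanPlus p α := plusMk (c • prePeak N s) fun μ' hμ' =>
      (bergman p μ').smul_mem c (prePeak_mem hpt (hα.trans hμ').le N h0 h1)
    have hg := hMb _ (hball f hc1)
    have hev := norm_le_growth_mul hpt (hα.trans hαν).le
      (plusVal_mem (cesaroPlus hp hpt hα f) hαν)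
      (mem_ball_zero_iff.1 (ofReal_mem_ball (x := 1 - s) (by linarith) (by linarith)))
    have hval : plusVal p α (cesaroPlus hp hpt hα f) ((1 - s : ℝ) : ℂ) =
        c * peak N s ((1 - s : ℝ) : ℂ) := cesaroDisc_smul_prePeak N h0 h1 c
    rw [hval, growth_one_sub h0 h1] at hev
    have h3 : κ * s ^ (-bμ) ≤ 2 ^ bν * s ^ (-bν) * M :=
      (hc2.trans hev).trans (by gcongr)
    have e : s ^ (bμ - bν) = s ^ (-bν) * s ^ bμ := by
      rw [← Real.rpow_add h0]; congr 1; ring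
    have e2 : s ^ (-bμ) * s ^ bμ = 1 := by
      rw [← Real.rpow_add h0, neg_add_cancel, Real.rpow_zero]
    calc κ = κ * s ^ (-bμ) * s ^ bμ := by rw [mul_assoc, e2, mul_one]
      _ ≤ 2 ^ bν * s ^ (-bν) * M * s ^ bμ := by gcongr
      _ = _ := by rw [e]; ring
  have hlim : Tendsto (fun s : ℝ => 2 ^ bν * M * s ^ (bμ - bν)) (𝓝[>] 0) (𝓝 0) := by
    have h1 : ContinuousAt (fun s : ℝ => 2 ^ bν * M * s ^ (bμ - bν)) 0 :=
      continuousAt_const.mul (Real.continuousAt_rpow_const _ _ (Or.inr (by linarith)))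
    have h2 := h1.tendsto.mono_left (nhdsWithin_le_nhds (s := Set.Ioi 0))
    rwa [Real.zero_rpow (by linarith), mul_zero] at h2
  have : κ ≤ 0 := ge_of_tendsto hlim (by
    filter_upwards [Ioc_mem_nhdsGT (zero_lt_one' ℝ)] with s hs
    exact key s hs.1 hs.2)
  linarith

theorem exists_small_rpow (κ : ℝ) (n : ℕ) :
    ∃ s : ℝ, 0 < s ∧ s ≤ 1 ∧ (n / κ) * s ^ (1 / ((n : ℝ) + 1)) ≤ 1 := by
  have hlim : Tendsto (fun s : ℝ => (n / κ) * s ^ (1 / ((n : ℝ) + 1))) (𝓝[>] 0) (𝓝 0) := by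
    have h1 : ContinuousAt (fun s : ℝ => (n / κ) * s ^ (1 / ((n : ℝ) + 1))) 0 :=
      continuousAt_const.mul (Real.continuousAt_rpow_const _ _ (Or.inr (by positivity)))
    have h2 := h1.tendsto.mono_left (nhdsWithin_le_nhds (s := Set.Ioi 0))
    rwa [Real.zero_rpow (by positivity), mul_zero] at h2
  obtain ⟨s, hs1, hs2⟩ := ((hlim.eventually (eventually_le_nhds zero_lt_one)).and
    (Ioc_mem_nhdsGT (zero_lt_one' ℝ))).exists
  exact ⟨s, hs2.1, hs2.2, hs1⟩

/-- A weighted sampling sequence that is bounded on each step gives a continuous map into the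
bounded sequences. -/
theorem exists_sampling {p : ℝ≥0∞} [Fact (1 ≤ p)] (hpt : p ≠ ∞) {α : ℝ} (hα : 0 < α)
    {a : ℕ → ℝ} {s : ℕ → ℝ} (h0 : ∀ n, 0 < s n) (h1 : ∀ n, s n ≤ 1) (ha : ∀ n, 0 ≤ a n)
    (hbd : ∀ μ, 0 < μ → μ < α → ∃ C, ∀ n, a n * s n ^ (-((μ + 2) / p.toReal)) ≤ C) :
    ∃ L : BergmanMinus p α →ₗ[ℂ] BoundedContinuousFunction ℕ ℂ, Continuous L ∧
      ∀ f n, L f n = a n * minusVal p α f ((1 - s n : ℝ) : ℂ) := by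
  have hest : ∀ μ, 0 < μ → μ < α → ∃ C : ℝ, 0 ≤ C ∧ ∀ f ∈ bergman p μ, ∀ n,
      ‖(a n : ℂ) * f ((1 - s n : ℝ) : ℂ)‖ ≤ C * bnorm p μ f := by
    intro μ hμ hμα
    obtain ⟨C, hC⟩ := hbd μ hμ hμα
    refine ⟨2 ^ ((μ + 2) / p.toReal) * max C 0, by positivity, fun f hf n => ?_⟩
    have hev := norm_le_growth_mul hpt hμ.le hf (mem_ball_zero_iff.1
      (ofReal_mem_ball (x := 1 - s n) (by linarith [h1 n]) (by linarith [h0 n])))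
    rw [growth_one_sub (h0 n) (h1 n)] at hev
    rw [norm_mul, Complex.norm_real, Real.norm_of_nonneg (ha n)]
    have hb := bnorm_nonneg p μ f
    calc _ ≤ a n * (2 ^ ((μ + 2) / p.toReal) * s n ^ (-((μ + 2) / p.toReal)) * bnorm p μ f) :=
          mul_le_mul_of_nonneg_left hev (ha n)
      _ = 2 ^ ((μ + 2) / p.toReal) * (a n * s n ^ (-((μ + 2) / p.toReal))) * bnorm p μ f := by ring
      _ ≤ _ := by gcongr; exact (hC n).trans (le_max_left _ _)
  have hex : ∀ f : BergmanMinus p α, ∃ C, ∀ n,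
      ‖(a n : ℂ) * minusVal p α f ((1 - s n : ℝ) : ℂ)‖ ≤ C := fun f => by
    obtain ⟨μ, hμ0, hμα, hf⟩ := exists_minusVal_mem f hα
    obtain ⟨C, -, hC⟩ := hest μ hμ0 hμα
    exact ⟨_, hC _ hf⟩
  let L : BergmanMinus p α →ₗ[ℂ] BoundedContinuousFunction ℕ ℂ :=
    { toFun := fun f => BoundedContinuousFunction.ofNormedAddCommGroupDiscrete
        (fun n => (a n : ℂ) * minusVal p α f ((1 - s n : ℝ) : ℂ)) (hex f).choose (hex f).choose_spec
      map_add' := fun f g => by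
        ext n
        simp [mul_add]
      map_smul' := fun c f => by
        ext n
        simp [mul_left_comm] }
  refine ⟨L, continuous_minus L hα fun μ hμ0 hμα => ?_, fun f n => rfl⟩
  obtain ⟨C, hC0, hC⟩ := hest μ hμ0 hμα
  refine AddMonoidHomClass.continuous_of_bound (L.comp (bergmanToMinus p α hμα)) C fun f => ?_
  rw [norm_bergman]
  refine (BoundedContinuousFunction.norm_le (mul_nonneg hC0 (bnorm_nonneg _ _ _))).2 fun n => ?_
  exact hC _ f.2 n

/-- A neighbourhood of `0` contains a ball of unknown radius `r n` in each step `μ n ↑ α`. A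
continuous map into bounded sequences, sampling at the points `1 - s n`, is unbounded on the image
of these balls, so the image lies in no compact set. -/
theorem not_isCompactOperator_cesaroMinus {p : ℝ≥0∞} [Fact (1 ≤ p)] (hp : 1 < p) (hpt : p ≠ ∞)
    {α : ℝ} (hα : 0 < α) : ¬ IsCompactOperator (cesaroMinus (α := α) hp hpt hα) := by
  rintro ⟨C, hC, hU⟩
  have hq := one_lt_toReal hp hpt
  have hq0 : 0 < p.toReal := by linarith
  set μ : ℕ → ℝ := fun n => α - α / ((n : ℝ) + 2) with hμ
  have hμ0 : ∀ n, 0 ≤ μ n := fun n => by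
    have : α / ((n : ℝ) + 2) ≤ α := div_le_self hα.le (by linarith [Nat.cast_nonneg (α := ℝ) n])
    simp only [hμ]; linarith
  have hμα : ∀ n, μ n < α := fun n => sub_lt_self α (by positivity)
  -- Taking the exponent for `α` makes one `N` serve all `μ n < α`.
  obtain ⟨N, hN, -⟩ := exists_flowInt_exponent (μ := α) (a := 0) hq
  have hball : ∀ n, ∃ r, 0 < r ∧ ∀ f : BergmanMinus p α, minusVal p α f ∈ bergman p (μ n) →
      bnorm p (μ n) (minusVal p α f) < r → cesaroMinus hp hpt hα f ∈ C := by
    intro n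
    have h1 := (continuous_bergmanToMinus (p := p) (hμα n)).tendsto 0
    rw [map_zero] at h1
    obtain ⟨r, hr, hr2⟩ := Metric.mem_nhds_iff.1 (h1 hU)
    refine ⟨r, hr, fun f hf hfr => ?_⟩
    have h2 : bergmanMk _ hf ∈ ball (0 : Bergman p (μ n)) r := by
      rw [mem_ball_zero_iff, norm_bergman, bergmanMk_val]
      exact hfr
    have h3 : bergmanToMinus p α (hμα n) (bergmanMk _ hf) = f := by
      apply minusVal_injective
      rw [minusVal_bergmanToMinus, bergmanMk_val]
    rw [← h3]
    exact hr2 h2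
  choose r hr hrC using hball
  have hκ : ∀ n, ∃ κ : ℝ, 0 < κ ∧ ∀ s : ℝ, 0 < s → s ≤ 1 → ∃ c : ℂ,
      bnorm p (μ n) (c • prePeak N s) < r n ∧
      κ * s ^ (-((μ n + 2) / p.toReal)) ≤ ‖c * peak N s ((1 - s : ℝ) : ℂ)‖ := fun n =>
    exists_scaled_prePeak hp hpt (hμ0 n) (by linarith [hμα n]) (hr n)
  choose κ hκ0 hκs using hκ
  -- The radii, and so `κ n`, are uncontrolled; `s n` is chosen afterwards, small enough to beat `n
  -- / κ n` even with the tiny exponent `1 / (n + 1)`.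
  choose s hs0 hs1 hs using fun n => exists_small_rpow (κ n) n
  choose c hc1 hc2 using fun n => hκs n (s n) (hs0 n) (hs1 n)
  -- Normalised so that the `n`-th sample of the `n`-th image has size at least `n`. On a fixed step
  -- `ν < α` the samples stay bounded since eventually `(μ n - ν) / p ≥ 1 / (n + 1)`.
  set a : ℕ → ℝ := fun n => n / κ n * s n ^ ((μ n + 2) / p.toReal) with ha
  have ha0 : ∀ n, 0 ≤ a n := fun n =>
    mul_nonneg (div_nonneg n.cast_nonneg (hκ0 n).le) (Real.rpow_nonneg (hs0 n).le _)
  have hbd : ∀ ν, 0 < ν → ν < α → ∃ B, ∀ n, a n * s n ^ (-((ν + 2) / p.toReal)) ≤ B := by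
    intro ν _ hν
    have hlim : Tendsto (fun n : ℕ => α / ((n : ℝ) + 2) + p.toReal * (1 / ((n : ℝ) + 1))) atTop
        (𝓝 0) := by
      have h1 : Tendsto (fun n : ℕ => α / ((n : ℝ) + 2)) atTop (𝓝 0) :=
        tendsto_const_nhds.div_atTop
          (tendsto_atTop_add_const_right _ _ tendsto_natCast_atTop_atTop)
      have h2 := (tendsto_one_div_add_atTop_nhds_zero_nat (𝕜 := ℝ)).const_mul p.toReal
      simpa using h1.add h2
    have hev : ∀ᶠ n : ℕ in atTop, a n * s n ^ (-((ν + 2) / p.toReal)) ≤ 1 := by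
      filter_upwards [hlim.eventually (eventually_le_nhds (sub_pos.2 hν))] with n hn
      refine le_trans ?_ (hs n)
      rw [ha]
      simp only
      rw [mul_assoc, ← Real.rpow_add (hs0 n)]
      refine mul_le_mul_of_nonneg_left ?_ (div_nonneg n.cast_nonneg (hκ0 n).le)
      refine Real.rpow_le_rpow_of_exponent_ge (hs0 n) (hs1 n) ?_
      rw [← sub_eq_add_neg, ← sub_div, le_div_iff₀ hq0]
      simp only [hμ]
      linarith
    obtain ⟨B, hB⟩ := (isBoundedUnder_of_eventually_le hev).bddAbove_range
    exact ⟨B, fun n => hB ⟨n, rfl⟩⟩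
  obtain ⟨L, hL, hLapp⟩ := exists_sampling hpt hα hs0 hs1 ha0 hbd
  obtain ⟨M, hM⟩ := (hC.image hL).isBounded.exists_norm_le
  obtain ⟨n, hn⟩ := exists_nat_gt M
  have hmem : c n • prePeak N (s n) ∈ bergman p (μ n) :=
    (bergman p (μ n)).smul_mem _ (prePeak_mem hpt (hμ0 n) N (hs0 n) (hs1 n))
  let f : BergmanMinus p α := minusMk (c n • prePeak N (s n)) ⟨μ n, hμα n, hmem⟩
  have hf := hM _ ⟨_, hrC n f hmem (hc1 n), rfl⟩
  have h1 := (BoundedContinuousFunction.norm_coe_le_norm (L (cesaroMinus hp hpt hα f)) n).trans hf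
  have hval : minusVal p α (cesaroMinus hp hpt hα f) ((1 - s n : ℝ) : ℂ) =
      c n * peak N (s n) ((1 - s n : ℝ) : ℂ) := cesaroDisc_smul_prePeak N (hs0 n) (hs1 n) (c n)
  rw [hLapp, hval, norm_mul, Complex.norm_real, Real.norm_of_nonneg (ha0 n)] at h1
  have h2 := mul_le_mul_of_nonneg_left (hc2 n) (ha0 n)
  have h3 : a n * (κ n * s n ^ (-((μ n + 2) / p.toReal))) = n := by
    have e : s n ^ ((μ n + 2) / p.toReal) * s n ^ (-((μ n + 2) / p.toReal)) = 1 := by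
      rw [← Real.rpow_add (hs0 n), add_neg_cancel, Real.rpow_zero]
    have := (hκ0 n).ne'
    calc _ = n / κ n * κ n * (s n ^ ((μ n + 2) / p.toReal) *
          s n ^ (-((μ n + 2) / p.toReal))) := by rw [ha]; ring
      _ = n := by rw [e, div_mul_cancel₀ _ this, mul_one]
  linarith


/-! ### Topology of the two spectra. -/

theorem inv_mul_ne_one {γ : ℂ} (h : γ.im ≠ 0) (m : ℕ) : γ⁻¹ * (m + 1) ≠ 1 := by
  intro hm
  have h0 : γ ≠ 0 := by rintro rfl; simp at h
  have h1 : γ = m + 1 := by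
    field_simp at hm
    exact hm.symm
  apply h
  rw [h1]
  simp

theorem tendsto_inv_perturb {γ : ℂ} (h : γ ≠ 0) (w : ℂ) :
    Tendsto (fun n : ℕ => (γ + (1 / ((n : ℝ) + 1) : ℝ) * w)⁻¹) atTop (𝓝 γ⁻¹) := by
  have h1 := (Complex.continuous_ofReal.tendsto 0).comp
    (tendsto_one_div_add_atTop_nhds_zero_nat (𝕜 := ℝ))
  have h2 := ((h1.mul_const w).const_add γ).inv₀ (by simpa using h)
  simpa using h2

/-- The spectrum is not closed: `1 / γ` with `γ = (α + 2) / p + i` is a resolvent point, but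
shifting `γ` to the right gives spectral points converging to it. The imaginary part avoids the
values `1 / (m + 1)`. -/
theorem not_isCompact_spectrum_cesaroPlus {p : ℝ≥0∞} [Fact (1 ≤ p)] (hp : 1 < p) (hpt : p ≠ ∞)
    {α : ℝ} (hα : 0 < α) : ¬ IsCompact (spectrum ℂ (cesaroPlus (α := α) hp hpt hα)) := by
  intro hc
  have hq0 : 0 < p.toReal := by linarith [one_lt_toReal hp hpt]
  set b := (α + 2) / p.toReal with hb
  set γ : ℂ := b + Complex.I with hγ
  have him : γ.im = 1 := by simp [hγ]
  have hre : γ.re = b := by simp [hγ]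
  have hγ0 : γ ≠ 0 := fun h => by rw [h] at him; simp at him
  refine notMem_spectrum_cesaroPlus hp hpt hα (inv_ne_zero hγ0) ?_
    (inv_mul_ne_one (by rw [him]; exact one_ne_zero))
    (hc.isClosed.mem_of_tendsto (tendsto_inv_perturb hγ0 1) (.of_forall fun n => ?_))
  · rw [inv_inv, hre, hb, div_mul_cancel₀ _ hq0.ne']
  · have hn : (0 : ℝ) < 1 / ((n : ℝ) + 1) := Nat.one_div_pos_of_nat
    refine mem_spectrum_cesaroPlus hp hpt hα ?_ (inv_mul_ne_one ?_)
    · rw [inv_inv, mul_one, Complex.add_re, Complex.ofReal_re, hre]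
      linarith
    · rw [mul_one, Complex.add_im, Complex.ofReal_im, him]
      norm_num

theorem accPt_spectrum_cesaroMinus {p : ℝ≥0∞} [Fact (1 ≤ p)] (hp : 1 < p) (hpt : p ≠ ∞)
    {α : ℝ} (hα : 0 < α) {l : ℂ} (hl0 : l ≠ 0) (hl : (α + 2) / p.toReal ≤ l⁻¹.re) :
    AccPt l (𝓟 (spectrum ℂ (cesaroMinus (α := α) hp hpt hα))) := by
  rw [accPt_iff_frequently]
  -- `1 / l` is moved by `t (1 + σ i)`: strictly right of the critical line, and away from the real
  -- axis when `σ` has the sign of the imaginary part.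
  obtain ⟨σ, hσ⟩ : ∃ σ : ℝ, ∀ t : ℝ, 0 < t → l⁻¹.im + t * σ ≠ 0 := by
    rcases le_total 0 l⁻¹.im with h | h
    · exact ⟨1, fun t ht => by linarith⟩
    · exact ⟨-1, fun t ht => by linarith⟩
  have htend := tendsto_inv_perturb (inv_ne_zero hl0) (1 + σ * Complex.I)
  rw [inv_inv] at htend
  refine htend.frequently (Frequently.of_forall fun n => ?_)
  set t : ℝ := 1 / ((n : ℝ) + 1) with ht
  have ht0 : 0 < t := Nat.one_div_pos_of_nat
  have hre : (l⁻¹ + t * (1 + σ * Complex.I)).re = l⁻¹.re + t := by simp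
  have him : (l⁻¹ + t * (1 + σ * Complex.I)).im = l⁻¹.im + t * σ := by simp
  refine ⟨fun h => ?_, mem_spectrum_cesaroMinus hp hpt hα ?_ (inv_mul_ne_one ?_)⟩
  · rw [inv_eq_iff_eq_inv] at h
    rw [h] at hre
    linarith
  · rw [inv_inv, hre]
    linarith
  · rw [him]
    exact hσ t ht0

end Cesaro

end

theorem proposition2p6 (p : ℝ≥0∞) [Fact (1 ≤ p)] (hp : 1 < p) (hp' : p < ∞)
    (α : ℝ) (hα : 0 < α) :
    (∃ T : Cesaro.BergmanPlus p α →L[ℂ] Cesaro.BergmanPlus p α,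
      (∀ f : Cesaro.BergmanPlus p α, ∀ z ∈ ball (0 : ℂ) 1, T f z = Cesaro.cesaro f z) ∧
      ¬ IsCompactOperator T ∧
      ¬ IsCompact (spectrum ℂ T)) ∧
    (∃ T : Cesaro.BergmanMinus p α →L[ℂ] Cesaro.BergmanMinus p α,
      (∀ f : Cesaro.BergmanMinus p α, ∀ z ∈ ball (0 : ℂ) 1, T f z = Cesaro.cesaro f z) ∧
      ¬ IsCompactOperator T ∧
      (∃ l ∈ spectrum ℂ T, l ≠ 0 ∧ AccPt l (𝓟 (spectrum ℂ T))) ∧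
      (∀ l ∈ spectrum ℂ T, l ≠ 0 →
        ¬ Module.End.HasEigenvalue (T : Module.End ℂ (Cesaro.BergmanMinus p α)) l →
        AccPt l (𝓟 (spectrum ℂ T)))) := by
  have hq0 : 0 < p.toReal := by linarith [Cesaro.one_lt_toReal hp hp'.ne]
  refine ⟨⟨Cesaro.cesaroPlus hp hp'.ne hα, fun f z hz => Set.indicator_of_mem hz _,
    Cesaro.not_isCompactOperator_cesaroPlus hp hp'.ne hα,
    Cesaro.not_isCompact_spectrum_cesaroPlus hp hp'.ne hα⟩,
    ⟨Cesaro.cesaroMinus hp hp'.ne hα, fun f z hz => Set.indicator_of_mem hz _,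
    Cesaro.not_isCompactOperator_cesaroMinus hp hp'.ne hα, ?_, fun l hl hl0 hev => ?_⟩⟩
  -- A nonreal point strictly right of the critical line.
  · set γ : ℂ := ((α + 2) / p.toReal + 1 : ℝ) + Complex.I with hγ
    have him : γ.im = 1 := by simp [hγ]
    have hre : γ.re = (α + 2) / p.toReal + 1 := by simp [hγ]
    have hγ0 : γ ≠ 0 := fun h => by rw [h] at him; simp at him
    refine ⟨γ⁻¹, Cesaro.mem_spectrum_cesaroMinus hp hp'.ne hα ?_
      (Cesaro.inv_mul_ne_one (by rw [him]; exact one_ne_zero)), inv_ne_zero hγ0,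
      Cesaro.accPt_spectrum_cesaroMinus hp hp'.ne hα (inv_ne_zero hγ0) ?_⟩
    all_goals
      rw [inv_inv, hre]
      linarith
  -- Left of the critical line a spectral point must be some `1 / (m + 1)`, hence an eigenvalue.
  · rcases le_or_gt ((α + 2) / p.toReal) l⁻¹.re with h | h
    · exact Cesaro.accPt_spectrum_cesaroMinus hp hp'.ne hα hl0 h
    · rw [lt_div_iff₀ hq0] at h
      by_cases hn : ∀ m : ℕ, l * (m + 1) ≠ 1
      · exact absurd hl (Cesaro.notMem_spectrum_cesaroMinus hp hp'.ne hα hl0 h hn)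
      · push Not at hn
        obtain ⟨m, hm⟩ := hn
        exact absurd (Cesaro.hasEigenvalue_cesaroMinus hp hp'.ne hα h hm) hev
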